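/- An SMTI-OLC instance $I$ consists of finite sets $W$ (workers), $F$ (firms) and $E=\{e_1,\dots,e_n\}$ (contracts); each contract $e$ has one worker $\mathrm{w}(e)$ and one firm $\mathrm{f}(e)$. Write $E_a$ for the contracts of an agent $a$, and $M_a=M\cap E_a$. Each worker $w$ has a preference list $P_w$ with ties on some subset of $E_w$ (contracts of $E_w$ not on $P_w$ are unacceptable to $w$). Each firm $f$ has a preference list $P_f$ on all of $E_f$ and upper quotas $q_f\colon\mathcal L_f\to\mathbb Z_{\ge 0}$ on a laminar family $\mathcal L_f$ of subsets of $E_f$. A set $M\subseteq E$ is feasible for $f$ if $|M_f\cap L|\le q_f(L)$ for all $L\in\mathcal L_f$. A matching is a set $M$ of acceptable contracts with $|M_w|\le 1$ for every worker $w$ that is feasible for every firm. A contract $e\notin M$ blocks $M$ if $e$ is acceptable to $w=\mathrm{w}(e)$ and $M_w=\emptyset$ or $w$ strictly prefers $e$ to the contract in $M_w$, and moreover, for $f=\mathrm{f}(e)$, $M_f+e$ is feasible for $f$ or there is $e'\in M_f$ such that $f$ strictly prefers $e$ to $e'$ and $M_f+e-e'$ is feasible for $f$. A matching is stable if no contract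 blocks it. A worker $w$ weakly prefers $M$ to $M'$ with respect to $P_w$ if $w$ has no contract on $P_w$ in $M'$, or has contracts on $P_w$ in both and does not strictly prefer the one in $M'$. A stable matching is worker-optimal if every worker weakly prefers it to every stable matching. The auxiliary instance $I^*$ has the same agents and three copies $x_i,y_i,z_i$ of each $e_i$. The list $P^*_w$ is obtained from $P_w$ by replacing each tie (a contract in no tie being a tie of length one) with its $x$-copies followed by its $y$-copies, and then appending the $z$-copies of the whole list, in each case in the order of the list and by increasing index within a tie; $P^*_f$ is obtained from $P_f$ in the same way with the roles of $x$ and $z$ interchanged. The constraints of $f$ in $I^*$ are: at most one of $x_i,y_i,z_i$ for each $e_i\in E_f$, and, for each $L\in\mathcal L_f$, at most $q_f(L)$ of the copies of the contracts in $L$. Let $\pi(S^*)=\{e_i : S^*\cap\{x_i,y_i,z_i\}\ne\emptyset\}$. Theorem. Consider the SMTI-OLC instances in which ties appear only in workers' lists. For every such instance $I$, the instance $I^*$ has exactly one worker-optimal stable matching $M^*$. The mechanism $I\mapsto M:=\pi(M^*)$ is worker-strategy-proof: if $I'$ is obtained from $I$ by replacing the list $P_w$ of one worker $w$ with any other list on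 a subset of $E_w$, then $w$ weakly prefers the output for $I$ to the output for $I'$ with respect to $P_w$. Its output $M$ is a stable matching of $I$ with $|M|\ge\frac23|M_{\mathrm{OPT}}|$, where $M_{\mathrm{OPT}}$ is a maximum-cardinality stable matching of $I$. Moreover, $M$ can be computed by a random access machine in $O(k\cdot|E|^2)$ time, where $k$ is the maximum level of nesting of the families $\mathcal L_f$ $(f\in F)$, that is, the maximum length of a chain $L_1\subsetneq\cdots\subsetneq L_k$ in one of them (in the time bound, $k$ and $|E|$ are read as $1$ if they are $0$). -/

import Mathlib

namespace SMTI

/-! ### Preference lists with ties -/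

/-- A preference list with ties, best tie first. A contract that is in no tie does not appear on
the list. -/
abbrev PrefList (E : Type*) := List (Finset E)

section PrefLists

variable {E : Type*}

/-- The contract `e` appears on the list `P`. -/
def Listed (P : PrefList E) (e : E) : Prop := ∃ T ∈ P, e ∈ T

/-- Strict preference: the tie of `e` stands before the tie of `d` on the list `P`. -/
def Prefers (P : PrefList E) (e d : E) : Prop := ∃ S T, [S, T].Sublist P ∧ e ∈ S ∧ d ∈ T

/-- `P` is a preference list with ties on a subset of `S`: its ties are nonempty and pairwise
disjoint, and contain only contracts of `S`. -/
def IsPrefListOn (S : Set E) (P : PrefList E) : Prop :=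
  (∀ T ∈ P, T.Nonempty) ∧ P.Pairwise Disjoint ∧ ∀ e, Listed P e → e ∈ S

/-- The list has no (proper) ties. -/
def IsStrictList (P : PrefList E) : Prop := ∀ T ∈ P, T.card = 1

/-- A laminar family of sets. -/
def IsLaminar (𝓛 : Finset (Finset E)) : Prop :=
  ∀ L ∈ 𝓛, ∀ K ∈ 𝓛, L ⊆ K ∨ K ⊆ L ∨ Disjoint L K

open Classical in
/-- The level of nesting of a family of sets: the maximum length of a chain
`L₁ ⊊ L₂ ⊊ ⋯ ⊊ Lₖ` of its members. -/
noncomputable def nestingLevel (𝓛 : Finset (Finset E)) : ℕ :=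
  (𝓛.powerset.filter fun C : Finset (Finset E) =>
    IsChain (· ⊆ ·) (C : Set (Finset E))).sup Finset.card

end PrefLists

/-! ### Instances, matchings, stability -/

/-- The data of an instance of stable matching with ties and one-sided laminar constraints, with
workers `W`, firms `F` and contracts `E`. The values `quota f L` matter only for
`L ∈ laminar f`. -/
structure OLC (W F E : Type*) where
  /-- the worker of a contract -/
  worker : E → W
  /-- the firm of a contract -/
  firm : E → F
  /-- the preference list of a worker -/
  workerPref : W → PrefList E
  /-- the preference list of a firm -/
  firmPref : F → PrefList E
  /-- the family of sets on which a firm has upper quotas -/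
  laminar : F → Finset (Finset E)
  /-- the upper quotas of a firm -/
  quota : F → Finset E → ℕ

namespace OLC

section Basic

variable {W F E : Type*}

/-- The conditions that the data of an instance satisfy: each worker lists some of her contracts,
each firm lists all of its contracts, and each firm has quotas on a laminar family of sets of its
contracts. -/
structure IsInstance (I : OLC W F E) : Prop where
  workerPref_on : ∀ w, IsPrefListOn {e | I.worker e = w} (I.workerPref w)
  firmPref_on : ∀ f, IsPrefListOn {e | I.firm e = f} (I.firmPref f)
  firmPref_all : ∀ e, Listed (I.firmPref (I.firm e)) e
  laminar_sub : ∀ f, ∀ L ∈ I.laminar f, ∀ e ∈ L, I.firm e = f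
  laminar : ∀ f, IsLaminar (I.laminar f)

/-- Ties appear only in the lists of the workers. -/
def TiesOnlyInWorkers (I : OLC W F E) : Prop := ∀ f, IsStrictList (I.firmPref f)

/-- The maximum level of nesting of the families of the firms. -/
noncomputable def nesting [Fintype F] (I : OLC W F E) : ℕ :=
  Finset.univ.sup fun f => nestingLevel (I.laminar f)

/-- The instance in which the list of the worker `w` is replaced with `P`. -/
def replaceList [DecidableEq W] (I : OLC W F E) (w : W) (P : PrefList E) : OLC W F E :=
  { I with workerPref := Function.update I.workerPref w P }

variable [DecidableEq W] [DecidableEq F] [DecidableEq E]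

/-- The contracts of `M` that are assigned to the worker `w`. -/
def ofWorker (I : OLC W F E) (M : Finset E) (w : W) : Finset E := M.filter fun e => I.worker e = w

/-- The contracts of `M` that are assigned to the firm `f`. -/
def ofFirm (I : OLC W F E) (M : Finset E) (f : F) : Finset E := M.filter fun e => I.firm e = f

/-- The set `M` is feasible for the firm `f`. -/
def FirmFeasible (I : OLC W F E) (f : F) (M : Finset E) : Prop :=
  ∀ L ∈ I.laminar f, (I.ofFirm M f ∩ L).card ≤ I.quota f L

/-- Matchings: only acceptable contracts, at most one contract for each worker, and feasible for
each firm. -/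
def IsMatching (I : OLC W F E) (M : Finset E) : Prop :=
  (∀ e ∈ M, Listed (I.workerPref (I.worker e)) e) ∧
    (∀ w, (I.ofWorker M w).card ≤ 1) ∧ ∀ f, I.FirmFeasible f M

/-- The contract `e` is free for its worker in `M`. -/
def FreeForWorker (I : OLC W F E) (M : Finset E) (e : E) : Prop :=
  Listed (I.workerPref (I.worker e)) e ∧
    (I.ofWorker M (I.worker e) = ∅ ∨
      ∃ d ∈ I.ofWorker M (I.worker e), Prefers (I.workerPref (I.worker e)) e d)

/-- The contract `e` is free for its firm in `M`. -/
def FreeForFirm (I : OLC W F E) (M : Finset E) (e : E) : Prop :=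
  I.FirmFeasible (I.firm e) (insert e (I.ofFirm M (I.firm e))) ∨
    ∃ d ∈ I.ofFirm M (I.firm e), Prefers (I.firmPref (I.firm e)) e d ∧
      I.FirmFeasible (I.firm e) ((insert e (I.ofFirm M (I.firm e))).erase d)

/-- Stable matchings: no contract outside `M` blocks `M`. -/
def IsStable (I : OLC W F E) (M : Finset E) : Prop :=
  I.IsMatching M ∧ ∀ e, e ∉ M → ¬ (I.FreeForWorker M e ∧ I.FreeForFirm M e)

/-- Stable matchings of maximum cardinality. -/
def IsMaxStable (I : OLC W F E) (M : Finset E) : Prop :=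
  I.IsStable M ∧ ∀ N, I.IsStable N → N.card ≤ M.card

/-- The worker `w` weakly prefers `M` to `N` with respect to her list in `I`: either she is not
assigned a listed contract in `N`, or she is assigned listed contracts in both and does not
strictly prefer the one in `N`. -/
def WeaklyPrefers (I : OLC W F E) (w : W) (M N : Finset E) : Prop :=
  (∀ d ∈ I.ofWorker N w, ¬ Listed (I.workerPref w) d) ∨
    ∃ e ∈ I.ofWorker M w, ∃ d ∈ I.ofWorker N w, Listed (I.workerPref w) e ∧
      Listed (I.workerPref w) d ∧ ¬ Prefers (I.workerPref w) d e

/-- Worker-optimal stable matchings. -/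
def IsWorkerOptimal (I : OLC W F E) (M : Finset E) : Prop :=
  I.IsStable M ∧ ∀ N, I.IsStable N → ∀ w, I.WeaklyPrefers w M N

end Basic

end OLC

/-! ### The auxiliary instance

The copies `xᵢ`, `yᵢ`, `zᵢ` of the contract `i` are `(i, 0)`, `(i, 1)`, `(i, 2)`. -/

section Auxiliary

variable {n : ℕ}

/-- The copies number `c` of the contracts of a tie, by increasing index, without ties. -/
def copies (c : Fin 3) (T : Finset (Fin n)) : PrefList (Fin n × Fin 3) :=
  (T.sort (· ≤ ·)).map fun i => {(i, c)}

/-- Each tie is replaced with all its copies number `a` and then all its copies number `b`; the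
copies number `c` of the whole list follow at the end. -/
def auxList (a b c : Fin 3) (P : PrefList (Fin n)) : PrefList (Fin n × Fin 3) :=
  P.flatMap (fun T => copies a T ++ copies b T) ++ P.flatMap (copies c)

/-- All copies of the contracts in `L`. -/
def allCopies (L : Finset (Fin n)) : Finset (Fin n × Fin 3) := L ×ˢ Finset.univ

/-- The projection: the contracts of which `S` contains a copy. -/
def proj (S : Finset (Fin n × Fin 3)) : Finset (Fin n) := S.image Prod.fst

/-- The auxiliary instance. The members of the family of a firm are the sets of all copies of
one contract, with quota `1`, and the sets `allCopies L` for the old members `L`, with the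
old quota. If the singleton of a contract was an old member, then the two kinds coincide on it, and
both bounds apply. -/
def OLC.auxiliary {W F : Type*} [DecidableEq F] (I : OLC W F (Fin n)) :
    OLC W F (Fin n × Fin 3) where
  worker e := I.worker e.1
  firm e := I.firm e.1
  workerPref w := auxList 0 1 2 (I.workerPref w)
  firmPref f := auxList 2 1 0 (I.firmPref f)
  laminar f :=
    ((Finset.univ.filter fun i => I.firm i = f).image fun i => allCopies {i}) ∪
      (I.laminar f).image allCopies
  quota f S :=
    if (proj S).card = 1 then
      if proj S ∈ I.laminar f then min 1 (I.quota f (proj S)) else 1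
    else I.quota f (proj S)

end Auxiliary

/-! ### Mechanisms -/

/-- A mechanism assigns a set of contracts to each instance (the finite sets of workers, firms
and contracts are numbered). -/
abbrev Mechanism :=
  ∀ nW nF n : ℕ, OLC (Fin nW) (Fin nF) (Fin n) → Finset (Fin n)

/-- Worker-strategy-proofness of a mechanism on the instances in which ties appear only in the
lists of the workers: no worker gains by submitting another list. -/
def WorkerStrategyProof (A : Mechanism) : Prop :=
  ∀ (nW nF n : ℕ) (I : OLC (Fin nW) (Fin nF) (Fin n)), I.IsInstance → I.TiesOnlyInWorkers →
    ∀ (w : Fin nW) (P : PrefList (Fin n)), IsPrefListOn {e | I.worker e = w} P →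
      I.WeaklyPrefers w (A nW nF n I) (A nW nF n (I.replaceList w P))

/-! ### A random access machine

Programs use finitely many registers and finitely many arrays of natural numbers with indirect
addressing. Each elementary command and each test takes one step. The only arithmetic operations
are increment and decrement, so that no number exceeds the largest input number by more than the
number of steps (and a machine word of logarithmic length suffices). -/

/-- The memory: registers, and arrays. -/
structure Mem where
  reg : ℕ → ℕ
  arr : ℕ → ℕ → ℕ

/-- Write `v` into register `r`. -/
def Mem.setReg (s : Mem) (r v : ℕ) : Mem := { s with reg := Function.update s.reg r v }

/-- Write `v` into position `i` of array `a`. -/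
def Mem.setArr (s : Mem) (a i v : ℕ) : Mem :=
  { s with arr := Function.update s.arr a (Function.update (s.arr a) i v) }

/-- Tests compare two registers. -/
inductive Test where
  | lt (r₁ r₂ : ℕ)
  | eq (r₁ r₂ : ℕ)

/-- The test succeeds. -/
def Test.Holds : Test → Mem → Prop
  | .lt r₁ r₂, s => s.reg r₁ < s.reg r₂
  | .eq r₁ r₂, s => s.reg r₁ = s.reg r₂

/-- Programs. -/
inductive Prog where
  | skip
  | const (r c : ℕ)
  | move (r₁ r₂ : ℕ)
  | inc (r : ℕ)
  | dec (r : ℕ)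
  | load (r a i : ℕ)
  | store (a i r : ℕ)
  | seq (p q : Prog)
  | ite (b : Test) (p q : Prog)
  | loop (b : Test) (p : Prog)

/-- `Exec p s t s'`: started in memory `s`, the program `p` halts after exactly `t` steps, in
memory `s'`. -/
inductive Exec : Prog → Mem → ℕ → Mem → Prop where
  | skip (s) : Exec .skip s 1 s
  | const (s r c) : Exec (.const r c) s 1 (s.setReg r c)
  | move (s r₁ r₂) : Exec (.move r₁ r₂) s 1 (s.setReg r₁ (s.reg r₂))
  | inc (s r) : Exec (.inc r) s 1 (s.setReg r (s.reg r + 1))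
  | dec (s r) : Exec (.dec r) s 1 (s.setReg r (s.reg r - 1))
  | load (s r a i) : Exec (.load r a i) s 1 (s.setReg r (s.arr a (s.reg i)))
  | store (s a i r) : Exec (.store a i r) s 1 (s.setArr a (s.reg i) (s.reg r))
  | seq {p q s s₁ s₂ t₁ t₂} : Exec p s t₁ s₁ → Exec q s₁ t₂ s₂ → Exec (.seq p q) s (t₁ + t₂) s₂
  | ite_true {b p q s s₁ t} : b.Holds s → Exec p s t s₁ → Exec (.ite b p q) s (t + 1) s₁
  | ite_false {b p q s s₁ t} : ¬ b.Holds s → Exec q s t s₁ → Exec (.ite b p q) s (t + 1) s₁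
  | loop_true {b p s s₁ s₂ t₁ t₂} : b.Holds s → Exec p s t₁ s₁ →
      Exec (.loop b p) s₁ t₂ s₂ → Exec (.loop b p) s (t₁ + t₂ + 1) s₂
  | loop_false {b p s} : ¬ b.Holds s → Exec (.loop b p) s 1 s

/-! ### Instances as inputs -/

/-- The place of `e` on the list `P`: the number of its tie, counted from `1`, or `0` if `e` is
not listed. -/
def place {n : ℕ} (P : PrefList (Fin n)) (e : Fin n) : ℕ :=
  if P.any (fun T => decide (e ∈ T)) then P.findIdx (fun T => decide (e ∈ T)) + 1 else 0

/-- A way to write down the constraints of an instance: the pairs of a firm and a nonempty member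
of its family are numbered (a quota on the empty set is void), and membership is given by a list of
the pairs of a contract and the number of a set that contains it, in any order. -/
structure Presentation {nW nF n : ℕ} (I : OLC (Fin nW) (Fin nF) (Fin n)) where
  m : ℕ
  constraint : Fin m → Fin nF × Finset (Fin n)
  injective : Function.Injective constraint
  mem_range : ∀ f L, (f, L) ∈ Set.range constraint ↔ L ∈ I.laminar f ∧ L.Nonempty
  incidence : List (Fin n × Fin m)
  nodup : incidence.Nodup
  mem_incidence : ∀ e j, (e, j) ∈ incidence ↔ e ∈ (constraint j).2

/-- The memory that holds a list of numbers in an array, followed by zeros. -/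
def array (l : List ℕ) : ℕ → ℕ := fun i => l.getD i 0

/-- The initial memory. Registers: the numbers of contracts, of constraints, of incidences, of
workers, of firms. Arrays: for each contract its worker, its firm, its place on the list of the
worker, and its place on the list of the firm; for each constraint its quota; for each
incidence its contract and its constraint. Everything else is zero. -/
def Presentation.input {nW nF n : ℕ} {I : OLC (Fin nW) (Fin nF) (Fin n)} (c : Presentation I) :
    Mem where
  reg := array [n, c.m, c.incidence.length, nW, nF]
  arr a :=
    match a with
    | 0 => array (List.ofFn fun e => (I.worker e : ℕ))
    | 1 => array (List.ofFn fun e => (I.firm e : ℕ))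
    | 2 => array (List.ofFn fun e => place (I.workerPref (I.worker e)) e)
    | 3 => array (List.ofFn fun e => place (I.firmPref (I.firm e)) e)
    | 4 => array (List.ofFn fun j => I.quota (c.constraint j).1 (c.constraint j).2)
    | 5 => array (c.incidence.map fun x => (x.1 : ℕ))
    | 6 => array (c.incidence.map fun x => (x.2 : ℕ))
    | _ => fun _ => 0

/-- The memory holds the set `M` as its output: the indicator of `M` is in array `7`. -/
def Mem.Outputs {n : ℕ} (s : Mem) (M : Finset (Fin n)) : Prop :=
  ∀ e : Fin n, s.arr 7 e = if e ∈ M then 1 else 0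

end SMTI

/-! The sets that are feasible for a firm are the independent sets of a laminar matroid. If the firm
has no ties, then a contract outside a feasible set `M` is not free for the firm exactly when it
lies in the closure of the contracts of `M` that the firm prefers to it
(`OLC.mem_closure_better_iff`). Stability thus becomes a statement about closures. Closures can be
composed, and they bound cardinalities: an independent set in the closure of `B` has at most as many
elements as `B` (`card_le_of_subset_closure`).

Existence and uniqueness. The auxiliary instance has no ties, so deferred acceptance applies. Each
worker offers her favourite contract outside a set `R` of rejected ones. If the offers violate a
quota, then in a violated set with the fewest offers each offer is spanned by the others
(`mem_closure_laminarMatroid`), and the worst one is rejected. The invariant `OLC.Sound` says that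
no stable matching contains a rejected contract and that each rejected contract is spanned by better
offers. Once the offers are feasible, it makes them worker-optimal and stable. On strict lists there
is only one such matching.

Strategy-proofness. In an instance without ties, a worker who can get `c` by listing it alone gets
something at least as good with her true list. The proof truncates that list after `c` and uses that
a worker assigned in the worker-optimal matching is assigned in every stable one. In the auxiliary
instance a false list that yields a copy of `b` may be replaced with that copy alone. A third copy
may moreover be exchanged for the second, because the two are neighbours on the list of a firm
without ties. The true list then yields a copy at least as good as a first or second copy of `b`,
which cannot be a copy of a contract worse than `b`.

Ratio. Let `M` be the projection and `N` any stable matching. Let `A` be the contracts of `N` whose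
workers are unassigned in `M`, let `Q` be the contracts in `lostContracts`, and let `C` be the
contracts in `N` of the workers of `Q`. Firm by firm, `N` is spanned by `Q ∪ (N \ A)`, so `|A| ≤ |Q|
≤ |C|`. The disjoint sets `A` and `C` are both spanned by `M`, so `2|A| ≤ |M|`. Together with `|N \
A| ≤ |M|` this gives `2|N| ≤ 3|M|`.

Running time. The program runs this deferred acceptance without building the auxiliary instance: it
stores how many copies of each contract are rejected and compares integer keys. Each round but the
last rejects one of `3n` copies, and a round is linear in the size of the input. The sets through a
contract form a chain, so there are at most `n * k` incidences. -/

set_option linter.unusedSectionVars false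

namespace SMTI

/-! ### Preference lists with ties and positions on them -/

section Lists

variable {E : Type*}

theorem listed_nil (e : E) : ¬ Listed [] e := by simp [Listed]

theorem listed_cons {A : Finset E} {P : PrefList E} {e : E} :
    Listed (A :: P) e ↔ e ∈ A ∨ Listed P e := by simp [Listed]

theorem listed_append {P Q : PrefList E} {e : E} :
    Listed (P ++ Q) e ↔ Listed P e ∨ Listed Q e := by
  simp [Listed, or_and_right, exists_or]

theorem listed_flatMap {α : Type*} {P : List α} {g : α → PrefList E} {e : E} :
    Listed (P.flatMap g) e ↔ ∃ T ∈ P, Listed (g T) e := by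
  simp only [Listed, List.mem_flatMap]
  exact ⟨fun ⟨T, ⟨a, h, h'⟩, h''⟩ => ⟨a, h, T, h', h''⟩, fun ⟨a, h, T, h', h''⟩ => ⟨T, ⟨a, h, h'⟩, h''⟩⟩

theorem Prefers.listed_left {P : PrefList E} {e d : E} (h : Prefers P e d) : Listed P e := by
  obtain ⟨S, T, hs, he, -⟩ := h
  exact ⟨S, hs.subset (by simp), he⟩

theorem Prefers.listed_right {P : PrefList E} {e d : E} (h : Prefers P e d) : Listed P d := by
  obtain ⟨S, T, hs, -, hd⟩ := h
  exact ⟨T, hs.subset (by simp), hd⟩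

theorem prefers_nil {e d : E} : ¬ Prefers [] e d := fun h => listed_nil _ h.listed_left

theorem prefers_cons {A : Finset E} {P : PrefList E} {e d : E} :
    Prefers (A :: P) e d ↔ Prefers P e d ∨ (e ∈ A ∧ Listed P d) := by
  constructor
  · rintro ⟨S, T, hs, he, hd⟩
    rw [List.sublist_cons_iff] at hs
    rcases hs with hs | ⟨r, hr, hs⟩
    · exact Or.inl ⟨S, T, hs, he, hd⟩
    · simp only [List.cons.injEq] at hr
      obtain ⟨rfl, rfl⟩ := hr
      exact Or.inr ⟨he, T, by simpa using hs, hd⟩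
  · rintro (⟨S, T, hs, he, hd⟩ | ⟨he, T, hT, hd⟩)
    · exact ⟨S, T, hs.cons _, he, hd⟩
    · exact ⟨A, T, List.Sublist.cons_cons _ (by simpa using hT), he, hd⟩

theorem prefers_append {P Q : PrefList E} {e d : E} :
    Prefers (P ++ Q) e d ↔ Prefers P e d ∨ Prefers Q e d ∨ (Listed P e ∧ Listed Q d) := by
  induction P with
  | nil => simp [prefers_nil, listed_nil]
  | cons A P ih =>
    rw [List.cons_append, prefers_cons, prefers_cons, ih, listed_append, listed_cons]
    tauto

theorem prefers_flatMap {α : Type*} {P : List α} {g : α → PrefList E} {e d : E} :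
    Prefers (P.flatMap g) e d ↔ (∃ T ∈ P, Prefers (g T) e d) ∨
      ∃ S T, [S, T].Sublist P ∧ Listed (g S) e ∧ Listed (g T) d := by
  induction P with
  | nil => simp [prefers_nil]
  | cons A P ih =>
    rw [List.flatMap_cons, prefers_append, ih, listed_flatMap]
    constructor
    · rintro (h | (⟨T, hT, h⟩ | ⟨S, T, hs, h, h'⟩) | ⟨h, T, hT, h'⟩)
      · exact Or.inl ⟨A, by simp, h⟩
      · exact Or.inl ⟨T, by simp [hT], h⟩
      · exact Or.inr ⟨S, T, hs.cons _, h, h'⟩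
      · exact Or.inr ⟨A, T, List.Sublist.cons_cons _ (by simpa using hT), h, h'⟩
    · rintro (⟨T, hT, h⟩ | ⟨S, T, hs, h, h'⟩)
      · rcases List.mem_cons.1 hT with rfl | hT
        · exact Or.inl h
        · exact Or.inr (Or.inl (Or.inl ⟨T, hT, h⟩))
      · rw [List.sublist_cons_iff] at hs
        rcases hs with hs | ⟨r, hr, hs⟩
        · exact Or.inr (Or.inl (Or.inr ⟨S, T, hs, h, h'⟩))
        · simp only [List.cons.injEq] at hr
          obtain ⟨rfl, rfl⟩ := hr
          exact Or.inr (Or.inr ⟨h, T, by simpa using hs, h'⟩)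

variable [DecidableEq E]

/-- The index of the first tie of `P` that contains `e`. -/
def pos (P : PrefList E) (e : E) : ℕ := P.findIdx fun T => decide (e ∈ T)

theorem pos_cons (A : Finset E) (P : PrefList E) (e : E) :
    pos (A :: P) e = if e ∈ A then 0 else pos P e + 1 := by
  simp only [pos, List.findIdx_cons]
  by_cases h : e ∈ A <;> simp [h]

/-- Disjointness makes the first tie that contains a contract the only one, so comparing first
indices loses nothing. -/
theorem prefers_iff {P : PrefList E} (hP : P.Pairwise Disjoint) {e d : E} :
    Prefers P e d ↔ Listed P e ∧ Listed P d ∧ pos P e < pos P d := by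
  induction P with
  | nil => simp [prefers_nil, listed_nil]
  | cons A P ih =>
    rw [List.pairwise_cons] at hP
    have hA : ∀ x ∈ A, ¬ Listed P x := fun x hx ⟨T, hT, hxT⟩ =>
      Finset.disjoint_left.1 (hP.1 T hT) hx hxT
    rw [prefers_cons, ih hP.2, listed_cons, listed_cons, pos_cons, pos_cons]
    have he := hA e
    have hd := hA d
    by_cases h1 : e ∈ A <;> by_cases h2 : d ∈ A <;> simp_all

theorem mem_tie_iff {P : PrefList E} (hP : P.Pairwise Disjoint) {e d : E} :
    (∃ T ∈ P, e ∈ T ∧ d ∈ T) ↔ Listed P e ∧ Listed P d ∧ pos P e = pos P d := by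
  induction P with
  | nil => simp [listed_nil]
  | cons A P ih =>
    rw [List.pairwise_cons] at hP
    have hA : ∀ x ∈ A, ∀ T ∈ P, x ∉ T := fun x hx T hT hxT =>
      Finset.disjoint_left.1 (hP.1 T hT) hx hxT
    have hA' : ∀ x ∈ A, ¬ Listed P x := fun x hx ⟨T, hT, hxT⟩ => hA x hx T hT hxT
    rw [listed_cons, listed_cons, pos_cons, pos_cons]
    simp only [List.mem_cons, exists_eq_or_imp, ih hP.2]
    have he := hA' e
    have hd := hA' d
    by_cases h1 : e ∈ A <;> by_cases h2 : d ∈ A <;> simp_all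

theorem pos_injOn {P : PrefList E} (hP : P.Pairwise Disjoint) (hs : IsStrictList P) {e d : E}
    (he : Listed P e) (hd : Listed P d) (h : pos P e = pos P d) : e = d := by
  obtain ⟨T, hT, h1, h2⟩ := (mem_tie_iff hP).2 ⟨he, hd, h⟩
  exact Finset.card_le_one.1 (hs T hT).le e h1 d h2

theorem prefers_trichotomy {P : PrefList E} (hP : P.Pairwise Disjoint) (hs : IsStrictList P)
    {e d : E} (he : Listed P e) (hd : Listed P d) (hne : e ≠ d) :
    Prefers P e d ∨ Prefers P d e := by
  rw [prefers_iff hP, prefers_iff hP]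
  rcases lt_trichotomy (pos P e) (pos P d) with h | h | h
  · exact Or.inl ⟨he, hd, h⟩
  · exact absurd (pos_injOn hP hs he hd h) hne
  · exact Or.inr ⟨hd, he, h⟩

theorem Prefers.asymm {P : PrefList E} (hP : P.Pairwise Disjoint) {e d : E} (h : Prefers P e d) :
    ¬ Prefers P d e := by
  rw [prefers_iff hP] at *
  omega

theorem Prefers.ne {P : PrefList E} (hP : P.Pairwise Disjoint) {e d : E} (h : Prefers P e d) :
    e ≠ d := by
  rintro rfl
  exact h.asymm hP h

theorem Prefers.trans {P : PrefList E} (hP : P.Pairwise Disjoint) {e d c : E} (h : Prefers P e d)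
    (h' : Prefers P d c) : Prefers P e c := by
  rw [prefers_iff hP] at *
  exact ⟨h.1, h'.2.1, by omega⟩

theorem place_eq {n : ℕ} (P : PrefList (Fin n)) (e : Fin n) [Decidable (Listed P e)] :
    place P e = if Listed P e then pos P e + 1 else 0 := by
  have : (P.any fun T => decide (e ∈ T)) = true ↔ Listed P e := by simp [Listed]
  simp only [place, this, pos]

end Lists

/-! ### The order of the copies on an auxiliary list -/

section Copies

variable {n : ℕ}

theorem listed_copies {c : Fin 3} {T : Finset (Fin n)} {x : Fin n × Fin 3} :
    Listed (copies c T) x ↔ x.2 = c ∧ x.1 ∈ T := by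
  obtain ⟨e, i⟩ := x
  simp only [Listed, copies, List.mem_map, Finset.mem_sort]
  constructor
  · rintro ⟨S, ⟨j, hj, rfl⟩, h⟩
    simp only [Finset.mem_singleton, Prod.mk.injEq] at h
    exact ⟨h.2, h.1 ▸ hj⟩
  · rintro ⟨rfl, h⟩
    exact ⟨_, ⟨e, h, rfl⟩, by simp⟩

theorem prefers_map_singleton {l : List (Fin n)} (hl : l.Pairwise (· < ·)) {c : Fin 3}
    {x y : Fin n × Fin 3} : Prefers (l.map fun i => ({(i, c)} : Finset (Fin n × Fin 3))) x y ↔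
      x.2 = c ∧ y.2 = c ∧ x.1 ∈ l ∧ y.1 ∈ l ∧ x.1 < y.1 := by
  obtain ⟨e, i⟩ := x
  obtain ⟨d, j⟩ := y
  induction l with
  | nil => simp [prefers_nil]
  | cons a l ih =>
    rw [List.pairwise_cons] at hl
    rw [List.map_cons, prefers_cons, ih hl.2]
    have hL : Listed (l.map fun i => ({(i, c)} : Finset (Fin n × Fin 3))) (d, j) ↔
        j = c ∧ d ∈ l := by
      simp only [Listed, List.mem_map]
      constructor
      · rintro ⟨S, ⟨k, hk, rfl⟩, h⟩
        simp only [Finset.mem_singleton, Prod.mk.injEq] at h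
        exact ⟨h.2, h.1 ▸ hk⟩
      · rintro ⟨rfl, h⟩
        exact ⟨_, ⟨d, h, rfl⟩, by simp⟩
    simp only [hL, Finset.mem_singleton, Prod.mk.injEq, List.mem_cons]
    constructor
    · rintro (h | ⟨⟨rfl, rfl⟩, rfl, h⟩)
      · tauto
      · exact ⟨rfl, rfl, Or.inl rfl, Or.inr h, hl.1 _ h⟩
    · rintro ⟨rfl, rfl, rfl | h, h' | h', hlt⟩
      · subst h'; exact absurd hlt (lt_irrefl _)
      · exact Or.inr ⟨⟨rfl, rfl⟩, rfl, h'⟩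
      · subst h'; exact absurd hlt (hl.1 _ h).asymm
      · exact Or.inl ⟨rfl, rfl, h, h', hlt⟩

theorem prefers_copies {c : Fin 3} {T : Finset (Fin n)} {x y : Fin n × Fin 3} :
    Prefers (copies c T) x y ↔ x.2 = c ∧ y.2 = c ∧ x.1 ∈ T ∧ y.1 ∈ T ∧ x.1 < y.1 := by
  rw [copies, prefers_map_singleton (T.sortedLT_sort).pairwise]
  simp

theorem listed_auxList {a b c : Fin 3} (h : ∀ i, i = a ∨ i = b ∨ i = c) {P : PrefList (Fin n)}
    {x : Fin n × Fin 3} : Listed (auxList a b c P) x ↔ Listed P x.1 := by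
  simp only [auxList, listed_append, listed_flatMap, listed_copies]
  constructor
  · rintro (⟨T, hT, h | h⟩ | ⟨T, hT, h⟩) <;> exact ⟨T, hT, h.2⟩
  · rintro ⟨T, hT, hx⟩
    rcases h x.2 with h | h | h
    · exact Or.inl ⟨T, hT, Or.inl ⟨h, hx⟩⟩
    · exact Or.inl ⟨T, hT, Or.inr ⟨h, hx⟩⟩
    · exact Or.inr ⟨T, hT, ⟨h, hx⟩⟩

theorem isStrictList_auxList (a b c : Fin 3) (P : PrefList (Fin n)) :
    IsStrictList (auxList a b c P) := by
  intro T hT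
  simp only [auxList, copies, List.mem_append, List.mem_flatMap, List.mem_map] at hT
  rcases hT with ⟨_, _, ⟨_, _, rfl⟩ | ⟨_, _, rfl⟩⟩ | ⟨_, _, ⟨_, _, rfl⟩⟩ <;> simp

theorem pairwise_disjoint_copies (c : Fin 3) (T : Finset (Fin n)) :
    (copies c T).Pairwise Disjoint := by
  rw [copies, List.pairwise_map]
  refine (T.sortedLT_sort).pairwise.imp fun h => ?_
  simpa using fun h' : _ = _ => absurd h (by simp [h'])

theorem disjoint_of_mem_copies {c d : Fin 3} {S T : Finset (Fin n)} (h : c ≠ d ∨ Disjoint S T)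
    {X Y : Finset (Fin n × Fin 3)} (hX : X ∈ copies c S) (hY : Y ∈ copies d T) : Disjoint X Y := by
  simp only [copies, List.mem_map, Finset.mem_sort] at hX hY
  obtain ⟨i, hi, rfl⟩ := hX
  obtain ⟨j, hj, rfl⟩ := hY
  simp only [Finset.disjoint_singleton, ne_eq, Prod.mk.injEq, not_and]
  rintro rfl rfl
  rcases h with h | h
  · exact h rfl
  · exact Finset.disjoint_left.1 h hi hj

theorem pairwise_disjoint_auxList {a b c : Fin 3} (hab : a ≠ b) (hac : a ≠ c) (hbc : b ≠ c)
    {P : PrefList (Fin n)} (hP : P.Pairwise Disjoint) : (auxList a b c P).Pairwise Disjoint := by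
  rw [auxList, List.pairwise_append, List.pairwise_flatMap, List.pairwise_flatMap]
  refine ⟨⟨fun T _ => ?_, hP.imp fun h x hx y hy => ?_⟩,
    ⟨fun T _ => pairwise_disjoint_copies _ _, hP.imp fun h x hx y hy =>
      disjoint_of_mem_copies (Or.inr h) hx hy⟩, fun x hx y hy => ?_⟩
  · rw [List.pairwise_append]
    exact ⟨pairwise_disjoint_copies _ _, pairwise_disjoint_copies _ _,
      fun x hx y hy => disjoint_of_mem_copies (Or.inl hab) hx hy⟩
  · rw [List.mem_append] at hx hy
    rcases hx with hx | hx <;> rcases hy with hy | hy <;>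
      exact disjoint_of_mem_copies (Or.inr h) hx hy
  · simp only [List.mem_flatMap, List.mem_append] at hx hy
    obtain ⟨S, -, hx⟩ := hx
    obtain ⟨T, -, hy⟩ := hy
    rcases hx with hx | hx
    · exact disjoint_of_mem_copies (Or.inl hac) hx hy
    · exact disjoint_of_mem_copies (Or.inl hbc) hx hy

theorem isPrefListOn_auxList {a b c : Fin 3} (hab : a ≠ b) (hac : a ≠ c) (hbc : b ≠ c)
    (h : ∀ i, i = a ∨ i = b ∨ i = c) {P : PrefList (Fin n)} {S : Set (Fin n)}
    (hP : IsPrefListOn S P) : IsPrefListOn {x | x.1 ∈ S} (auxList a b c P) := by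
  refine ⟨fun T hT => ?_, pairwise_disjoint_auxList hab hac hbc hP.2.1, fun x hx => ?_⟩
  · rw [← Finset.card_pos, isStrictList_auxList a b c P T hT]
    exact one_pos
  · exact hP.2.2 _ ((listed_auxList h).1 hx)

set_option maxHeartbeats 1000000 in
/-- The order of the copies on an auxiliary list: first by being a copy number `c` or not, then by
the tie, then copies number `a` before copies number `b`, then by index. -/
theorem prefers_auxList {a b c : Fin 3} (hab : a ≠ b) (hac : a ≠ c) (hbc : b ≠ c)
    (h : ∀ i, i = a ∨ i = b ∨ i = c) {P : PrefList (Fin n)} (hP : P.Pairwise Disjoint)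
    {e d : Fin n} {i j : Fin 3} : Prefers (auxList a b c P) (e, i) (d, j) ↔
      Listed P e ∧ Listed P d ∧ ((i ≠ c ∧ j = c) ∨ ((i = c ↔ j = c) ∧ (pos P e < pos P d ∨
        pos P e = pos P d ∧ ((i = a ∧ j = b) ∨ (i = j ∧ e < d))))) := by
  have h2 := prefers_iff hP (e := e) (d := d)
  have h3 := mem_tie_iff hP (e := e) (d := d)
  simp only [auxList, prefers_append, prefers_flatMap, listed_append, listed_flatMap,
    listed_copies, prefers_copies]
  constructor
  · rintro ((⟨T, hT, h | h | h⟩ | ⟨S, T, hs, he, hd⟩) | (⟨T, hT, h⟩ | ⟨S, T, hs, he, hd⟩) |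
      ⟨⟨S, hS, he⟩, ⟨T, hT, hd⟩⟩)
    · have := h3.1 ⟨T, hT, h.2.2.1, h.2.2.2.1⟩
      grind
    · have := h3.1 ⟨T, hT, h.2.2.1, h.2.2.2.1⟩
      grind
    · have := h3.1 ⟨T, hT, h.1.2, h.2.2⟩
      grind
    · have := h2.1 ⟨S, T, hs, by tauto, by tauto⟩
      grind
    · have := h3.1 ⟨T, hT, h.2.2.1, h.2.2.2.1⟩
      grind
    · have := h2.1 ⟨S, T, hs, by tauto, by tauto⟩
      grind
    · have h4 : Listed P e := ⟨S, hS, by tauto⟩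
      have h5 : Listed P d := ⟨T, hT, by tauto⟩
      grind
  · rintro ⟨he, hd, ⟨h4, h5⟩ | ⟨h4, h5 | ⟨h5, h6⟩⟩⟩
    · obtain ⟨S, hS, he⟩ := he
      obtain ⟨T, hT, hd⟩ := hd
      refine Or.inr (Or.inr ⟨⟨S, hS, ?_⟩, T, hT, h5, hd⟩)
      have := h i
      tauto
    · obtain ⟨S, T, hs, h6, h7⟩ := h2.2 ⟨he, hd, h5⟩
      have h8 := h i
      have h9 := h j
      by_cases h10 : i = c
      · exact Or.inr (Or.inl (Or.inr ⟨S, T, hs, ⟨h10, h6⟩, h4.1 h10, h7⟩))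
      · refine Or.inl (Or.inr ⟨S, T, hs, ?_, ?_⟩) <;> tauto
    · obtain ⟨T, hT, h7, h8⟩ := h3.2 ⟨he, hd, h5⟩
      rcases h6 with ⟨rfl, rfl⟩ | ⟨rfl, h6⟩
      · exact Or.inl (Or.inl ⟨T, hT, Or.inr (Or.inr ⟨⟨rfl, h7⟩, rfl, h8⟩)⟩)
      · rcases h i with h9 | h9 | h9
        · exact Or.inl (Or.inl ⟨T, hT, Or.inl ⟨h9, h9, h7, h8, h6⟩⟩)
        · exact Or.inl (Or.inl ⟨T, hT, Or.inr (Or.inl ⟨h9, h9, h7, h8, h6⟩)⟩)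
        · exact Or.inr (Or.inl (Or.inl ⟨T, hT, ⟨h9, h9, h7, h8, h6⟩⟩))

end Copies

/-! ### Laminar matroids -/

section Laminar

variable {E : Type*} [DecidableEq E]

/-- Independence in a laminar matroid: the upper quotas are met. -/
def QuotaIndep (𝓛 : Finset (Finset E)) (q : Finset E → ℕ) (A : Finset E) : Prop :=
  ∀ L ∈ 𝓛, (A ∩ L).card ≤ q L

theorem QuotaIndep.mono {𝓛 : Finset (Finset E)} {q : Finset E → ℕ} {A B : Finset E}
    (hB : QuotaIndep 𝓛 q B) (h : A ⊆ B) : QuotaIndep 𝓛 q A := fun L hL =>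
  (Finset.card_le_card (Finset.inter_subset_inter_right h)).trans (hB L hL)

/-- One new element raises a count by at most one, and only in sets that contain it; a quota that it
breaks was attained before. -/
theorem QuotaIndep.exists_tight {𝓛 : Finset (Finset E)} {q : Finset E → ℕ} {A : Finset E}
    (hA : QuotaIndep 𝓛 q A) {e : E} (he : ¬ QuotaIndep 𝓛 q (insert e A)) :
    ∃ K ∈ 𝓛, e ∈ K ∧ (A ∩ K).card = q K := by
  simp only [QuotaIndep, not_forall, not_le] at he
  obtain ⟨K, hK, h⟩ := he
  have hA := hA K hK
  by_cases heK : e ∈ K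
  · refine ⟨K, hK, heK, ?_⟩
    rw [Finset.insert_inter_of_mem heK] at h
    have := Finset.card_insert_le e (A ∩ K)
    omega
  · rw [Finset.insert_inter_of_notMem heK] at h
    omega

/-- If no element of `B` can be added to `A`, then each element of `B` outside `A` lies in a tight
set. By laminarity the maximal tight sets are disjoint. In each of them `B` has at most as many
elements as `A`, and outside their union `B` is contained in `A`; so `B` is not larger than `A`. -/
theorem QuotaIndep.exists_insert {𝓛 : Finset (Finset E)} (h𝓛 : IsLaminar 𝓛) {q : Finset E → ℕ}
    {A B : Finset E} (hA : QuotaIndep 𝓛 q A) (hB : QuotaIndep 𝓛 q B) (h : A.card < B.card) :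
    ∃ e ∈ B, e ∉ A ∧ QuotaIndep 𝓛 q (insert e A) := by
  by_contra! hcon
  -- the maximal tight sets
  let 𝓣 := 𝓛.filter fun K => (A ∩ K).card = q K
  let 𝓜 := 𝓣.filter fun K => ∀ K' ∈ 𝓣, K ⊆ K' → K' = K
  have hmax : ∀ K ∈ 𝓣, ∃ K' ∈ 𝓜, K ⊆ K' := by
    intro K hK
    obtain ⟨K', h1, h2⟩ := 𝓣.exists_le_maximal hK
    exact ⟨K', Finset.mem_filter.2 ⟨h2.prop, fun K'' h3 h4 => (h2.eq_of_le h3 h4).symm⟩, h1⟩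
  have hdisj : (𝓜 : Set (Finset E)).PairwiseDisjoint id := by
    intro K hK K' hK' hne
    have h1 := (Finset.mem_filter.1 hK)
    have h2 := (Finset.mem_filter.1 hK')
    rcases h𝓛 K (Finset.mem_filter.1 h1.1).1 K' (Finset.mem_filter.1 h2.1).1 with h3 | h3 | h3
    · exact absurd (h1.2 K' h2.1 h3).symm hne
    · exact absurd (h2.2 K h1.1 h3) hne
    · exact h3
  let U := 𝓜.biUnion id
  have hcard : ∀ X : Finset E, (X ∩ U).card = ∑ K ∈ 𝓜, (X ∩ K).card := by
    intro X
    rw [Finset.inter_biUnion, Finset.card_biUnion]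
    · rfl
    · intro K hK K' hK' hne
      exact (hdisj hK hK' hne).mono Finset.inter_subset_right Finset.inter_subset_right
  have h1 : B \ U ⊆ A \ U := by
    intro e he
    rw [Finset.mem_sdiff] at he ⊢
    refine ⟨?_, he.2⟩
    by_contra heA
    obtain ⟨K, hK, heK, h2⟩ := hA.exists_tight (hcon e he.1 heA)
    obtain ⟨K', hK', hKK'⟩ := hmax K (Finset.mem_filter.2 ⟨hK, h2⟩)
    exact he.2 (Finset.mem_biUnion.2 ⟨K', hK', hKK' heK⟩)
  have h2 : (B ∩ U).card ≤ (A ∩ U).card := by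
    rw [hcard, hcard]
    refine Finset.sum_le_sum fun K hK => ?_
    have h3 := Finset.mem_filter.1 (Finset.mem_filter.1 hK).1
    rw [h3.2]
    exact hB K h3.1
  have h3 := Finset.card_le_card h1
  have h4 := Finset.card_inter_add_card_sdiff A U
  have h5 := Finset.card_inter_add_card_sdiff B U
  omega

/-- The matroid of a laminar family with upper quotas. -/
def laminarMatroid (𝓛 : Finset (Finset E)) (h : IsLaminar 𝓛) (q : Finset E → ℕ) : Matroid E :=
  (IndepMatroid.ofFinset Set.univ (QuotaIndep 𝓛 q) (fun L _ => by simp)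
    (fun _ _ => QuotaIndep.mono) (fun _ _ => QuotaIndep.exists_insert h)
    fun _ _ => Set.subset_univ _).matroid

theorem laminarMatroid_indep {𝓛 : Finset (Finset E)} (h : IsLaminar 𝓛) {q : Finset E → ℕ}
    {A : Finset E} : (laminarMatroid 𝓛 h q).Indep A ↔ QuotaIndep 𝓛 q A :=
  IndepMatroid.ofFinset_indep Set.univ (QuotaIndep 𝓛 q) (fun L _ => by simp)
    (fun _ _ => QuotaIndep.mono) (fun _ _ => QuotaIndep.exists_insert h) fun _ _ => Set.subset_univ _

/-- Suppose that `d` is not spanned, and extend `d` by a basis `B` of the rest of `O ∩ L`. The quota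
of `L` keeps `B` smaller than that rest, so some `e` there is blocked by a set `K` that is tight for
`B`. Then `d ∉ K`, and `O` violates `K`. By laminarity `K` lies inside `L`, where it misses `d`, so
it has fewer offers than `L`; this contradicts minimality. -/
theorem mem_closure_laminarMatroid {𝓛 : Finset (Finset E)} (h : IsLaminar 𝓛) {q : Finset E → ℕ}
    {O : Finset E} {L : Finset E} (hL : L ∈ 𝓛) (hviol : q L < (O ∩ L).card)
    (hmin : ∀ K ∈ 𝓛, q K < (O ∩ K).card → (O ∩ L).card ≤ (O ∩ K).card) {d : E}
    (hd : d ∈ O ∩ L) : d ∈ (laminarMatroid 𝓛 h q).closure ((O ∩ L).erase d : Finset E) := by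
  by_contra hcon
  set M := laminarMatroid 𝓛 h q
  set X := (O ∩ L).erase d with hX
  obtain ⟨I, hI⟩ := M.exists_isBasis (X : Set E) (Set.subset_univ _)
  have hIX := hI.subset
  obtain ⟨B, rfl⟩ : ∃ B : Finset E, I = B := (X.finite_toSet.subset hIX).exists_finset_coe.imp
    fun _ h => h.symm
  rw [Finset.coe_subset] at hIX
  have hdB : d ∉ M.closure B := by rwa [hI.closure_eq_closure]
  have hBd : QuotaIndep 𝓛 q (insert d B) := by
    rw [← laminarMatroid_indep h, Finset.coe_insert]
    exact ((hI.indep.notMem_closure_iff (Set.mem_univ _)).1 hdB).1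
  have hdX : d ∉ B := fun h => by simpa [hX] using hIX h
  have hBL : insert d B ∩ L = insert d B := by
    rw [Finset.inter_eq_left]
    intro x hx
    rcases Finset.mem_insert.1 hx with rfl | hx
    · exact (Finset.mem_inter.1 hd).2
    · exact (Finset.mem_inter.1 (Finset.mem_of_mem_erase (hIX hx))).2
  have h1 := hBd L hL
  rw [hBL, Finset.card_insert_of_notMem hdX] at h1
  have h2 : B.card < X.card := by
    rw [hX, Finset.card_erase_of_mem hd]
    omega
  obtain ⟨e, heX, heB⟩ := Finset.exists_mem_notMem_of_card_lt_card h2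
  have h3 : ¬ QuotaIndep 𝓛 q (insert e B) := by
    rw [← laminarMatroid_indep h, Finset.coe_insert, hI.indep.insert_indep_iff]
    simp only [Finset.mem_coe, heB, or_false, Set.mem_sdiff, not_and, not_not]
    exact fun _ => hI.subset_closure heX
  obtain ⟨K, hK, heK, hKt⟩ := (hBd.mono (Finset.subset_insert _ _)).exists_tight h3
  have heL := Finset.mem_inter.1 (Finset.mem_of_mem_erase heX)
  have hdK : d ∉ K := by
    intro hdK
    have := hBd K hK
    rw [Finset.insert_inter_of_mem hdK,
      Finset.card_insert_of_notMem fun h => hdX (Finset.mem_inter.1 h).1] at this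
    omega
  -- `B` alone fills `K`, and `O ∩ K` contains `e` in addition.
  have h4 : q K < (O ∩ K).card := by
    rw [← hKt]
    refine Finset.card_lt_card ⟨fun x hx => ?_, fun h => ?_⟩
    · rw [Finset.mem_inter] at hx ⊢
      exact ⟨(Finset.mem_inter.1 (Finset.mem_of_mem_erase (hIX hx.1))).1, hx.2⟩
    · exact heB (Finset.mem_inter.1 (h (Finset.mem_inter.2 ⟨heL.1, heK⟩))).1
  have h5 := hmin K hK h4
  rcases h K hK L hL with h6 | h6 | h6
  · refine absurd (Finset.card_lt_card ?_) h5.not_gt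
    refine ⟨Finset.inter_subset_inter_left h6, fun h7 => hdK (Finset.mem_inter.1 (h7 hd)).2⟩
  · exact hdK (h6 (Finset.mem_inter.1 hd).2)
  · exact Finset.disjoint_left.1 h6 heK heL.2

end Laminar

/-! ### Stability in terms of the matroids of the firms -/

namespace OLC

variable {W F E : Type*} [DecidableEq W] [DecidableEq F] [DecidableEq E]

theorem mem_ofWorker {I : OLC W F E} {M : Finset E} {w : W} {e : E} :
    e ∈ I.ofWorker M w ↔ e ∈ M ∧ I.worker e = w := Finset.mem_filter

theorem mem_ofFirm {I : OLC W F E} {M : Finset E} {f : F} {e : E} :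
    e ∈ I.ofFirm M f ↔ e ∈ M ∧ I.firm e = f := Finset.mem_filter

theorem IsInstance.firm_eq {I : OLC W F E} (hI : I.IsInstance) {f : F} {e : E}
    (h : Listed (I.firmPref f) e) : I.firm e = f := (hI.firmPref_on f).2.2 e h

theorem IsInstance.worker_eq {I : OLC W F E} (hI : I.IsInstance) {w : W} {e : E}
    (h : Listed (I.workerPref w) e) : I.worker e = w := (hI.workerPref_on w).2.2 e h

theorem IsInstance.firmFeasible_iff {I : OLC W F E} (hI : I.IsInstance) {f : F} {M : Finset E} :
    I.FirmFeasible f M ↔ QuotaIndep (I.laminar f) (I.quota f) M := by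
  refine forall₂_congr fun L hL => ?_
  have : I.ofFirm M f ∩ L = M ∩ L := by
    ext e
    simp only [Finset.mem_inter, mem_ofFirm]
    have := hI.laminar_sub f L hL e
    tauto
  rw [this]

/-- The matroid of the feasible sets of a firm. -/
def firmMatroid {I : OLC W F E} (hI : I.IsInstance) (f : F) : Matroid E :=
  laminarMatroid (I.laminar f) (hI.laminar f) (I.quota f)

theorem subset_closure_firmMatroid {I : OLC W F E} (hI : I.IsInstance) (f : F) (X : Set E) :
    X ⊆ (firmMatroid hI f).closure X :=
  (firmMatroid hI f).subset_closure X (Set.subset_univ _)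

theorem firmMatroid_indep {I : OLC W F E} (hI : I.IsInstance) {f : F} {M : Finset E} :
    (firmMatroid hI f).Indep M ↔ I.FirmFeasible f M := by
  rw [hI.firmFeasible_iff]
  exact laminarMatroid_indep _

theorem firmFeasible_ofFirm {I : OLC W F E} {f : F} {M : Finset E} :
    I.FirmFeasible f (I.ofFirm M f) ↔ I.FirmFeasible f M := by
  have : I.ofFirm (I.ofFirm M f) f = I.ofFirm M f := by
    ext e
    simp only [mem_ofFirm]
    tauto
  simp only [FirmFeasible, this]

/-- The contracts of `M` that the firm of `e` strictly prefers to `e`. -/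
def better (I : OLC W F E) (M : Finset E) (e : E) : Set E :=
  {d | d ∈ M ∧ Prefers (I.firmPref (I.firm e)) d e}

theorem notMem_closure_of_indep {M : Matroid E} {X B : Set E} (hX : M.Indep X) {e : E}
    (he : e ∈ X) (hB : B ⊆ X) (heB : e ∉ B) : e ∉ M.closure B := fun h =>
  hX.notMem_closure_sdiff_of_mem he
    (M.closure_subset_closure (Set.subset_sdiff_singleton hB heB) h)

/-- In terms of the matroid of its firm: a contract is not free for its firm in a feasible set `M`
if and only if it is spanned by the better contracts of `M`. -/
theorem mem_closure_better_iff {I : OLC W F E} (hI : I.IsInstance) (hF : I.TiesOnlyInWorkers)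
    {M : Finset E} {e : E} (hM : I.FirmFeasible (I.firm e) M) (he : e ∉ M) :
    e ∈ (firmMatroid hI (I.firm e)).closure (I.better M e) ↔ ¬ I.FreeForFirm M e := by
  have hdis := (hI.firmPref_on (I.firm e)).2.1
  have hsub : I.better M e ⊆ I.ofFirm M (I.firm e) := fun d hd =>
    mem_ofFirm.2 ⟨hd.1, hI.firm_eq hd.2.listed_left⟩
  have heN : e ∉ I.ofFirm M (I.firm e) := fun h => he (mem_ofFirm.1 h).1
  constructor
  · rintro h (hfree | ⟨d, hd, hpref, hfree⟩)
    · rw [← firmMatroid_indep hI, Finset.coe_insert] at hfree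
      exact notMem_closure_of_indep hfree (Set.mem_insert _ _)
        (hsub.trans (Set.subset_insert _ _)) (fun h' => heN (hsub h')) h
    · rw [← firmMatroid_indep hI, Finset.coe_erase, Finset.coe_insert] at hfree
      refine notMem_closure_of_indep hfree ⟨Set.mem_insert _ _, hpref.ne hdis⟩
        (Set.subset_sdiff_singleton (hsub.trans (Set.subset_insert _ _)) ?_)
        (fun h' => heN (hsub h')) h
      exact fun h' => h'.2.asymm hdis hpref
  · intro hfree
    rw [FreeForFirm, not_or] at hfree
    set N := I.ofFirm M (I.firm e) with hN
    have hNi : (firmMatroid hI (I.firm e)).Indep N :=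
      (firmMatroid_indep hI).2 (firmFeasible_ofFirm.2 hM)
    have hcl : e ∈ (firmMatroid hI (I.firm e)).closure N := by
      by_contra hcon
      refine hfree.1 ((firmMatroid_indep hI).1 ?_)
      rw [Finset.coe_insert]
      exact ((hNi.notMem_closure_iff (Set.mem_univ _)).1 hcon).1
    -- Exchanging `e` for any other element of its fundamental circuit keeps feasibility. As `e` is
    -- not free, all these elements are better than `e`, and they span it.
    have hC := hNi.fundCircuit_isCircuit hcl heN
    refine (firmMatroid hI (I.firm e)).closure_subset_closure ?_
      (hC.mem_closure_sdiff_singleton_of_mem (Matroid.mem_fundCircuit _ _ _))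
    rintro d ⟨hdC, hde⟩
    have hdN : d ∈ N := (Matroid.fundCircuit_subset_insert _ _ _ hdC).resolve_left hde
    refine ⟨(mem_ofFirm.1 hdN).1, ?_⟩
    rw [hNi.mem_fundCircuit_iff hcl heN] at hdC
    have hfd := (mem_ofFirm.1 hdN).2
    refine (prefers_trichotomy hdis (hF _) (hfd ▸ hI.firmPref_all d) (hI.firmPref_all e)
      hde).resolve_right fun hp => hfree.2 ⟨d, hdN, hp, ?_⟩
    rwa [← firmMatroid_indep hI, Finset.coe_erase, Finset.coe_insert]

/-- Instances without ties. -/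
structure IsStrictInstance (I : OLC W F E) : Prop extends IsInstance I where
  workers : ∀ w, IsStrictList (I.workerPref w)
  firms : I.TiesOnlyInWorkers

theorem IsStrictInstance.worker_trichotomy {I : OLC W F E} (hI : I.IsStrictInstance) {e d : E}
    (he : Listed (I.workerPref (I.worker e)) e) (hd : Listed (I.workerPref (I.worker e)) d)
    (hne : e ≠ d) : Prefers (I.workerPref (I.worker e)) e d ∨
      Prefers (I.workerPref (I.worker e)) d e :=
  prefers_trichotomy (hI.workerPref_on _).2.1 (hI.workers _) he hd hne

theorem IsMatching.worker_inj {I : OLC W F E} {M : Finset E} (hM : I.IsMatching M) {e d : E}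
    (he : e ∈ M) (hd : d ∈ M) (h : I.worker e = I.worker d) : e = d :=
  Finset.card_le_one.1 (hM.2.1 (I.worker d)) e (mem_ofWorker.2 ⟨he, h⟩) d (mem_ofWorker.2 ⟨hd, rfl⟩)

theorem IsWorkerOptimal.exists_mem {I : OLC W F E} {S N : Finset E} (hS : I.IsWorkerOptimal S)
    (hN : I.IsStable N) {d : E} (hd : d ∈ N) : ∃ e ∈ S, I.worker e = I.worker d ∧
      ¬ Prefers (I.workerPref (I.worker d)) d e := by
  rcases hS.2 N hN (I.worker d) with h | ⟨e, he, d', hd', -, -, h⟩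
  · exact absurd (hN.1.1 d hd) (h d (mem_ofWorker.2 ⟨hd, rfl⟩))
  · rw [mem_ofWorker] at he hd'
    have := hN.1.worker_inj hd'.1 hd hd'.2
    subst this
    exact ⟨e, he.1, he.2, h⟩

/-- Each of two worker-optimal matchings is weakly preferred to the other by every worker, and on a
strict list this forces equal contracts. -/
theorem IsWorkerOptimal.eq {I : OLC W F E} (hI : I.IsStrictInstance) {S N : Finset E}
    (hS : I.IsWorkerOptimal S) (hN : I.IsWorkerOptimal N) : S = N := by
  have key : ∀ S N : Finset E, I.IsWorkerOptimal S → I.IsWorkerOptimal N → S ⊆ N := by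
    intro S N hS hN d hd
    obtain ⟨e, he, hw, h⟩ := hN.exists_mem hS.1 hd
    obtain ⟨d', hd', hw', h'⟩ := hS.exists_mem hN.1 he
    have := hS.1.1.worker_inj hd' hd (hw'.trans hw)
    subst this
    by_contra hne
    rcases hI.worker_trichotomy (hS.1.1.1 _ hd) (hw ▸ hN.1.1.1 _ he)
      (fun h => hne (h ▸ he)) with h1 | h1
    · exact h h1
    · exact h' (hw' ▸ h1)
  exact (key S N hS hN).antisymm (key N S hN hS)

/-! ### Deferred acceptance with rejections by matroid closure -/

section DeferredAcceptance

variable [Fintype E]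

open Classical in
/-- The favourite contracts of the workers among those that are not in `R`. -/
noncomputable def offers (I : OLC W F E) (R : Finset E) : Finset E :=
  Finset.univ.filter fun e => e ∉ R ∧ Listed (I.workerPref (I.worker e)) e ∧
    ∀ d, d ∉ R → ¬ Prefers (I.workerPref (I.worker e)) d e

theorem mem_offers {I : OLC W F E} {R : Finset E} {e : E} : e ∈ I.offers R ↔
    e ∉ R ∧ Listed (I.workerPref (I.worker e)) e ∧
      ∀ d, d ∉ R → ¬ Prefers (I.workerPref (I.worker e)) d e := by
  simp [offers]

theorem exists_offer {I : OLC W F E} (hI : I.IsInstance) {R : Finset E} {d : E} (hd : d ∉ R)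
    (hl : Listed (I.workerPref (I.worker d)) d) : ∃ e ∈ I.offers R, I.worker e = I.worker d := by
  classical
  obtain ⟨e, he, hmin⟩ := (Finset.univ.filter fun e => e ∉ R ∧
    Listed (I.workerPref (I.worker d)) e).exists_min_image (pos (I.workerPref (I.worker d)))
      ⟨d, by simp [hd, hl]⟩
  simp only [Finset.mem_filter, Finset.mem_univ, true_and] at he hmin
  have hw := hI.worker_eq he.2
  refine ⟨e, mem_offers.2 ⟨he.1, hw ▸ he.2, fun x hx hp => ?_⟩, hw⟩
  rw [hw] at hp
  have := hmin x ⟨hx, hp.listed_left⟩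
  rw [prefers_iff (hI.workerPref_on _).2.1] at hp
  omega

/-- The invariant of the deferred acceptance algorithm for the set `R` of rejected contracts. -/
structure Sound {I : OLC W F E} (hI : I.IsInstance) (R : Finset E) : Prop where
  notMem_stable : ∀ N, I.IsStable N → ∀ e ∈ R, e ∉ N
  spanned : ∀ e ∈ R, e ∈ (firmMatroid hI (I.firm e)).closure (I.better (I.offers R) e)

theorem Sound.empty {I : OLC W F E} (hI : I.IsInstance) : Sound hI ∅ :=
  ⟨fun _ _ _ h => absurd h (Finset.notMem_empty _), fun _ h => absurd h (Finset.notMem_empty _)⟩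

/-- A further rejection only removes competitors, so the other favourites stay favourites. -/
theorem offers_subset_insert {I : OLC W F E} {R : Finset E} {d e : E} (he : e ∈ I.offers R)
    (hne : e ≠ d) : e ∈ I.offers (insert d R) := by
  rw [mem_offers] at he ⊢
  exact ⟨by simp [hne, he.1], he.2.1, fun x hx => he.2.2 x fun h => hx (Finset.mem_insert_of_mem h)⟩

/-- Suppose that `d ∈ N`. An offer `x` that is better than `d` and not in `N` is free for its
worker, because `N` avoids `R` and `x` is her favourite outside `R`. By stability `x` is spanned by
contracts of `N` better than `x`, hence better than `d`. So better contracts of `N` span `d`,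
against the independence of `N`. -/
theorem offers_notMem_stable {I : OLC W F E} (hI : I.IsStrictInstance) {R : Finset E}
    {N : Finset E} (hN : I.IsStable N) (hR : ∀ e ∈ R, e ∉ N) {d : E}
    (hcl : d ∈ (firmMatroid hI.toIsInstance (I.firm d)).closure (I.better (I.offers R) d)) :
    d ∉ N := by
  intro hdN
  have hdis : (I.firmPref (I.firm d)).Pairwise Disjoint := (hI.firmPref_on _).2.1
  have hNi : (firmMatroid hI.toIsInstance (I.firm d)).Indep N :=
    (firmMatroid_indep _).2 (hN.1.2.2 _)
  have hB : I.better N d ⊆ N := fun y hy => hy.1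
  refine notMem_closure_of_indep hNi hdN hB (fun h => h.2.ne hdis rfl)
    (Matroid.closure_subset_closure_of_subset_closure (fun x hx => ?_) hcl)
  have hfx := hI.firm_eq hx.2.listed_left
  by_cases hxN : x ∈ N
  · exact subset_closure_firmMatroid _ _ _ ⟨hxN, hx.2⟩
  have hxO := mem_offers.1 hx.1
  have hfree : I.FreeForWorker N x := by
    refine ⟨hxO.2.1, ?_⟩
    rcases (I.ofWorker N (I.worker x)).eq_empty_or_nonempty with h | ⟨y, hy⟩
    · exact Or.inl h
    · refine Or.inr ⟨y, hy, ?_⟩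
      rw [mem_ofWorker] at hy
      have hyl := hN.1.1 y hy.1
      rw [hy.2] at hyl
      refine (hI.worker_trichotomy hxO.2.1 hyl ?_).resolve_right
        (hxO.2.2 y fun h => hR y h hy.1)
      rintro rfl
      exact hxN hy.1
  have h1 := (mem_closure_better_iff hI.toIsInstance hI.firms (hN.1.2.2 _) hxN).2
    fun h => hN.2 x hxN ⟨hfree, h⟩
  rw [hfx] at h1
  have hsub : I.better N x ⊆ I.better N d := by
    intro y hy
    have h2 := hy.2
    rw [hfx] at h2
    exact ⟨hy.1, h2.trans hdis hx.2⟩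
  exact Matroid.closure_subset_closure _ hsub h1

/-- Only the offer `d` is withdrawn. Wherever `d` helped to span a rejected contract, the better
offers that span `d` take its place. -/
theorem Sound.insert_offer {I : OLC W F E} (hI : I.IsStrictInstance) {R : Finset E}
    (hR : Sound hI.toIsInstance R) {d : E}
    (hcl : d ∈ (firmMatroid hI.toIsInstance (I.firm d)).closure (I.better (I.offers R) d)) :
    Sound hI.toIsInstance (insert d R) := by
  have hdis : ∀ f, (I.firmPref f).Pairwise Disjoint := fun f => (hI.firmPref_on f).2.1
  have hself : I.better (I.offers R) d ⊆ I.better (I.offers (insert d R)) d := fun x hx =>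
    ⟨offers_subset_insert hx.1 (hx.2.ne (hdis _)), hx.2⟩
  refine ⟨fun N hN e he => ?_, fun e he => ?_⟩
  · rcases Finset.mem_insert.1 he with rfl | he
    · exact offers_notMem_stable hI hN (hR.notMem_stable N hN) hcl
    · exact hR.notMem_stable N hN e he
  · rcases Finset.mem_insert.1 he with rfl | he
    · exact Matroid.closure_subset_closure _ hself hcl
    · refine Matroid.closure_subset_closure_of_subset_closure ?_ (hR.spanned e he)
      intro x hx
      by_cases hxd : x = d
      · subst hxd
        have hfx := hI.firm_eq hx.2.listed_left
        rw [hfx] at hcl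
        have hsub : I.better (I.offers R) x ⊆ I.better (I.offers (insert x R)) e := by
          intro y hy
          have h2 := hself hy
          have h3 := h2.2
          rw [hfx] at h3
          exact ⟨h2.1, h3.trans (hdis _) hx.2⟩
        exact Matroid.closure_subset_closure _ hsub hcl
      · exact subset_closure_firmMatroid _ _ _ ⟨offers_subset_insert hx.1 hxd, hx.2⟩

/-- A contract that is free for its worker has to be in `R`, since she holds her favourite outside
`R`; but then it is spanned by better offers and does not block. The contracts of any stable
matching lie outside `R`, hence the optimality. -/
theorem Sound.isWorkerOptimal {I : OLC W F E} (hI : I.IsStrictInstance) {R : Finset E}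
    (hR : Sound hI.toIsInstance R) (hO : ∀ f, I.FirmFeasible f (I.offers R)) :
    I.IsWorkerOptimal (I.offers R) := by
  have hM : I.IsMatching (I.offers R) := by
    refine ⟨fun e he => (mem_offers.1 he).2.1, fun w => Finset.card_le_one.2 ?_, hO⟩
    intro e he d hd
    rw [mem_ofWorker, mem_offers] at he hd
    obtain ⟨he, rfl⟩ := he
    by_contra hne
    have h1 := hd.1.2.1
    rw [hd.2] at h1
    rcases hI.worker_trichotomy he.2.1 h1 hne with h | h
    · exact hd.1.2.2 e he.1 (hd.2.symm ▸ h)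
    · exact he.2.2 d hd.1.1 h
  refine ⟨⟨hM, fun e he hb => ?_⟩, fun N hN w => ?_⟩
  · have heR : e ∈ R := by
      by_contra heR
      rcases hb.1.2 with h | ⟨d, hd, h⟩
      · obtain ⟨d, hd, hw⟩ := exists_offer hI.toIsInstance heR hb.1.1
        exact Finset.notMem_empty d (h ▸ mem_ofWorker.2 ⟨hd, hw⟩)
      · rw [mem_ofWorker, mem_offers] at hd
        exact hd.1.2.2 e heR (hd.2.symm ▸ h)
    exact (mem_closure_better_iff hI.toIsInstance hI.firms (hO _) he).1 (hR.spanned e heR) hb.2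
  · rcases (I.ofWorker N w).eq_empty_or_nonempty with h | ⟨d, hd⟩
    · exact Or.inl fun d hd => absurd (h ▸ hd) (Finset.notMem_empty d)
    · have hdN := mem_ofWorker.1 hd
      have hdR : d ∉ R := fun h => hR.notMem_stable N hN d h hdN.1
      have hl := hN.1.1 d hdN.1
      obtain ⟨e, he, hw⟩ := exists_offer hI.toIsInstance hdR hl
      rw [hdN.2] at hw hl
      have he' := mem_offers.1 he
      rw [hw] at he'
      exact Or.inr ⟨e, mem_ofWorker.2 ⟨he, hw⟩, d, hd, he'.2.1, hl, he'.2.2 d hdR⟩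

theorem mem_closure_better {I : OLC W F E} (hI : I.IsInstance) (hF : I.TiesOnlyInWorkers)
    {O L : Finset E} {f : F} (hL : L ∈ I.laminar f) (hviol : I.quota f L < (O ∩ L).card)
    (hmin : ∀ K ∈ I.laminar f, I.quota f K < (O ∩ K).card → (O ∩ L).card ≤ (O ∩ K).card) {d : E}
    (hd : d ∈ O ∩ L) (hworst : ∀ x ∈ O ∩ L, ¬ Prefers (I.firmPref f) d x) :
    d ∈ (firmMatroid hI (I.firm d)).closure (I.better O d) := by
  have hf : ∀ x ∈ O ∩ L, I.firm x = f := fun x hx =>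
    hI.laminar_sub f L hL x (Finset.mem_inter.1 hx).2
  have hl : ∀ x ∈ O ∩ L, Listed (I.firmPref f) x := fun x hx => hf x hx ▸ hI.firmPref_all x
  have h := mem_closure_laminarMatroid (hI.laminar f) hL hviol hmin hd
  rw [hf d hd]
  refine Matroid.closure_subset_closure _ (fun x hx => ?_) h
  rw [Finset.mem_coe, Finset.mem_erase] at hx
  refine ⟨(Finset.mem_inter.1 hx.2).1, ?_⟩
  rw [hf d hd]
  exact (prefers_trichotomy (hI.firmPref_on f).2.1 (hF f) (hl x hx.2) (hl d hd) hx.1).resolve_right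
    (hworst x hx.2)

theorem exists_isWorkerOptimal {I : OLC W F E} (hI : I.IsStrictInstance) :
    ∃ S, I.IsWorkerOptimal S := by
  suffices h : ∀ k (R : Finset E), Sound hI.toIsInstance R → Rᶜ.card = k →
      ∃ S, I.IsWorkerOptimal S from h _ ∅ (Sound.empty _) rfl
  intro k
  induction k using Nat.strong_induction_on with
  | _ k ih =>
  intro R hR hk
  by_cases hO : ∀ f, I.FirmFeasible f (I.offers R)
  · exact ⟨_, hR.isWorkerOptimal hI hO⟩
  push Not at hO
  obtain ⟨f, hf⟩ := hO
  rw [hI.toIsInstance.firmFeasible_iff] at hf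
  set O := I.offers R with hOdef
  -- An arbitrary violated set would not do: the excess may be confined to a smaller set inside it,
  -- which need not contain the worst offer.
  obtain ⟨L, hL, hmin⟩ := ((I.laminar f).filter fun L => I.quota f L < (O ∩ L).card).exists_min_image
    (fun L => (O ∩ L).card) (by
      simp only [QuotaIndep, not_forall, not_le] at hf
      obtain ⟨L, hL, h⟩ := hf
      exact ⟨L, Finset.mem_filter.2 ⟨hL, h⟩⟩)
  simp only [Finset.mem_filter] at hL hmin
  obtain ⟨d, hd, hmax⟩ := (O ∩ L).exists_max_image (pos (I.firmPref f))
    (Finset.card_pos.1 (by omega))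
  have hcl := mem_closure_better hI.toIsInstance hI.firms hL.1 hL.2 (fun K hK h => hmin K ⟨hK, h⟩)
    hd fun x hx hp => by
      rw [prefers_iff (hI.firmPref_on f).2.1] at hp
      have := hmax x hx
      omega
  have hdO := (Finset.mem_inter.1 hd).1
  refine ih _ ?_ (insert d R) (hR.insert_offer hI hcl) rfl
  rw [← hk, Finset.compl_insert]
  exact Finset.card_erase_lt_of_mem (Finset.mem_compl.2 (mem_offers.1 hdO).1)

theorem existsUnique_isWorkerOptimal {I : OLC W F E} (hI : I.IsStrictInstance) :
    ∃! S, I.IsWorkerOptimal S := by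
  obtain ⟨S, hS⟩ := exists_isWorkerOptimal hI
  exact ⟨S, hS, fun N hN => hN.eq hI hS⟩

end DeferredAcceptance

end OLC

/-! ### Strategy-proofness without ties -/

section Lists

variable {E : Type*}

theorem not_listed_of_pairwise_append {P Q : PrefList E} (h : (P ++ Q).Pairwise Disjoint) {e : E}
    (he : Listed P e) : ¬ Listed Q e := by
  rintro ⟨T, hT, heT⟩
  obtain ⟨S, hS, heS⟩ := he
  exact Finset.disjoint_left.1 ((List.pairwise_append.1 h).2.2 S hS T hT) heS heT

theorem IsStrictList.mem_iff {P : PrefList E} (h : IsStrictList P) {e : E} :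
    {e} ∈ P ↔ Listed P e := by
  refine ⟨fun he => ⟨_, he, by simp⟩, fun ⟨T, hT, he⟩ => ?_⟩
  obtain ⟨x, rfl⟩ := Finset.card_eq_one.1 (h T hT)
  rwa [Finset.mem_singleton.1 he]

theorem listed_singleton {c e : E} : Listed [{c}] e ↔ e = c := by simp [Listed]

end Lists

/-- The rank of a closure is the rank of the set. All comparisons of the sizes of matchings at a
firm go through this bound. -/
theorem card_le_of_subset_closure {E : Type*} {M : Matroid E} {A B : Finset E} (hA : M.Indep A)
    (h : (A : Set E) ⊆ M.closure B) : A.card ≤ B.card := by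
  have h1 := (hA.encard_le_eRk_of_subset h).trans_eq (M.eRk_closure_eq B)
  have h2 := h1.trans (M.eRk_le_encard B)
  rw [Set.encard_coe_eq_coe_finsetCard, Set.encard_coe_eq_coe_finsetCard] at h2
  exact_mod_cast h2

namespace OLC

variable {W F E : Type*} [DecidableEq W] [DecidableEq F] [DecidableEq E]

theorem replaceList_workerPref_self (I : OLC W F E) (w : W) (P : PrefList E) :
    (I.replaceList w P).workerPref w = P := Function.update_self ..

theorem replaceList_workerPref_of_ne (I : OLC W F E) {w v : W} (P : PrefList E) (h : v ≠ w) :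
    (I.replaceList w P).workerPref v = I.workerPref v := Function.update_of_ne h ..

theorem replaceList_replaceList (I : OLC W F E) (w : W) (P Q : PrefList E) :
    (I.replaceList w P).replaceList w Q = I.replaceList w Q := by
  simp [replaceList]

theorem replaceList_self (I : OLC W F E) (w : W) : I.replaceList w (I.workerPref w) = I := by
  simp [replaceList]

theorem IsInstance.replaceList {I : OLC W F E} (hI : I.IsInstance) {w : W} {P : PrefList E}
    (hP : IsPrefListOn {e | I.worker e = w} P) : (I.replaceList w P).IsInstance := by
  refine ⟨fun v => ?_, hI.firmPref_on, hI.firmPref_all, hI.laminar_sub, hI.laminar⟩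
  by_cases h : v = w
  · subst h
    rw [replaceList_workerPref_self]
    exact hP
  · rw [replaceList_workerPref_of_ne _ _ h]
    exact hI.workerPref_on v

theorem IsStrictInstance.replaceList {I : OLC W F E} (hI : I.IsStrictInstance) {w : W}
    {P : PrefList E} (hP : IsPrefListOn {e | I.worker e = w} P) (hs : IsStrictList P) :
    (I.replaceList w P).IsStrictInstance := by
  refine ⟨hI.toIsInstance.replaceList hP, fun v => ?_, hI.firms⟩
  by_cases h : v = w
  · subst h
    rwa [replaceList_workerPref_self]
  · rw [replaceList_workerPref_of_ne _ _ h]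
    exact hI.workers v

/-- If one worker changes her list, then a stable matching stays stable provided that she still
accepts her contract and no contract becomes free for her. -/
theorem IsStable.replaceList {I : OLC W F E} {T : Finset E} (hT : I.IsStable T) {w : W}
    {Q : PrefList E} (hl : ∀ e ∈ T, I.worker e = w → Listed Q e)
    (hfree : ∀ e, e ∉ T → I.worker e = w → Listed Q e →
      (I.ofWorker T w = ∅ ∨ ∃ d ∈ I.ofWorker T w, Prefers Q e d) → I.FreeForWorker T e) :
    (I.replaceList w Q).IsStable T := by
  refine ⟨⟨fun e he => ?_, hT.1.2.1, hT.1.2.2⟩, fun e he hb => hT.2 e he ⟨?_, hb.2⟩⟩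
  · change Listed ((I.replaceList w Q).workerPref (I.worker e)) e
    by_cases h : I.worker e = w
    · rw [h, replaceList_workerPref_self]
      exact hl e he h
    · rw [replaceList_workerPref_of_ne _ _ h]
      exact hT.1.1 e he
  · have h1 : Listed ((I.replaceList w Q).workerPref (I.worker e)) e ∧
      (I.ofWorker T (I.worker e) = ∅ ∨ ∃ d ∈ I.ofWorker T (I.worker e),
        Prefers ((I.replaceList w Q).workerPref (I.worker e)) e d) := hb.1
    by_cases h : I.worker e = w
    · rw [h, replaceList_workerPref_self] at h1
      exact hfree e he h h1.1 h1.2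
    · rwa [replaceList_workerPref_of_ne _ _ h] at h1

/-- A worker who is assigned a contract in the worker-optimal stable matching is assigned a
contract in every stable matching. -/
theorem IsWorkerOptimal.exists_mem_of_mem [Fintype F] {I : OLC W F E} (hI : I.IsStrictInstance)
    {U T : Finset E} (hU : I.IsWorkerOptimal U) (hT : I.IsStable T) {a : E} (ha : a ∈ U) :
    ∃ t ∈ T, I.worker t = I.worker a := by
  -- A contract of `U` outside `T` is free for its worker in `T`, since `U` is optimal for her; by
  -- stability `T` spans it at its firm.
  have hfirm : ∀ f, (I.ofFirm U f).card ≤ (I.ofFirm T f).card := by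
    intro f
    have hTi : (firmMatroid hI.toIsInstance f).Indep (I.ofFirm T f) :=
      (firmMatroid_indep _).2 (firmFeasible_ofFirm.2 (hT.1.2.2 f))
    refine card_le_of_subset_closure (M := firmMatroid hI.toIsInstance f)
      ((firmMatroid_indep _).2 (firmFeasible_ofFirm.2 (hU.1.1.2.2 f))) fun e he => ?_
    have he' := mem_ofFirm.1 he
    obtain ⟨heU, rfl⟩ := he'
    by_cases heT : e ∈ T
    · exact subset_closure_firmMatroid _ _ _ (mem_ofFirm.2 ⟨heT, rfl⟩)
    have hfree : I.FreeForWorker T e := by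
      have hle := hU.1.1.1 e heU
      refine ⟨hle, ?_⟩
      rcases (I.ofWorker T (I.worker e)).eq_empty_or_nonempty with h | ⟨d, hd⟩
      · exact Or.inl h
      refine Or.inr ⟨d, hd, ?_⟩
      rw [mem_ofWorker] at hd
      obtain ⟨e', he', hw, hp⟩ := hU.exists_mem hT hd.1
      obtain rfl := hU.1.1.worker_inj he' heU (hw.trans hd.2)
      have hld := hT.1.1 d hd.1
      rw [hd.2] at hp hld
      refine (hI.worker_trichotomy hle hld ?_).resolve_right hp
      rintro rfl
      exact heT hd.1
    refine Matroid.closure_subset_closure _ (fun d hd => ?_)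
      ((mem_closure_better_iff hI.toIsInstance hI.firms (hT.1.2.2 _) heT).2
        fun h => hT.2 e heT ⟨hfree, h⟩)
    exact mem_ofFirm.2 ⟨hd.1, hI.firm_eq hd.2.listed_left⟩
  have hcard : ∀ M : Finset E, M.card = ∑ f, (I.ofFirm M f).card := fun M =>
    Finset.card_eq_sum_card_fiberwise fun _ _ => Finset.mem_univ _
  have h1 : U.card ≤ T.card := by
    rw [hcard U, hcard T]
    exact Finset.sum_le_sum fun f _ => hfirm f
  have hinj : ∀ M : Finset E, I.IsMatching M → (M.image I.worker).card = M.card := fun M hM =>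
    Finset.card_image_of_injOn fun e he d hd h => hM.worker_inj he hd h
  -- By optimality every worker assigned in `T` is assigned in `U`; as `T` is at least as large, the
  -- two sets of assigned workers coincide.
  have h2 : T.image I.worker ⊆ U.image I.worker := by
    intro w hw
    obtain ⟨t, ht, rfl⟩ := Finset.mem_image.1 hw
    obtain ⟨e, he, hw, -⟩ := hU.exists_mem hT ht
    exact Finset.mem_image.2 ⟨e, he, hw⟩
  have h3 := Finset.eq_of_subset_of_card_le h2 (by rw [hinj U hU.1.1, hinj T hT.1]; exact h1)
  have h4 := Finset.mem_image_of_mem I.worker ha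
  rw [← h3] at h4
  exact Finset.mem_image.1 h4

theorem isPrefListOn_singleton {S : Set E} {c : E} (hc : c ∈ S) : IsPrefListOn S [{c}] :=
  ⟨by simp, by simp, fun e he => listed_singleton.1 he ▸ hc⟩

/-- Strategy-proofness of the worker-optimal stable matching of an instance without ties: if the
worker `w` can get the contract `c` by listing it alone, then with her true list she
gets a contract that is at least as good as `c`. -/
theorem IsWorkerOptimal.exists_mem_of_singleton [Fintype F] [Fintype E] {I : OLC W F E}
    (hI : I.IsStrictInstance) {S T : Finset E} (hS : I.IsWorkerOptimal S) {c : E}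
    (hl : Listed (I.workerPref (I.worker c)) c)
    (hT : (I.replaceList (I.worker c) [{c}]).IsStable T) (hc : c ∈ T) :
    ∃ a ∈ S, I.worker a = I.worker c ∧ ¬ Prefers (I.workerPref (I.worker c)) c a := by
  obtain ⟨w, hw⟩ : ∃ w, w = I.worker c := ⟨_, rfl⟩
  rw [← hw] at hl hT ⊢
  obtain ⟨Q, R, hPQ⟩ := List.append_of_mem ((hI.workers w).mem_iff.2 hl)
  have hPon := hI.workerPref_on w
  have hPs := hI.workers w
  set P := I.workerPref w with hP
  have hPQ : P = (Q ++ [{c}]) ++ R := by simp [hPQ]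
  -- The true list is truncated just after `c`; contracts worse than `c` are exactly cut off.
  set Q' := Q ++ [{c}] with hQ'
  have hlc : Listed Q' c := by simp [hQ', listed_append, listed_singleton]
  have hdis : (Q' ++ R).Pairwise Disjoint := hPQ ▸ hPon.2.1
  have hQ'on : IsPrefListOn {e | I.worker e = w} Q' := by
    refine ⟨fun T hT => hPon.1 T ?_, hdis.sublist (List.sublist_append_left _ _), fun e he =>
      hPon.2.2 e ?_⟩
    · rw [hPQ]; exact List.mem_append_left _ hT
    · rw [hPQ, listed_append]; exact Or.inl he
  have hQ's : IsStrictList Q' := fun T hT => hPs T (by rw [hPQ]; exact List.mem_append_left _ hT)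
  have hcs : ∀ s, Prefers P c s → Listed R s := by
    intro s h
    rw [hPQ, prefers_append] at h
    rcases h with h | h | h
    · have hcQ : ¬ Listed Q c := fun h' =>
        not_listed_of_pairwise_append (hQ'on.2.1) h' (listed_singleton.2 rfl)
      rw [prefers_append] at h
      rcases h with h | h | h
      · exact absurd h.listed_left hcQ
      · simp [prefers_cons, prefers_nil, listed_nil] at h
      · exact absurd h.1 hcQ
    · exact h.listed_right
    · exact h.2
  have hJ2 := hI.replaceList hQ'on hQ's
  have hcw : c ∈ {e | I.worker e = w} := hw.symm
  have hJ1 := hI.replaceList (isPrefListOn_singleton hcw) (fun T hT => by simp_all)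
  obtain ⟨T', hT'⟩ := exists_isWorkerOptimal hJ2
  rcases (I.ofWorker T' w).eq_empty_or_nonempty with hemp | ⟨a, ha⟩
  -- If `w` got nothing with the truncated list, then `T'` would also be stable for the list of `c`
  -- alone. But `w` gets `c` in the matching `T` for that list, hence a contract in the
  -- worker-optimal one, and therefore a contract in every stable matching.
  · exfalso
    have hst : (I.replaceList w [{c}]).IsStable T' := by
      rw [← I.replaceList_replaceList w Q' [{c}]]
      refine hT'.1.replaceList (fun e he hwe => ?_) fun e _ hwe hle _ => ?_
      · exact absurd (hemp ▸ mem_ofWorker.2 ⟨he, hwe⟩ : e ∈ (∅ : Finset E)) (Finset.notMem_empty e)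
      · rw [listed_singleton] at hle
        subst hle
        have hwe : I.worker e = w := hwe
        refine ⟨?_, Or.inl ?_⟩
        · change Listed ((I.replaceList w Q').workerPref (I.worker e)) e
          rwa [hwe, replaceList_workerPref_self]
        · change I.ofWorker T' (I.worker e) = ∅
          rwa [hwe]
    obtain ⟨U, hU⟩ := exists_isWorkerOptimal hJ1
    obtain ⟨u, hu, hwu, -⟩ := hU.exists_mem hT hc
    obtain ⟨t, ht, hwt⟩ := hU.exists_mem_of_mem hJ1 hst hu
    have : t ∈ I.ofWorker T' w := mem_ofWorker.2 ⟨ht, hwt.trans (hwu.trans hw.symm)⟩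
    rw [hemp] at this
    exact Finset.notMem_empty t this
  · rw [mem_ofWorker] at ha
    have hT'l : ∀ e ∈ T', I.worker e = w → Listed Q' e := by
      intro e he hwe
      have := hT'.1.1.1 e he
      change Listed ((I.replaceList w Q').workerPref (I.worker e)) e at this
      rwa [hwe, replaceList_workerPref_self] at this
    -- The part that was cut off is worse than the contract `a` of `w`, so restoring it creates no
    -- blocking contract.
    have hst : I.IsStable T' := by
      rw [← I.replaceList_self w, ← hP, ← I.replaceList_replaceList w Q' P]
      refine hT'.1.replaceList (fun e he hwe => ?_) fun e _ hwe hle hf => ?_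
      · rw [hPQ, listed_append]
        exact Or.inl (hT'l e he hwe)
      · have hwe : I.worker e = w := hwe
        rcases hf with hf | ⟨d, hd, hf⟩
        · exact absurd (hf ▸ mem_ofWorker.2 ⟨ha.1, ha.2⟩ : a ∈ (∅ : Finset E)) (Finset.notMem_empty a)
        · have hd' : d ∈ T' ∧ I.worker d = w := mem_ofWorker.1 hd
          have hld := hT'l d hd'.1 hd'.2
          have hp : Prefers Q' e d := by
            rw [hPQ, prefers_append] at hf
            have := not_listed_of_pairwise_append hdis hld
            rcases hf with hf | hf | hf
            · exact hf
            · exact absurd hf.listed_right this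
            · exact absurd hf.2 this
          have hfree : Listed ((I.replaceList w Q').workerPref (I.worker e)) e ∧
            (I.ofWorker T' (I.worker e) = ∅ ∨ ∃ d ∈ I.ofWorker T' (I.worker e),
              Prefers ((I.replaceList w Q').workerPref (I.worker e)) e d) := by
            rw [hwe, replaceList_workerPref_self]
            exact ⟨hp.listed_left, Or.inr ⟨d, mem_ofWorker.2 hd', hp⟩⟩
          exact hfree
    obtain ⟨s, hs, hws, hp⟩ := hS.exists_mem hst ha.1
    rw [ha.2] at hws hp
    refine ⟨s, hs, hws, fun hcon => hp ?_⟩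
    rw [← hP, hPQ, prefers_append]
    exact Or.inr (Or.inr ⟨hT'l a ha.1 ha.2, hcs s hcon⟩)

end OLC

/-! ### Feasible sets of the auxiliary instance -/

section Copies

variable {n : ℕ}

theorem mem_allCopies {L : Finset (Fin n)} {x : Fin n × Fin 3} : x ∈ allCopies L ↔ x.1 ∈ L := by
  simp [allCopies]

theorem proj_allCopies (L : Finset (Fin n)) : proj (allCopies L) = L := by
  ext i
  simp [proj, allCopies]

theorem mem_proj {S : Finset (Fin n × Fin 3)} {i : Fin n} : i ∈ proj S ↔ ∃ c, (i, c) ∈ S := by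
  simp [proj]

theorem card_inter_allCopies {S : Finset (Fin n × Fin 3)} (hS : Set.InjOn Prod.fst (S : Set (Fin n × Fin 3)))
    (L : Finset (Fin n)) : (S ∩ allCopies L).card = (proj S ∩ L).card := by
  have : proj S ∩ L = (S ∩ allCopies L).image Prod.fst := by
    ext i
    simp only [Finset.mem_inter, mem_proj, Finset.mem_image, mem_allCopies]
    constructor
    · rintro ⟨⟨c, hc⟩, hi⟩
      exact ⟨(i, c), ⟨hc, hi⟩, rfl⟩
    · rintro ⟨x, ⟨hx, hi⟩, rfl⟩
      exact ⟨⟨x.2, hx⟩, hi⟩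
  rw [this, Finset.card_image_of_injOn (hS.mono (by simp))]

end Copies

namespace OLC

variable {W F : Type*} [DecidableEq W] [DecidableEq F] {n : ℕ}

theorem mem_auxiliary_laminar {I : OLC W F (Fin n)} {f : F} {K : Finset (Fin n × Fin 3)} :
    K ∈ I.auxiliary.laminar f ↔
      ∃ L, allCopies L = K ∧ (L ∈ I.laminar f ∨ ∃ i, I.firm i = f ∧ L = {i}) := by
  simp only [auxiliary, Finset.mem_union, Finset.mem_image, Finset.mem_filter, Finset.mem_univ,
    true_and]
  constructor
  · rintro (⟨i, hi, rfl⟩ | ⟨L, hL, rfl⟩)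
    · exact ⟨_, rfl, Or.inr ⟨i, hi, rfl⟩⟩
    · exact ⟨_, rfl, Or.inl hL⟩
  · rintro ⟨L, rfl, hL | ⟨i, hi, rfl⟩⟩
    · exact Or.inr ⟨L, hL, rfl⟩
    · exact Or.inl ⟨i, hi, rfl⟩

theorem isStrictInstance_auxiliary {I : OLC W F (Fin n)} (hI : I.IsInstance) :
    I.auxiliary.IsStrictInstance where
  workerPref_on w := isPrefListOn_auxList (by decide) (by decide) (by decide) (by decide)
    (hI.workerPref_on w)
  firmPref_on f := isPrefListOn_auxList (by decide) (by decide) (by decide) (by decide)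
    (hI.firmPref_on f)
  firmPref_all e := (listed_auxList (by decide)).2 (hI.firmPref_all e.1)
  laminar_sub f K hK e he := by
    obtain ⟨L, rfl, hL | ⟨i, hi, rfl⟩⟩ := mem_auxiliary_laminar.1 hK
    · exact hI.laminar_sub f L hL e.1 (mem_allCopies.1 he)
    · rw [mem_allCopies, Finset.mem_singleton] at he
      exact (congrArg I.firm he).trans hi
  laminar f K hK K' hK' := by
    obtain ⟨L, rfl, hL⟩ := mem_auxiliary_laminar.1 hK
    obtain ⟨L', rfl, hL'⟩ := mem_auxiliary_laminar.1 hK'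
    have h : L ⊆ L' ∨ L' ⊆ L ∨ Disjoint L L' := by
      rcases hL with hL | ⟨i, -, rfl⟩
      · rcases hL' with hL' | ⟨j, -, rfl⟩
        · exact hI.laminar f L hL L' hL'
        · simp only [Finset.singleton_subset_iff, Finset.disjoint_singleton_right]
          tauto
      · simp only [Finset.singleton_subset_iff, Finset.disjoint_singleton_left]
        tauto
    simp only [Finset.disjoint_left, Finset.subset_iff, mem_allCopies, Prod.forall] at h ⊢
    exact h.imp (fun h a _ => @h a) (Or.imp (fun h a _ => @h a) fun h a _ => @h a)
  workers w := isStrictList_auxList _ _ _ _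
  firms f := isStrictList_auxList _ _ _ _

/-- The only overlap of the two kinds of constraints is at singletons, where the minimum in the
quota enforces both. -/
theorem quotaIndep_auxiliary_iff {I : OLC W F (Fin n)} (hI : I.IsInstance) {f : F} {S : Finset (Fin n × Fin 3)} :
    QuotaIndep (I.auxiliary.laminar f) (I.auxiliary.quota f) S ↔
      (∀ i, I.firm i = f → (S ∩ allCopies {i}).card ≤ 1) ∧
        ∀ L ∈ I.laminar f, (S ∩ allCopies L).card ≤ I.quota f L := by
  have hq : ∀ L, I.auxiliary.quota f (allCopies L) = if L.card = 1 then
      if L ∈ I.laminar f then min 1 (I.quota f L) else 1 else I.quota f L := fun L => by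
    simp only [auxiliary, proj_allCopies]
  have hmem := fun K => mem_auxiliary_laminar (I := I) (f := f) (K := K)
  constructor
  · intro h
    refine ⟨fun i hi => ?_, fun L hL => ?_⟩
    · have := h _ ((hmem _).2 ⟨{i}, rfl, Or.inr ⟨i, hi, rfl⟩⟩)
      rw [hq] at this
      simp only [Finset.card_singleton, if_true] at this
      split_ifs at this <;> omega
    · have := h _ ((hmem _).2 ⟨L, rfl, Or.inl hL⟩)
      rw [hq] at this
      simp only [hL, if_true] at this
      split_ifs at this <;> omega
  · rintro ⟨h1, h2⟩ K hK
    obtain ⟨L, rfl, hL⟩ := (hmem K).1 hK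
    rw [hq]
    split_ifs with h3 h4
    · refine le_min ?_ (h2 L h4)
      obtain ⟨i, rfl⟩ := Finset.card_eq_one.1 h3
      rcases hL with hL | ⟨j, hj, hL⟩
      · exact h1 i (hI.laminar_sub f _ hL i (Finset.mem_singleton_self i))
      · rw [Finset.singleton_inj] at hL
        exact h1 i (hL ▸ hj)
    · rcases hL with hL | ⟨j, hj, rfl⟩
      · exact absurd hL h4
      · exact h1 j hj
    · rcases hL with hL | ⟨j, hj, rfl⟩
      · exact h2 L hL
      · simp at h3

theorem auxiliary_firmFeasible_iff {I : OLC W F (Fin n)} (hI : I.IsInstance) {f : F}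
    {S : Finset (Fin n × Fin 3)} : I.auxiliary.FirmFeasible f S ↔
      (∀ i, I.firm i = f → (S ∩ allCopies {i}).card ≤ 1) ∧
        ∀ L ∈ I.laminar f, (S ∩ allCopies L).card ≤ I.quota f L := by
  rw [(isStrictInstance_auxiliary hI).firmFeasible_iff, quotaIndep_auxiliary_iff hI]

theorem auxiliary_firmFeasible_of_injOn {I : OLC W F (Fin n)} (hI : I.IsInstance) {f : F}
    {S : Finset (Fin n × Fin 3)} (hS : Set.InjOn Prod.fst (S : Set (Fin n × Fin 3))) :
    I.auxiliary.FirmFeasible f S ↔ I.FirmFeasible f (proj S) := by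
  rw [auxiliary_firmFeasible_iff hI, hI.firmFeasible_iff]
  simp only [card_inter_allCopies hS]
  refine ⟨fun h => h.2, fun h => ⟨fun i _ => ?_, h⟩⟩
  simpa using Finset.card_le_card (Finset.inter_subset_right (s₁ := proj S) (s₂ := {i}))

theorem IsMatching.injOn_fst {I : OLC W F (Fin n)} {S : Finset (Fin n × Fin 3)}
    (hS : I.auxiliary.IsMatching S) : Set.InjOn Prod.fst (S : Set (Fin n × Fin 3)) :=
  fun _ hx _ hy h => hS.worker_inj hx hy (congrArg I.worker h)

theorem replaceList_auxiliary (I : OLC W F (Fin n)) (w : W) (P : PrefList (Fin n)) :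
    (I.replaceList w P).auxiliary = I.auxiliary.replaceList w (auxList 0 1 2 P) := by
  have : (fun v => auxList 0 1 2 (Function.update I.workerPref w P v)) =
      Function.update (fun v => auxList 0 1 2 (I.workerPref v)) w (auxList 0 1 2 P) := by
    funext v
    by_cases h : v = w
    · subst h; simp
    · simp [h]
  simp only [auxiliary, replaceList, this]
  rfl

theorem prefers_auxiliary_worker {I : OLC W F (Fin n)} (hI : I.IsInstance) {w : W} {e d : Fin n}
    {i j : Fin 3} : Prefers (I.auxiliary.workerPref w) (e, i) (d, j) ↔
      Listed (I.workerPref w) e ∧ Listed (I.workerPref w) d ∧ ((i ≠ 2 ∧ j = 2) ∨ ((i = 2 ↔ j = 2) ∧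
        (pos (I.workerPref w) e < pos (I.workerPref w) d ∨
          pos (I.workerPref w) e = pos (I.workerPref w) d ∧ ((i = 0 ∧ j = 1) ∨ (i = j ∧ e < d))))) :=
  prefers_auxList (by decide) (by decide) (by decide) (by decide) (hI.workerPref_on w).2.1

theorem listed_auxiliary_worker {I : OLC W F (Fin n)} {w : W} {x : Fin n × Fin 3} :
    Listed (I.auxiliary.workerPref w) x ↔ Listed (I.workerPref w) x.1 :=
  listed_auxList (by decide)

/-- Equal positions on a list without ties mean equal contracts, so the tie-breaking by index
disappears, and within one contract only the third copy against the second remains. -/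
theorem prefers_auxiliary_firm {I : OLC W F (Fin n)} (hI : I.IsInstance) (hF : I.TiesOnlyInWorkers)
    {f : F} {e d : Fin n} {i j : Fin 3} : Prefers (I.auxiliary.firmPref f) (e, i) (d, j) ↔
      Listed (I.firmPref f) e ∧ Listed (I.firmPref f) d ∧ ((i ≠ 0 ∧ j = 0) ∨ ((i = 0 ↔ j = 0) ∧
        (Prefers (I.firmPref f) e d ∨ e = d ∧ i = 2 ∧ j = 1))) := by
  have h := prefers_auxList (n := n) (a := 2) (b := 1) (c := 0) (by decide) (by decide) (by decide)
    (by decide) (hI.firmPref_on f).2.1 (e := e) (d := d) (i := i) (j := j)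
  refine h.trans (and_congr_right fun he => and_congr_right fun hd => or_congr_right
    (and_congr_right fun _ => ?_))
  rw [prefers_iff (hI.firmPref_on f).2.1]
  refine or_congr (by simp [he, hd]) ⟨fun h => ?_, fun h => ⟨by rw [h.1], Or.inl h.2⟩⟩
  have := pos_injOn (hI.firmPref_on f).2.1 (hF f) he hd h.1
  subst this
  exact ⟨rfl, h.2.resolve_right fun h => lt_irrefl _ h.2⟩

/-! ### Strategy-proofness of the projected matching -/

/-- Exchanging the second and the third copy of a contract. -/
def swapCopies (b : Fin n) : Equiv.Perm (Fin n × Fin 3) := Equiv.swap (b, 2) (b, 1)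

theorem swapCopies_fst (b : Fin n) (x : Fin n × Fin 3) : (swapCopies b x).1 = x.1 := by
  rw [swapCopies, Equiv.swap_apply_def]
  split_ifs with h1 h2 <;> simp_all

theorem mem_map_swapCopies {b : Fin n} {S : Finset (Fin n × Fin 3)} {x : Fin n × Fin 3} :
    x ∈ S.map (swapCopies b).toEmbedding ↔ swapCopies b x ∈ S := by
  rw [Finset.mem_map_equiv, swapCopies, Equiv.symm_swap]

theorem firmFeasible_map_swapCopies {I : OLC W F (Fin n)} (hI : I.IsInstance) {f : F} {b : Fin n}
    {S : Finset (Fin n × Fin 3)} (h : I.auxiliary.FirmFeasible f (S.map (swapCopies b).toEmbedding)) :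
    I.auxiliary.FirmFeasible f S := by
  have : ∀ L, (S ∩ allCopies L).card = (S.map (swapCopies b).toEmbedding ∩ allCopies L).card := by
    intro L
    rw [← Finset.card_map (swapCopies b).toEmbedding]
    congr 1
    ext x
    simp only [mem_map_swapCopies, Finset.mem_inter, mem_allCopies, swapCopies_fst]
  rw [auxiliary_firmFeasible_iff hI] at h ⊢
  simpa only [this] using h

theorem map_swapCopies_map (b : Fin n) (S : Finset (Fin n × Fin 3)) :
    (S.map (swapCopies b).toEmbedding).map (swapCopies b).toEmbedding = S := by
  ext x
  simp only [mem_map_swapCopies]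
  rw [swapCopies, Equiv.swap_apply_self]

theorem swapCopies_of_ne {b : Fin n} {x : Fin n × Fin 3} (h : x.1 ≠ b) : swapCopies b x = x :=
  Equiv.swap_apply_of_ne_of_ne (fun h' => h (by rw [h'])) (fun h' => h (by rw [h']))

/-- The third and the second copy of a contract are neighbours on the list of the firm. -/
theorem IsStable.map_swapCopies {I : OLC W F (Fin n)} (hI : I.IsInstance)
    (hF : I.TiesOnlyInWorkers) {b : Fin n} {T : Finset (Fin n × Fin 3)}
    (hT : (I.auxiliary.replaceList (I.worker b) [{(b, 2)}]).IsStable T) (hb : (b, 2) ∈ T) :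
    (I.auxiliary.replaceList (I.worker b) [{(b, 1)}]).IsStable
      (T.map (swapCopies b).toEmbedding) := by
  obtain ⟨w, hw⟩ : ∃ w, w = I.worker b := ⟨_, rfl⟩
  rw [← hw] at hT ⊢
  set J := I.auxiliary with hJ
  set σ := swapCopies b with hσ
  have hwσ : ∀ x, J.worker (σ x) = J.worker x := fun x => congrArg I.worker (swapCopies_fst b x)
  have hfσ : ∀ x, J.firm (σ x) = J.firm x := fun x => congrArg I.firm (swapCopies_fst b x)
  have hbw : J.worker (b, 2) = w := hw.symm
  have hTw : ∀ x ∈ T, J.worker x = w → x = (b, 2) := fun x hx h =>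
    hT.1.worker_inj hx hb (h.trans hbw.symm)
  have hb1 : (b, 1) ∉ T := fun h => by simpa using hTw _ h hw.symm
  have hσ2 : σ (b, 1) = (b, 2) := Equiv.swap_apply_right _ _
  have hT'w : ∀ x ∈ T.map σ.toEmbedding, J.worker x = w → x = (b, 1) := by
    intro x hx h
    rw [mem_map_swapCopies] at hx
    exact σ.injective (hσ2.symm ▸ hTw _ hx ((hwσ x).trans h))
  have hne : ∀ x, J.worker x ≠ w → σ x = x := fun x hx =>
    swapCopies_of_ne fun h => hx ((congrArg I.worker h).trans hw.symm)
  have hofw : ∀ v, v ≠ w → J.ofWorker (T.map σ.toEmbedding) v = J.ofWorker T v := by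
    intro v hv
    ext x
    rw [mem_ofWorker, mem_ofWorker, mem_map_swapCopies]
    refine and_congr_left fun h => ?_
    rw [hne x (h ▸ hv)]
  have hoff : ∀ f, J.ofFirm (T.map σ.toEmbedding) f = (J.ofFirm T f).map σ.toEmbedding := by
    intro f
    ext x
    rw [mem_ofFirm, mem_map_swapCopies, mem_map_swapCopies, mem_ofFirm, hfσ]
  refine ⟨⟨fun x hx => ?_, fun v => Finset.card_le_one.2 fun x hx y hy => ?_, fun f => ?_⟩,
    fun x hx hblock => ?_⟩
  · change Listed ((J.replaceList w [{(b, 1)}]).workerPref (J.worker x)) x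
    by_cases h : J.worker x = w
    · rw [h, replaceList_workerPref_self, listed_singleton]
      exact hT'w x hx h
    · rw [replaceList_workerPref_of_ne _ _ h]
      rw [mem_map_swapCopies, ← hσ, hne x h] at hx
      have := hT.1.1 x hx
      change Listed ((J.replaceList w [{(b, 2)}]).workerPref (J.worker x)) x at this
      rwa [replaceList_workerPref_of_ne _ _ h] at this
  · rw [mem_ofWorker, mem_map_swapCopies] at hx hy
    refine σ.injective (hT.1.worker_inj hx.1 hy.1 ?_)
    change J.worker _ = J.worker _
    rw [hwσ, hwσ]
    exact hx.2.trans hy.2.symm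
  · refine firmFeasible_map_swapCopies hI (b := b) ?_
    rw [map_swapCopies_map]
    exact hT.1.2.2 f
  · have h1 : Listed ((J.replaceList w [{(b, 1)}]).workerPref (J.worker x)) x ∧
      (J.ofWorker (T.map σ.toEmbedding) (J.worker x) = ∅ ∨
        ∃ d ∈ J.ofWorker (T.map σ.toEmbedding) (J.worker x),
        Prefers ((J.replaceList w [{(b, 1)}]).workerPref (J.worker x)) x d) := hblock.1
    -- The worker `w` lists nothing but `(b, 1)`, which she holds after the exchange.
    by_cases h : J.worker x = w
    · rw [h, replaceList_workerPref_self, listed_singleton] at h1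
      refine hx (mem_map_swapCopies.2 ?_)
      rw [h1.1, ← hσ, hσ2]
      exact hb
    rw [replaceList_workerPref_of_ne _ _ h, hofw _ h] at h1
    rw [mem_map_swapCopies, ← hσ, hne x h] at hx
    refine hT.2 x hx ⟨?_, ?_⟩
    · change Listed ((J.replaceList w [{(b, 2)}]).workerPref (J.worker x)) x ∧
        (J.ofWorker T (J.worker x) = ∅ ∨ ∃ d ∈ J.ofWorker T (J.worker x),
          Prefers ((J.replaceList w [{(b, 2)}]).workerPref (J.worker x)) x d)
      rwa [replaceList_workerPref_of_ne _ _ h]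
    · have h2 : J.FreeForFirm (T.map σ.toEmbedding) x := hblock.2
      have h3 : insert x (J.ofFirm (T.map σ.toEmbedding) (J.firm x)) =
          (insert x (J.ofFirm T (J.firm x))).map σ.toEmbedding := by
        rw [hoff, Finset.map_insert, Equiv.coe_toEmbedding, hne x h]
      rw [FreeForFirm, h3] at h2
      rcases h2 with h2 | ⟨d, hd, hp, h2⟩
      · exact Or.inl (firmFeasible_map_swapCopies hI h2)
      · rw [hoff, mem_map_swapCopies, ← hσ] at hd
        refine Or.inr ⟨σ d, hd, ?_, firmFeasible_map_swapCopies hI (b := b) ?_⟩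
        · change Prefers (J.firmPref (J.firm x)) x (σ d)
          by_cases hd1 : d = (b, 1)
          · rw [hd1, hσ2]
            rw [hd1] at hp
            obtain ⟨e, i⟩ := x
            -- No copy of another contract stands between the second and the third copy of `b`, so
            -- `x` compares with both in the same way.
            have hxb : e ≠ b := fun hcon => h ((congrArg I.worker hcon).trans hw.symm)
            rw [hJ, prefers_auxiliary_firm hI hF] at hp ⊢
            simpa [hxb] using hp
          · have : σ d = d := by
              refine Equiv.swap_apply_of_ne_of_ne ?_ hd1
              rintro rfl
              have : σ (b, 2) = (b, 1) := Equiv.swap_apply_left _ _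
              rw [this] at hd
              exact hb1 (mem_ofFirm.1 hd).1
            rwa [this]
        · have : ((insert x (J.ofFirm T (J.firm x))).erase (σ d)).map σ.toEmbedding =
              ((insert x (J.ofFirm T (J.firm x))).map σ.toEmbedding).erase d := by
            ext y
            simp only [mem_map_swapCopies, Finset.mem_erase, hσ, ne_eq, (swapCopies b).injective.eq_iff]
          exact (congrArg (I.auxiliary.FirmFeasible (J.firm x)) this).mpr h2

/-- No worker can get a contract that she strictly prefers by replacing her list. -/
theorem exists_mem_proj_of_replaceList [Fintype F] {I : OLC W F (Fin n)} (hI : I.IsInstance)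
    (hF : I.TiesOnlyInWorkers) {S T : Finset (Fin n × Fin 3)} (hS : I.auxiliary.IsWorkerOptimal S)
    {w : W} {P : PrefList (Fin n)} (hT : (I.replaceList w P).auxiliary.IsStable T) {b : Fin n}
    (hb : b ∈ proj T) (hbw : I.worker b = w) (hl : Listed (I.workerPref w) b) :
    ∃ a ∈ proj S, I.worker a = w ∧ ¬ Prefers (I.workerPref w) b a := by
  subst hbw
  -- Every copy of a contract worse than `b` stands behind the first and the second copy of `b`.
  -- This fails for the third copy, which stands behind the first and second copies of the whole
  -- list.
  have key : ∀ (k : Fin 3) (T : Finset (Fin n × Fin 3)), k ≠ 2 → (b, k) ∈ T →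
      (I.auxiliary.replaceList (I.worker b) [{(b, k)}]).IsStable T →
      ∃ a ∈ proj S, I.worker a = I.worker b ∧ ¬ Prefers (I.workerPref (I.worker b)) b a := by
    intro k T hk hb hT
    obtain ⟨⟨a, j⟩, ha, haw, hp⟩ := hS.exists_mem_of_singleton (isStrictInstance_auxiliary hI)
      (c := (b, k)) (listed_auxiliary_worker.2 hl) hT hb
    refine ⟨a, mem_proj.2 ⟨j, ha⟩, haw, fun h => hp ?_⟩
    change Prefers (I.auxiliary.workerPref (I.worker b)) _ _
    rw [prefers_auxiliary_worker hI]
    have h' := (prefers_iff (hI.workerPref_on _).2.1).1 h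
    refine ⟨h'.1, h'.2.1, ?_⟩
    by_cases hj : j = 2
    · exact Or.inl ⟨hk, hj⟩
    · exact Or.inr ⟨by simp [hk, hj], Or.inl h'.2.2⟩
  obtain ⟨k, hk⟩ := mem_proj.1 hb
  -- Dropping all but the contract that she holds leaves the worker nothing with which to block.
  have hTk : (I.auxiliary.replaceList (I.worker b) [{(b, k)}]).IsStable T := by
    rw [replaceList_auxiliary] at hT
    rw [← replaceList_replaceList _ _ (auxList 0 1 2 P)]
    refine hT.replaceList (fun e he hwe => ?_) fun e he hwe hle _ => ?_
    · exact listed_singleton.2 (hT.1.worker_inj he hk hwe)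
    · rw [listed_singleton] at hle
      exact absurd (hle ▸ hk) he
  by_cases hk2 : k = 2
  · subst hk2
    refine key 1 _ (by decide) ?_ (hTk.map_swapCopies hI hF hk)
    rw [mem_map_swapCopies, swapCopies, Equiv.swap_apply_right]
    exact hk
  · exact key k T hk2 hk hTk

/-! ### Stability of the projection -/

/-- If `e` could be added to the projection, then its copy could be added to `X`, because
feasibility of sets with at most one copy of each contract is read off from the projection. -/
theorem mem_closure_proj {I : OLC W F (Fin n)} (hI : I.IsInstance) {f : F}
    {X : Finset (Fin n × Fin 3)} (hX : Set.InjOn Prod.fst (X : Set (Fin n × Fin 3)))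
    (hXf : I.auxiliary.FirmFeasible f X) {e : Fin n} {c : Fin 3}
    (h : (e, c) ∈ (firmMatroid (isStrictInstance_auxiliary hI).toIsInstance f).closure X) :
    e ∈ (firmMatroid hI f).closure (proj X : Finset (Fin n)) := by
  by_contra hcon
  have hi : (firmMatroid hI f).Indep (proj X) :=
    (firmMatroid_indep hI).2 ((auxiliary_firmFeasible_of_injOn hI hX).1 hXf)
  have h1 := (hi.notMem_closure_iff (Set.mem_univ _)).1 hcon
  have he : e ∉ proj X := h1.2
  have hins : Set.InjOn Prod.fst ((insert (e, c) X : Finset _) : Set (Fin n × Fin 3)) := by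
    rw [Finset.coe_insert]
    refine (Set.injOn_insert fun h => he (mem_proj.2 ⟨c, h⟩)).2 ⟨hX, ?_⟩
    rintro ⟨x, hx, hxe⟩
    have hxe : x.1 = e := hxe
    exact he (mem_proj.2 ⟨x.2, hxe ▸ hx⟩)
  have h2 : I.auxiliary.FirmFeasible f (insert (e, c) X) := by
    rw [auxiliary_firmFeasible_of_injOn hI hins, ← firmMatroid_indep hI]
    have : ((proj (insert (e, c) X) : Finset (Fin n)) : Set (Fin n)) = insert e (proj X : Set _) := by
      simp [proj]
    rw [this]
    exact h1.1
  rw [← firmMatroid_indep (isStrictInstance_auxiliary hI).toIsInstance, Finset.coe_insert] at h2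
  exact notMem_closure_of_indep h2 (Set.mem_insert _ _) (Set.subset_insert _ _)
    (fun h => he (mem_proj.2 ⟨c, h⟩)) h

/-- If a copy of a contract is free for its worker in a stable matching of the auxiliary instance,
then the contract is spanned by the contracts with a copy that is better for the firm. -/
theorem IsStable.mem_closure_of_copy {I : OLC W F (Fin n)} (hI : I.IsInstance)
    {S : Finset (Fin n × Fin 3)} (hS : I.auxiliary.IsStable S) {e : Fin n} (he : e ∉ proj S)
    {c : Fin 3} (hl : Listed (I.workerPref (I.worker e)) e)
    (hfree : ∀ d j, (d, j) ∈ S → I.worker d = I.worker e →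
      Prefers (I.auxiliary.workerPref (I.worker e)) (e, c) (d, j)) :
    e ∈ (firmMatroid hI (I.firm e)).closure
      {d | ∃ j, (d, j) ∈ S ∧ Prefers (I.auxiliary.firmPref (I.firm e)) (d, j) (e, c)} := by
  classical
  have hA := isStrictInstance_auxiliary hI
  have hec : (e, c) ∉ S := fun h => he (mem_proj.2 ⟨c, h⟩)
  have hfw : I.auxiliary.FreeForWorker S (e, c) := by
    refine ⟨listed_auxiliary_worker.2 hl, ?_⟩
    rcases (I.auxiliary.ofWorker S (I.auxiliary.worker (e, c))).eq_empty_or_nonempty with h | ⟨x, hx⟩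
    · exact Or.inl h
    · have hx' := mem_ofWorker.1 hx
      exact Or.inr ⟨x, hx, hfree x.1 x.2 hx'.1 hx'.2⟩
  have h := (mem_closure_better_iff hA.toIsInstance hA.firms (hS.1.2.2 _) hec).2
    fun h => hS.2 _ hec ⟨hfw, h⟩
  set X := S.filter fun x => Prefers (I.auxiliary.firmPref (I.firm e)) x (e, c) with hX
  have hXS : X ⊆ S := Finset.filter_subset _ _
  have hXb : I.auxiliary.better S (e, c) = X := by
    ext x
    rw [Finset.mem_coe, hX, Finset.mem_filter]
    rfl
  rw [hXb] at h
  have hfe : I.auxiliary.FirmFeasible (I.firm e) X := by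
    have := hS.1.2.2 (I.firm e)
    rw [← firmMatroid_indep hA.toIsInstance] at this ⊢
    exact this.subset (Finset.coe_subset.2 hXS)
  refine Matroid.closure_subset_closure _ ?_
    (mem_closure_proj hI (hS.1.injOn_fst.mono (Finset.coe_subset.2 hXS)) hfe h)
  intro d hd
  obtain ⟨j, hj⟩ := mem_proj.1 (Finset.mem_coe.1 hd)
  rw [hX, Finset.mem_filter] at hj
  exact ⟨j, hj⟩

/-- The third and the second copies are only spanned by better third and second copies. -/
theorem IsStable.mem_closure_of_copy_ne_zero {I : OLC W F (Fin n)} (hI : I.IsInstance)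
    (hF : I.TiesOnlyInWorkers)
    {S : Finset (Fin n × Fin 3)} (hS : I.auxiliary.IsStable S) {e : Fin n} (he : e ∉ proj S)
    {c : Fin 3} (hc : c ≠ 0) (hl : Listed (I.workerPref (I.worker e)) e)
    (hfree : ∀ d j, (d, j) ∈ S → I.worker d = I.worker e →
      Prefers (I.auxiliary.workerPref (I.worker e)) (e, c) (d, j)) :
    e ∈ (firmMatroid hI (I.firm e)).closure
      {d | d ∈ proj S ∧ (d, 0) ∉ S ∧ Prefers (I.firmPref (I.firm e)) d e} := by
  refine Matroid.closure_subset_closure _ ?_ (hS.mem_closure_of_copy hI he hl hfree)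
  rintro d ⟨j, hj, hp⟩
  rw [prefers_auxiliary_firm hI hF] at hp
  have hde : d ≠ e := by
    rintro rfl
    exact he (mem_proj.2 ⟨j, hj⟩)
  have hj0 : j ≠ 0 := by tauto
  refine ⟨mem_proj.2 ⟨j, hj⟩, fun h => hj0 ?_, by tauto⟩
  exact congrArg Prod.snd (hS.1.injOn_fst hj h rfl)

theorem IsMatching.proj {I : OLC W F (Fin n)} (hI : I.IsInstance) {S : Finset (Fin n × Fin 3)}
    (hS : I.auxiliary.IsMatching S) : I.IsMatching (proj S) := by
  refine ⟨fun e he => ?_, fun w => Finset.card_le_one.2 fun e he d hd => ?_, fun f => ?_⟩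
  · obtain ⟨c, hc⟩ := mem_proj.1 he
    exact listed_auxiliary_worker.1 (hS.1 _ hc)
  · rw [mem_ofWorker] at he hd
    obtain ⟨i, hi⟩ := mem_proj.1 he.1
    obtain ⟨j, hj⟩ := mem_proj.1 hd.1
    exact congrArg Prod.fst (hS.worker_inj hi hj (he.2.trans hd.2.symm))
  · exact (auxiliary_firmFeasible_of_injOn hI hS.injOn_fst).1 (hS.2.2 f)

/-- The second copy of a blocking contract precedes every copy of the worker's contract, so it is
free for her. Being spanned by better second and third copies, the contract is spanned by better
contracts of the projection and does not block. -/
theorem IsStable.proj {I : OLC W F (Fin n)} (hI : I.IsInstance) (hF : I.TiesOnlyInWorkers)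
    {S : Finset (Fin n × Fin 3)} (hS : I.auxiliary.IsStable S) : I.IsStable (proj S) := by
  have hM := hS.1.proj hI
  refine ⟨hM, fun e he hb => ?_⟩
  refine (mem_closure_better_iff hI hF (hM.2.2 _) he).1 ?_ hb.2
  have hsub : {d | d ∈ SMTI.proj S ∧ (d, 0) ∉ S ∧ Prefers (I.firmPref (I.firm e)) d e} ⊆
      I.better (SMTI.proj S) e := fun d hd => ⟨hd.1, hd.2.2⟩
  refine Matroid.closure_subset_closure _ hsub
    (hS.mem_closure_of_copy_ne_zero hI hF he (c := 1) (by decide) hb.1.1 fun d j hdj hw => ?_)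
  have hdM : d ∈ I.ofWorker (SMTI.proj S) (I.worker e) := mem_ofWorker.2 ⟨mem_proj.2 ⟨j, hdj⟩, hw⟩
  rcases hb.1.2 with h | ⟨d', hd', h⟩
  · exact absurd (h ▸ hdM) (Finset.notMem_empty d)
  · obtain rfl : d' = d := Finset.card_le_one.1 (hM.2.1 _) d' hd' d hdM
    rw [prefers_iff (hI.workerPref_on _).2.1] at h
    rw [prefers_auxiliary_worker hI]
    refine ⟨h.1, h.2.1, ?_⟩
    by_cases hj : j = 2
    · exact Or.inl ⟨by decide, hj⟩
    · exact Or.inr ⟨by simp [hj], Or.inl h.2.2⟩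

/-! ### The approximation ratio -/

section Ratio

variable {I : OLC W F (Fin n)} {S : Finset (Fin n × Fin 3)} {N : Finset (Fin n)}

open Classical in
/-- The contracts of `N` whose workers are not assigned in `M`. -/
noncomputable def newContracts (I : OLC W F (Fin n)) (M N : Finset (Fin n)) : Finset (Fin n) :=
  N.filter fun e => ∀ d ∈ M, I.worker d ≠ I.worker e

open Classical in
/-- The contracts outside `N` with a second or third copy in `S` whose workers do not strictly
prefer them to their contracts in `N`. -/
noncomputable def lostContracts (I : OLC W F (Fin n)) (S : Finset (Fin n × Fin 3))
    (N : Finset (Fin n)) : Finset (Fin n) :=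
  (proj S).filter fun d => d ∉ N ∧ (d, 0) ∉ S ∧
    ∃ e ∈ N, I.worker e = I.worker d ∧ ¬ Prefers (I.workerPref (I.worker d)) d e

theorem mem_newContracts {M : Finset (Fin n)} {e : Fin n} :
    e ∈ I.newContracts M N ↔ e ∈ N ∧ ∀ d ∈ M, I.worker d ≠ I.worker e := by simp [newContracts]

theorem mem_lostContracts {d : Fin n} : d ∈ I.lostContracts S N ↔ d ∈ proj S ∧ d ∉ N ∧ (d, 0) ∉ S ∧
    ∃ e ∈ N, I.worker e = I.worker d ∧ ¬ Prefers (I.workerPref (I.worker d)) d e := by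
  simp [lostContracts]

/-- An unassigned worker is free for all copies, in particular for the third one, which a firm never
ranks below a first copy. -/
theorem mem_closure_of_mem_newContracts (hI : I.IsInstance) (hF : I.TiesOnlyInWorkers)
    (hS : I.auxiliary.IsStable S) (hN : I.IsStable N) {e : Fin n}
    (he : e ∈ I.newContracts (proj S) N) : e ∈ (firmMatroid hI (I.firm e)).closure
      {d | d ∈ proj S ∧ (d, 0) ∉ S ∧ Prefers (I.firmPref (I.firm e)) d e} := by
  rw [mem_newContracts] at he
  exact hS.mem_closure_of_copy_ne_zero hI hF (fun h => he.2 e h rfl) (c := 2) (by decide)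
    (hN.1.1 e he.1) fun d j hdj hw => absurd hw (he.2 d (mem_proj.2 ⟨j, hdj⟩))

/-- Two kinds of spanning alternate. A new contract is spanned by better contracts with a second or
third copy in `S`. Such a contract, if neither lost nor in `N`, is preferred by its worker to what
she has in `N`, so by stability better contracts of `N` span it. Each step moves up the strict list
of the firm, so the induction on the position ends in the given set. -/
theorem mem_closure_lostContracts (hI : I.IsInstance) (hF : I.TiesOnlyInWorkers)
    (hS : I.auxiliary.IsStable S) (hN : I.IsStable N) (f : F) (k : ℕ) :
    ∀ x, I.firm x = f → pos (I.firmPref f) x = k →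
      (x ∈ N ∨ x ∈ proj S ∧ (x, 0) ∉ S) → x ∈ (firmMatroid hI f).closure
        (I.ofFirm (I.lostContracts S N ∪ (N \ I.newContracts (proj S) N)) f : Finset (Fin n)) := by
  induction k using Nat.strong_induction_on with
  | _ k ih =>
  intro x hf hk hx
  subst hf
  have hpos : ∀ y, Prefers (I.firmPref (I.firm x)) y x → I.firm y = I.firm x ∧
      pos (I.firmPref (I.firm x)) y < k := fun y hy =>
    ⟨hI.firm_eq hy.listed_left, hk ▸ ((prefers_iff (hI.firmPref_on _).2.1).1 hy).2.2⟩
  have hmem : x ∈ I.lostContracts S N ∪ (N \ I.newContracts (proj S) N) → x ∈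
      (firmMatroid hI (I.firm x)).closure (I.ofFirm (I.lostContracts S N ∪
        (N \ I.newContracts (proj S) N)) (I.firm x) : Finset (Fin n)) := fun h =>
    subset_closure_firmMatroid _ _ _ (mem_ofFirm.2 ⟨h, rfl⟩)
  by_cases hxN : x ∈ N
  · by_cases hxA : x ∈ I.newContracts (proj S) N
    · refine Matroid.closure_subset_closure_of_subset_closure ?_
        (mem_closure_of_mem_newContracts hI hF hS hN hxA)
      rintro d ⟨hd, hd0, hp⟩
      obtain ⟨h1, h2⟩ := hpos d hp
      exact ih _ h2 d h1 rfl (Or.inr ⟨hd, hd0⟩)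
    · exact hmem (Finset.mem_union_right _ (Finset.mem_sdiff.2 ⟨hxN, hxA⟩))
  · have hx := hx.resolve_left hxN
    by_cases hxI : x ∈ I.lostContracts S N
    · exact hmem (Finset.mem_union_left _ hxI)
    · have hl := (hS.1.proj hI).1 x hx.1
      have hfree : I.FreeForWorker N x := by
        refine ⟨hl, ?_⟩
        rcases (I.ofWorker N (I.worker x)).eq_empty_or_nonempty with h | ⟨e, he⟩
        · exact Or.inl h
        · refine Or.inr ⟨e, he, ?_⟩
          rw [mem_ofWorker] at he
          by_contra hp
          exact hxI (mem_lostContracts.2 ⟨hx.1, hxN, hx.2, e, he.1, he.2, hp⟩)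
      refine Matroid.closure_subset_closure_of_subset_closure ?_
        ((mem_closure_better_iff hI hF (hN.1.2.2 _) hxN).2 fun h => hN.2 x hxN ⟨hfree, h⟩)
      rintro y ⟨hy, hp⟩
      obtain ⟨h1, h2⟩ := hpos y hp
      exact ih _ h2 y h1 rfl (Or.inl hy)

theorem card_eq_sum_ofFirm [Fintype F] (I : OLC W F (Fin n)) (M : Finset (Fin n)) :
    M.card = ∑ f, (I.ofFirm M f).card :=
  Finset.card_eq_sum_card_fiberwise fun _ _ => Finset.mem_univ _

theorem card_newContracts_le [Fintype F] (hI : I.IsInstance) (hF : I.TiesOnlyInWorkers)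
    (hS : I.auxiliary.IsStable S) (hN : I.IsStable N) :
    (I.newContracts (proj S) N).card ≤ (I.lostContracts S N).card := by
  have hsub : I.newContracts (proj S) N ⊆ N := fun e he => (mem_newContracts.1 he).1
  have h : N.card ≤ (I.lostContracts S N ∪ (N \ I.newContracts (proj S) N)).card := by
    rw [card_eq_sum_ofFirm I N, card_eq_sum_ofFirm I (_ ∪ _)]
    refine Finset.sum_le_sum fun f _ => card_le_of_subset_closure (M := firmMatroid hI f)
      ((firmMatroid_indep hI).2 (firmFeasible_ofFirm.2 (hN.1.2.2 f))) fun e he => ?_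
    have he := mem_ofFirm.1 he
    exact mem_closure_lostContracts hI hF hS hN f _ e he.2 rfl (Or.inl he.1)
  have h1 := Finset.card_union_le (I.lostContracts S N) (N \ I.newContracts (proj S) N)
  rw [Finset.card_sdiff_of_subset hsub] at h1
  have h2 := Finset.card_le_card hsub
  omega

/-- Here the first copies matter: `e` is at least as good as `d`, and `S` contains only a second or
third copy of `d`. So the first copy of `e` precedes it, even if `e` and `d` are tied, and is free
for the worker. -/
theorem mem_closure_proj_of_mem (hI : I.IsInstance) (hS : I.auxiliary.IsStable S)
    (hN : I.IsStable N) {e d : Fin n} (he : e ∈ N) (hd : d ∈ I.lostContracts S N)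
    (hw : I.worker e = I.worker d) : e ∈ (firmMatroid hI (I.firm e)).closure
      (I.ofFirm (proj S) (I.firm e) : Finset (Fin n)) := by
  obtain ⟨hdS, hdN, hd0, e', he', hw', hp⟩ := mem_lostContracts.1 hd
  obtain rfl := hN.1.worker_inj he' he (hw'.trans hw.symm)
  have hM := hS.1.proj hI
  have heM : e' ∉ proj S := by
    intro h
    obtain rfl := hM.worker_inj h hdS hw
    exact hdN he
  have hl := hN.1.1 e' he
  refine Matroid.closure_subset_closure _ ?_ (hS.mem_closure_of_copy hI heM (c := 0) hl ?_)
  · rintro x ⟨j, hj, hp⟩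
    exact mem_ofFirm.2 ⟨mem_proj.2 ⟨j, hj⟩,
      hI.firm_eq ((listed_auxList (by decide)).1 hp.listed_left)⟩
  · intro x j hj hxw
    obtain rfl := hM.worker_inj (mem_proj.2 ⟨j, hj⟩) hdS (hxw.trans hw)
    have hlx := hM.1 x hdS
    rw [hw] at hl ⊢
    rw [prefers_auxiliary_worker hI]
    rw [prefers_iff (hI.workerPref_on _).2.1] at hp
    have hj0 : j ≠ 0 := by
      rintro rfl
      exact hd0 hj
    refine ⟨hl, hlx, ?_⟩
    have hle : pos (I.workerPref (I.worker x)) e' ≤ pos (I.workerPref (I.worker x)) x := by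
      by_contra hcon
      exact hp ⟨hlx, hl, by omega⟩
    by_cases hj2 : j = 2
    · exact Or.inl ⟨by decide, hj2⟩
    · refine Or.inr ⟨by simp [hj2], ?_⟩
      have : j = 1 := by omega
      rcases hle.lt_or_eq with h | h
      · exact Or.inl h
      · exact Or.inr ⟨h, Or.inl ⟨rfl, this⟩⟩

/-- The approximation ratio. -/
theorem two_mul_card_le [Fintype F] (hI : I.IsInstance) (hF : I.TiesOnlyInWorkers)
    (hS : I.auxiliary.IsStable S) (hN : I.IsStable N) : 2 * N.card ≤ 3 * (proj S).card := by
  classical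
  have hM := hS.1.proj hI
  have hinj : ∀ X M : Finset (Fin n), I.IsMatching M → X ⊆ M → (X.image I.worker).card = X.card :=
    fun X M hM hX => Finset.card_image_of_injOn fun e he d hd h => hM.worker_inj (hX he) (hX hd) h
  set A := I.newContracts (proj S) N with hA
  set Q := I.lostContracts S N with hQ
  set C := N.filter fun e => ∃ d ∈ Q, I.worker e = I.worker d with hC
  have hAN : A ⊆ N := fun e he => (mem_newContracts.1 he).1
  have hCN : C ⊆ N := Finset.filter_subset _ _
  have hQM : Q ⊆ proj S := fun d hd => (mem_lostContracts.1 hd).1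
  have h1 : A.card ≤ Q.card := card_newContracts_le hI hF hS hN
  have h2 : Q.card ≤ C.card := by
    rw [← hinj Q _ hM hQM, ← hinj C _ hN.1 hCN]
    refine Finset.card_le_card fun w hw => ?_
    obtain ⟨d, hd, rfl⟩ := Finset.mem_image.1 hw
    obtain ⟨-, -, -, e, he, hew, -⟩ := mem_lostContracts.1 hd
    exact Finset.mem_image.2 ⟨e, Finset.mem_filter.2 ⟨he, d, hd, hew⟩, hew⟩
  -- The workers of `C` are assigned in the projection, those of `A` are not.
  have h3 : (A ∪ C).card = A.card + C.card := by
    refine Finset.card_union_of_disjoint (Finset.disjoint_left.2 fun e heA heC => ?_)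
    obtain ⟨-, d, hd, hw⟩ := Finset.mem_filter.1 heC
    exact (mem_newContracts.1 heA).2 d (hQM hd) hw.symm
  have h4 : (A ∪ C).card ≤ (proj S).card := by
    rw [card_eq_sum_ofFirm I (A ∪ C), card_eq_sum_ofFirm I (proj S)]
    refine Finset.sum_le_sum fun f _ => card_le_of_subset_closure (M := firmMatroid hI f) ?_ ?_
    · refine ((firmMatroid_indep hI).2 (hN.1.2.2 f)).subset fun e he => ?_
      exact Finset.union_subset hAN hCN (mem_ofFirm.1 he).1
    · intro e he
      obtain ⟨heU, rfl⟩ := mem_ofFirm.1 (Finset.mem_coe.1 he)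
      rcases Finset.mem_union.1 heU with he | he
      · refine Matroid.closure_subset_closure _ (fun d hd => ?_)
          (mem_closure_of_mem_newContracts hI hF hS hN he)
        exact mem_ofFirm.2 ⟨hd.1, hI.firm_eq hd.2.2.listed_left⟩
      · obtain ⟨heN, d, hd, hw⟩ := Finset.mem_filter.1 he
        exact mem_closure_proj_of_mem hI hS hN heN hd hw
  -- Each contract of `N` outside `A` has a worker who is assigned in the projection.
  have h5 : (N \ A).card ≤ (proj S).card := by
    rw [← hinj (N \ A) _ hN.1 Finset.sdiff_subset, ← hinj _ _ hM subset_rfl]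
    refine Finset.card_le_card fun w hw => ?_
    obtain ⟨e, he, rfl⟩ := Finset.mem_image.1 hw
    rw [Finset.mem_sdiff, hA, mem_newContracts] at he
    push Not at he
    obtain ⟨d, hd, hdw⟩ := he.2 he.1
    exact Finset.mem_image.2 ⟨d, hd, hdw⟩
  rw [Finset.card_sdiff_of_subset hAN] at h5
  have h6 := Finset.card_le_card hAN
  omega

end Ratio

end OLC

/-! ### Reasoning about programs -/

namespace Prog

/-- The program contains a command that writes into register `r`. -/
def writesReg : Prog → ℕ → Bool
  | skip, _ => false
  | const r _, x => x == r
  | move r _, x => x == r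
  | inc r, x => x == r
  | dec r, x => x == r
  | load r _ _, x => x == r
  | store _ _ _, _ => false
  | seq p q, x => p.writesReg x || q.writesReg x
  | ite _ p q, x => p.writesReg x || q.writesReg x
  | loop _ p, x => p.writesReg x

/-- The program contains a command that writes into array `a`. -/
def writesArr : Prog → ℕ → Bool
  | store a _ _, x => x == a
  | seq p q, x => p.writesArr x || q.writesArr x
  | ite _ p q, x => p.writesArr x || q.writesArr x
  | loop _ p, x => p.writesArr x
  | _, _ => false

/-- The program contains no loops. -/
def loopFree : Prog → Bool
  | seq p q => p.loopFree && q.loopFree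
  | ite _ p q => p.loopFree && q.loopFree
  | loop _ _ => false
  | _ => true

/-- An upper bound on the number of steps of a program without loops. -/
def cost : Prog → ℕ
  | seq p q => p.cost + q.cost
  | ite _ p q => max p.cost q.cost + 1
  | _ => 1

end Prog

instance (b : Test) (s : Mem) : Decidable (b.Holds s) :=
  match b with
  | .lt r₁ r₂ => inferInstanceAs (Decidable (s.reg r₁ < s.reg r₂))
  | .eq r₁ r₂ => inferInstanceAs (Decidable (s.reg r₁ = s.reg r₂))

/-- The final memory of a program without loops. -/
def Prog.den : Prog → Mem → Mem
  | .skip, s => s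
  | .const r c, s => s.setReg r c
  | .move r₁ r₂, s => s.setReg r₁ (s.reg r₂)
  | .inc r, s => s.setReg r (s.reg r + 1)
  | .dec r, s => s.setReg r (s.reg r - 1)
  | .load r a i, s => s.setReg r (s.arr a (s.reg i))
  | .store a i r, s => s.setArr a (s.reg i) (s.reg r)
  | .seq p q, s => q.den (p.den s)
  | .ite b p q, s => if b.Holds s then p.den s else q.den s
  | .loop _ _, s => s

theorem Exec.reg_eq {p : Prog} {s s' : Mem} {t : ℕ} (h : Exec p s t s') {r : ℕ}
    (hr : p.writesReg r = false) : s'.reg r = s.reg r := by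
  induction h with
  | skip | store => rfl
  | const | move | inc | dec | load =>
    simp only [Prog.writesReg, beq_eq_false_iff_ne, ne_eq] at hr
    exact Function.update_of_ne hr _ _
  | seq _ _ ih₁ ih₂ =>
    simp only [Prog.writesReg, Bool.or_eq_false_iff] at hr
    exact (ih₂ hr.2).trans (ih₁ hr.1)
  | ite_true _ _ ih =>
    simp only [Prog.writesReg, Bool.or_eq_false_iff] at hr
    exact ih hr.1
  | ite_false _ _ ih =>
    simp only [Prog.writesReg, Bool.or_eq_false_iff] at hr
    exact ih hr.2
  | loop_true _ _ _ ih₁ ih₂ =>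
    exact (ih₂ hr).trans (ih₁ hr)
  | loop_false => rfl

theorem Exec.arr_eq {p : Prog} {s s' : Mem} {t : ℕ} (h : Exec p s t s') {a : ℕ}
    (ha : p.writesArr a = false) : s'.arr a = s.arr a := by
  induction h with
  | skip | const | move | inc | dec | load | loop_false => rfl
  | store =>
    simp only [Prog.writesArr, beq_eq_false_iff_ne, ne_eq] at ha
    exact Function.update_of_ne ha _ _
  | seq _ _ ih₁ ih₂ =>
    simp only [Prog.writesArr, Bool.or_eq_false_iff] at ha
    exact (ih₂ ha.2).trans (ih₁ ha.1)
  | ite_true _ _ ih =>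
    simp only [Prog.writesArr, Bool.or_eq_false_iff] at ha
    exact ih ha.1
  | ite_false _ _ ih =>
    simp only [Prog.writesArr, Bool.or_eq_false_iff] at ha
    exact ih ha.2
  | loop_true _ _ _ ih₁ ih₂ =>
    exact (ih₂ ha).trans (ih₁ ha)

/-- Started in memory `s`, the program halts after at most `T` steps, with a memory that
satisfies `Q`, and changes only registers and arrays into which it writes. -/
def Runs (p : Prog) (s : Mem) (T : ℕ) (Q : Mem → Prop) : Prop :=
  ∃ t s', Exec p s t s' ∧ t ≤ T ∧ Q s'

theorem Runs.frame {p : Prog} {s : Mem} {T : ℕ} {Q : Mem → Prop} (h : Runs p s T Q) :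
    Runs p s T fun s' => Q s' ∧ (∀ r, p.writesReg r = false → s'.reg r = s.reg r) ∧
      ∀ a, p.writesArr a = false → s'.arr a = s.arr a := by
  obtain ⟨t, s', h1, h2, h3⟩ := h
  exact ⟨t, s', h1, h2, h3, fun _ => h1.reg_eq, fun _ => h1.arr_eq⟩

theorem Runs.mono {p : Prog} {s : Mem} {T T' : ℕ} {Q Q' : Mem → Prop} (h : Runs p s T Q)
    (hT : T ≤ T') (hQ : ∀ s', Q s' → Q' s') : Runs p s T' Q' := by
  obtain ⟨t, s', h1, h2, h3⟩ := h
  exact ⟨t, s', h1, h2.trans hT, hQ s' h3⟩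

theorem Runs.seq {p q : Prog} {s : Mem} {T₁ T₂ : ℕ} {Q Q' : Mem → Prop} (h : Runs p s T₁ Q)
    (h' : ∀ s', Q s' → Runs q s' T₂ Q') : Runs (.seq p q) s (T₁ + T₂) Q' := by
  obtain ⟨t, s', h1, h2, h3⟩ := h
  obtain ⟨t', s'', h4, h5, h6⟩ := h' s' h3
  exact ⟨_, s'', .seq h1 h4, by omega, h6⟩

theorem Runs.ite {b : Test} {p q : Prog} {s : Mem} {T : ℕ} {Q : Mem → Prop}
    (hp : b.Holds s → Runs p s T Q) (hq : ¬ b.Holds s → Runs q s T Q) :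
    Runs (.ite b p q) s (T + 1) Q := by
  by_cases h : b.Holds s
  · obtain ⟨t, s', h1, h2, h3⟩ := hp h
    exact ⟨_, s', .ite_true h h1, by omega, h3⟩
  · obtain ⟨t, s', h1, h2, h3⟩ := hq h
    exact ⟨_, s', .ite_false h h1, by omega, h3⟩

theorem runs_of_loopFree {p : Prog} (hp : p.loopFree = true) (s : Mem) :
    Runs p s p.cost fun s' => s' = p.den s := by
  induction p generalizing s with
  | skip => exact ⟨1, _, .skip s, le_rfl, rfl⟩
  | const r c => exact ⟨1, _, .const s r c, le_rfl, rfl⟩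
  | move r r' => exact ⟨1, _, .move s r r', le_rfl, rfl⟩
  | inc r => exact ⟨1, _, .inc s r, le_rfl, rfl⟩
  | dec r => exact ⟨1, _, .dec s r, le_rfl, rfl⟩
  | load r a i => exact ⟨1, _, .load s r a i, le_rfl, rfl⟩
  | store a i r => exact ⟨1, _, .store s a i r, le_rfl, rfl⟩
  | seq p q ihp ihq =>
    simp only [Prog.loopFree, Bool.and_eq_true] at hp
    exact (ihp hp.1 s).seq fun s' h => by
      subst h
      exact ihq hp.2 _
  | ite b p q ihp ihq =>
    simp only [Prog.loopFree, Bool.and_eq_true] at hp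
    refine Runs.ite (fun h => ?_) fun h => ?_
    · exact (ihp hp.1 s).mono (le_max_left _ _) fun s' h' => by rw [h', Prog.den, if_pos h]
    · exact (ihq hp.2 s).mono (le_max_right _ _) fun s' h' => by rw [h', Prog.den, if_neg h]
  | loop => simp [Prog.loopFree] at hp

theorem runs_den {p : Prog} (hp : p.loopFree = true) {s : Mem} {Q : Mem → Prop} (h : Q (p.den s)) :
    Runs p s p.cost Q :=
  (runs_of_loopFree hp s).mono le_rfl fun _ h' => h' ▸ h

/-- A loop in which register `i` runs through the numbers below the content of register `N`. -/
def forLoop (i N : ℕ) (body : Prog) : Prog :=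
  .seq (.const i 0) (.loop (.lt i N) (.seq body (.inc i)))

/-- Induction on the number of remaining iterations. Each costs the body, the increment and the
test; the final `2` pays for the initialisation and the failing test. The step may assume that
whatever the body does not write is as in `s₀`. -/
theorem runs_forLoop {i N : ℕ} {body : Prog} (hlf : body.loopFree = true)
    (hi : body.writesReg i = false) (hN : body.writesReg N = false) (hiN : N ≠ i) (s₀ : Mem)
    (Inv : ℕ → Mem → Prop) (h0 : Inv 0 (s₀.setReg i 0))
    (hstep : ∀ k s, k < s₀.reg N → s.reg i = k →
      (∀ r, r ≠ i → body.writesReg r = false → s.reg r = s₀.reg r) →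
      (∀ a, body.writesArr a = false → s.arr a = s₀.arr a) → Inv k s →
      Inv (k + 1) ((body.den s).setReg i (k + 1))) :
    Runs (forLoop i N body) s₀ (s₀.reg N * (body.cost + 2) + 2) (Inv (s₀.reg N)) := by
  have main : ∀ d k s, d + k = s₀.reg N → s.reg i = k →
      (∀ r, r ≠ i → body.writesReg r = false → s.reg r = s₀.reg r) →
      (∀ a, body.writesArr a = false → s.arr a = s₀.arr a) → Inv k s →
      Runs (.loop (.lt i N) (.seq body (.inc i))) s (d * (body.cost + 2) + 1) (Inv (s₀.reg N)) := by
    intro d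
    induction d with
    | zero =>
      intro k s hk hik hr _ hInv
      refine ⟨1, s, .loop_false ?_, by omega, ?_⟩
      · change ¬ s.reg i < s.reg N
        rw [hr N hiN hN]
        omega
      · rw [zero_add] at hk
        exact hk ▸ hInv
    | succ d ih =>
      intro k s hk hik hr ha hInv
      obtain ⟨t, s', h1, h2, h3⟩ := runs_of_loopFree hlf s
      have hs' : Exec (.seq body (.inc i)) s (t + 1) (s'.setReg i (k + 1)) := by
        have h4 := Exec.inc s' i
        rw [h1.reg_eq hi, hik] at h4
        exact .seq h1 h4
      obtain ⟨t', s'', h5, h6, h7⟩ := ih (k + 1) (s'.setReg i (k + 1)) (by omega)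
        (Function.update_self ..)
        (fun r hri hr' => (Function.update_of_ne hri _ _).trans ((h1.reg_eq hr').trans (hr r hri hr')))
        (fun a ha' => (h1.arr_eq ha').trans (ha a ha'))
        (h3 ▸ hstep k s (by omega) hik hr ha hInv)
      refine ⟨_, s'', .loop_true ?_ hs' h5, ?_, h7⟩
      · change s.reg i < s.reg N
        rw [hr N hiN hN]
        omega
      · rw [add_mul]
        omega
  obtain ⟨t, s', h1, h2, h3⟩ := main (s₀.reg N) 0 (s₀.setReg i 0) rfl (Function.update_self ..)
    (fun r hr _ => Function.update_of_ne hr _ _) (fun _ _ => rfl) h0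
  exact ⟨_, s', .seq (.const s₀ i 0) h1, by omega, h3⟩

/-! ### Searching for a minimum -/

/-- The number `x` is `y + 1` for the first candidate `y` of minimum key below `k`, and
`0` if there are no candidates below `k`. -/
def IsFirstMin (cand : ℕ → Prop) (key : ℕ → ℤ) (k x : ℕ) : Prop :=
  (x = 0 → ∀ y < k, ¬ cand y) ∧ ∀ z, x = z + 1 → z < k ∧ cand z ∧
    ∀ y < k, cand y → key z < key y ∨ (key z = key y ∧ z ≤ y)

theorem IsFirstMin.zero (cand : ℕ → Prop) (key : ℕ → ℤ) {k : ℕ} (hk : ∀ y < k, ¬ cand y) :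
    IsFirstMin cand key k 0 := ⟨fun _ => hk, fun z hz => by omega⟩

theorem IsFirstMin.succ_of_not {cand : ℕ → Prop} {key : ℕ → ℤ} {k x : ℕ}
    (h : IsFirstMin cand key k x) (hk : ¬ cand k) : IsFirstMin cand key (k + 1) x := by
  refine ⟨fun hx y hy hc => ?_, fun z hz => ⟨?_, (h.2 z hz).2.1, fun y hy hc => ?_⟩⟩
  · obtain rfl | hy := (Nat.lt_succ_iff_lt_or_eq.1 hy).symm
    exacts [hk hc, h.1 hx y hy hc]
  · have := (h.2 z hz).1
    omega
  · obtain rfl | hy := (Nat.lt_succ_iff_lt_or_eq.1 hy).symm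
    exacts [absurd hc hk, (h.2 z hz).2.2 y hy hc]

theorem IsFirstMin.succ_of_le {cand : ℕ → Prop} {key : ℕ → ℤ} {k z : ℕ}
    (h : IsFirstMin cand key k (z + 1)) (hk : key z ≤ key k) :
    IsFirstMin cand key (k + 1) (z + 1) := by
  refine ⟨fun hx => by omega, fun z' hz => ?_⟩
  obtain rfl : z' = z := by omega
  have := h.2 z' rfl
  refine ⟨by omega, this.2.1, fun y hy hc => ?_⟩
  obtain rfl | hy := (Nat.lt_succ_iff_lt_or_eq.1 hy).symm
  · omega
  · exact this.2.2 y hy hc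

/-- Only a strictly smaller key replaces the current minimum, so the least index wins among equal
keys, as the tie-breaking by index demands. -/
theorem IsFirstMin.succ_of_lt {cand : ℕ → Prop} {key : ℕ → ℤ} {k x : ℕ}
    (h : IsFirstMin cand key k x) (hk : cand k) (hlt : ∀ z, x = z + 1 → key k < key z) :
    IsFirstMin cand key (k + 1) (k + 1) := by
  refine ⟨fun hx => by omega, fun z' hz => ?_⟩
  obtain rfl : z' = k := by omega
  refine ⟨by omega, hk, fun y hy hc => ?_⟩
  obtain rfl | hy := (Nat.lt_succ_iff_lt_or_eq.1 hy).symm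
  · exact Or.inr ⟨rfl, le_rfl⟩
  · obtain _ | x := x
    · exact absurd hc (h.1 rfl y hy)
    · have h1 := hlt x rfl
      have h2 := (h.2 x rfl).2.2 y hy hc
      omega

/-! ### The program -/

namespace DA

/-- The position of the current copy of a contract on the list of its worker, for the place `p` of
the contract and the number `r` of rejected copies; `B` is larger than `2 * p + 1`. -/
def workerKey (B p r : ℕ) : ℤ := if r = 2 then B + 2 * p else 2 * p + r

/-- The opposite of the position of the current copy of a contract on the list of its firm. -/
def firmKey (B p r : ℕ) : ℤ := if r = 0 then -(B + p) else -p

def seqs : List Prog → Prog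
  | [] => .skip
  | [p] => p
  | p :: l => .seq p (seqs l)

/-- Reset the favourite contract of the worker of contract `5`. -/
def resetBody : Prog := seqs [.load 6 0 5, .const 7 0, .store 9 6 7]

/-- Update the favourite contract of the worker of contract `5`. -/
def bestBody : Prog := seqs [.load 6 0 5, .load 7 9 6, .load 8 2 5, .load 9 8 5, .const 10 0,
  .const 11 3, .const 12 2, .move 13 5, .inc 13,
  .ite (.lt 10 8) (.ite (.lt 9 11) (.ite (.eq 7 10) (.store 9 6 13)
    (seqs [.dec 7, .load 14 2 7, .load 15 8 7,
      .ite (.eq 9 12) (.ite (.eq 15 12) (.ite (.lt 8 14) (.store 9 6 13) .skip) .skip)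
        (.ite (.eq 15 12) (.store 9 6 13) (.ite (.lt 8 14) (.store 9 6 13)
          (.ite (.eq 8 14) (.ite (.lt 9 15) (.store 9 6 13) .skip) .skip)))])) .skip) .skip]

/-- Reset the counter of constraint `5`. -/
def clearBody : Prog := seqs [.const 7 0, .store 10 5 7]

/-- Count the contract of incidence `5` if it is offered. -/
def countBody : Prog := seqs [.load 6 5 5, .load 7 6 5, .load 8 0 6, .load 9 9 8, .inc 6,
  .ite (.eq 9 6) (seqs [.load 10 10 7, .inc 10, .store 10 7 10]) .skip]

/-- Search a violated constraint of minimum counter. -/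
def violatedBody : Prog := seqs [.load 6 4 5, .load 7 10 5,
  .ite (.lt 6 7) (seqs [.const 8 0, .ite (.eq 20 8) (seqs [.move 20 5, .inc 20])
    (seqs [.move 9 20, .dec 9, .load 10 10 9,
      .ite (.lt 7 10) (seqs [.move 20 5, .inc 20]) .skip])]) .skip]

/-- Search the incidence of the violated constraint with the worst offered contract. -/
def worstBody : Prog := seqs [.load 6 5 5, .load 7 6 5, .inc 7,
  .ite (.eq 7 20) (seqs [.load 8 0 6, .load 9 9 8, .move 10 6, .inc 10,
    .ite (.eq 9 10) (seqs [.const 11 0, .ite (.eq 21 11) (seqs [.move 21 5, .inc 21])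
      (seqs [.move 12 21, .dec 12, .load 13 5 12, .load 14 8 6, .load 15 3 6, .load 16 8 13,
        .load 17 3 13,
        .ite (.eq 14 11)
          (.ite (.eq 16 11) (.ite (.lt 17 15) (seqs [.move 21 5, .inc 21]) .skip)
            (seqs [.move 21 5, .inc 21]))
          (.ite (.eq 16 11) .skip (.ite (.lt 17 15) (seqs [.move 21 5, .inc 21]) .skip))])])
      .skip]) .skip]

/-- Write the indicator of the offered contracts into the output array. -/
def outputBody : Prog := seqs [.load 6 0 5, .load 7 9 6, .move 8 5, .inc 8, .const 9 0,
  .ite (.eq 7 8) (.inc 9) .skip, .store 7 5 9]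

/-- Find the favourite active contracts of the workers. -/
def offersProg : Prog := .seq (forLoop 5 0 resetBody) (forLoop 5 0 bestBody)

/-- Count the offered contracts of each constraint. -/
def loadsProg : Prog := .seq (forLoop 5 1 clearBody) (forLoop 5 2 countBody)

/-- Search a violated constraint. -/
def searchProg : Prog := .seq (.const 20 0) (forLoop 5 1 violatedBody)

/-- Search the worst offered contract of the violated constraint. -/
def worstProg : Prog := .seq (.const 21 0) (forLoop 5 2 worstBody)

/-- Reject the current copy of the contract that was found. -/
def updateProg : Prog := seqs [.dec 21, .load 6 5 21, .load 7 8 6, .inc 7, .store 8 6 7]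

/-- A round of the algorithm. -/
def round : Prog := seqs [offersProg, loadsProg, searchProg, .const 6 0,
  .ite (.eq 20 6) (.const 22 1) (.seq worstProg updateProg)]

/-- The program. -/
def program : Prog := seqs [.const 22 0, .const 23 0, .loop (.eq 22 23) round,
  forLoop 5 0 outputBody]

/-! ### Correctness of the single loops -/

theorem runs_reset (s₀ : Mem) : Runs (forLoop 5 0 resetBody) s₀
    (s₀.reg 0 * (resetBody.cost + 2) + 2) fun s => ∀ e < s₀.reg 0, s.arr 9 (s₀.arr 0 e) = 0 := by
  refine runs_forLoop rfl rfl rfl (by decide) s₀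
    (fun k s => ∀ e < k, s.arr 9 (s₀.arr 0 e) = 0) (by simp) ?_
  intro k s hk hi _ ha hInv e he
  have ha0 := ha 0 rfl
  simp only [resetBody, seqs, Prog.den, Mem.setReg, Mem.setArr, Function.update_apply]
  simp only [reduceIte, Nat.reduceEqDiff, hi, ha0]
  rw [Function.update_apply]
  split_ifs with h
  · rfl
  · refine hInv e ?_
    rcases Nat.lt_succ_iff_lt_or_eq.1 he with h' | rfl
    · exact h'
    · exact absurd rfl h

/-- The contract `e` has a copy that is not rejected. -/
def Active (s : Mem) (e : ℕ) : Prop := 0 < s.arr 2 e ∧ s.arr 8 e < 3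

/-- The nested tests of the program spell out the comparison of keys without computing them; the
bound on `B` settles the comparisons of a third copy with a first or second one. -/
theorem den_bestBody (s : Mem) {B : ℕ} (hB : ∀ e, 2 * s.arr 2 e + 1 < B) {k w b : ℕ}
    (hk : s.reg 5 = k) (hw : s.arr 0 k = w) (hb : s.arr 9 w = b)
    (h3 : ∀ z, b = z + 1 → Active s z) :
    (Active s k ∧ (∀ z, b = z + 1 → workerKey B (s.arr 2 k) (s.arr 8 k) <
        workerKey B (s.arr 2 z) (s.arr 8 z)) ∧
      (bestBody.den s).arr 9 = Function.update (s.arr 9) w (k + 1)) ∨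
    ((Active s k → ∃ z, b = z + 1 ∧ workerKey B (s.arr 2 z) (s.arr 8 z) ≤
        workerKey B (s.arr 2 k) (s.arr 8 k)) ∧
      (bestBody.den s).arr 9 = s.arr 9) := by
  have h1 := hB k
  simp only [bestBody, seqs, Prog.den, Mem.setReg, Mem.setArr, Test.Holds, Function.update_apply]
  simp only [reduceIte, Nat.reduceEqDiff, hk, hw, hb]
  by_cases hp : 0 < s.arr 2 k
  swap
  · exact Or.inr ⟨fun h => absurd h.1 hp, by simp [hp]⟩
  by_cases hr : s.arr 8 k < 3
  swap
  · exact Or.inr ⟨fun h => absurd h.2 hr, by simp [hp, hr]⟩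
  obtain _ | z := b
  · exact Or.inl ⟨⟨hp, hr⟩, by simp, by simp [hp, hr, Function.update]⟩
  have h2 := hB z
  have h4 := (h3 z rfl).2
  have hz : ∀ z', z + 1 = z' + 1 ↔ z' = z := by omega
  simp only [hp, hr, hz, forall_eq, exists_eq_left, Active, reduceIte, Nat.add_eq_zero_iff,
    Nat.one_ne_zero, and_false, Nat.add_sub_cancel, true_and]
  simp only [workerKey]
  -- On each path through the tests the order of the two keys is a matter of linear arithmetic.
  split_ifs <;> first
    | exact Or.inl ⟨by omega, by simp⟩
    | exact Or.inr ⟨fun _ => by omega, rfl⟩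

/-- After the first two loops, array `9` holds the favourite active contracts of the workers. -/
theorem runs_best (s₀ : Mem) {B : ℕ} (hB : ∀ e, 2 * s₀.arr 2 e + 1 < B)
    (h0 : ∀ e < s₀.reg 0, s₀.arr 9 (s₀.arr 0 e) = 0) : Runs (forLoop 5 0 bestBody) s₀
    (s₀.reg 0 * (bestBody.cost + 2) + 2) fun s => ∀ e < s₀.reg 0,
      IsFirstMin (fun y => s₀.arr 0 y = s₀.arr 0 e ∧ Active s₀ y)
        (fun y => workerKey B (s₀.arr 2 y) (s₀.arr 8 y)) (s₀.reg 0) (s.arr 9 (s₀.arr 0 e)) := by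
  refine runs_forLoop rfl rfl rfl (by decide) s₀ (fun k s => ∀ e < s₀.reg 0,
      IsFirstMin (fun y => s₀.arr 0 y = s₀.arr 0 e ∧ Active s₀ y)
        (fun y => workerKey B (s₀.arr 2 y) (s₀.arr 8 y)) k (s.arr 9 (s₀.arr 0 e))) ?_ ?_
  · intro e he
    change IsFirstMin _ _ _ (s₀.arr 9 (s₀.arr 0 e))
    rw [h0 e he]
    exact IsFirstMin.zero _ _ fun y hy => by omega
  intro k s hk hi _ ha hInv e he
  have ha0 := ha 0 rfl
  have ha2 := ha 2 rfl
  have ha8 := ha 8 rfl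
  have hAct : ∀ y, Active s y ↔ Active s₀ y := fun y => by simp only [Active, ha2, ha8]
  have hmain := den_bestBody s (B := B) (fun e => by rw [ha2]; exact hB e) hi
    (w := s₀.arr 0 k) (by rw [ha0]) rfl
    (fun z hz => (hAct z).2 ((hInv k hk).2 z hz).2.1.2)
  simp only [hAct, ha2, ha8] at hmain
  change IsFirstMin _ _ _ ((bestBody.den s).arr 9 (s₀.arr 0 e))
  rcases hmain with ⟨h1, h2, h3⟩ | ⟨h1, h3⟩
  · rw [h3, Function.update_apply]
    split_ifs with h
    · exact (hInv e he).succ_of_lt ⟨h.symm, h1⟩ (h ▸ h2)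
    · exact (hInv e he).succ_of_not fun h' => h h'.1.symm
  · rw [h3]
    by_cases h : s₀.arr 0 k = s₀.arr 0 e ∧ Active s₀ k
    · obtain ⟨z, hz, hle⟩ := h1 h.2
      rw [h.1] at hz
      have := hInv e he
      rw [hz] at this ⊢
      exact this.succ_of_le hle
    · exact (hInv e he).succ_of_not h

theorem runs_clear (s₀ : Mem) : Runs (forLoop 5 1 clearBody) s₀
    (s₀.reg 1 * (clearBody.cost + 2) + 2) fun s => ∀ j < s₀.reg 1, s.arr 10 j = 0 := by
  refine runs_forLoop rfl rfl rfl (by decide) s₀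
    (fun k s => ∀ j < k, s.arr 10 j = 0) (by simp) ?_
  intro k s hk hi _ ha hInv j hj
  simp only [clearBody, seqs, Prog.den, Mem.setReg, Mem.setArr, Function.update_apply]
  simp only [reduceIte, Nat.reduceEqDiff, hi]
  rw [Function.update_apply]
  split_ifs with h
  · rfl
  · exact hInv j (by omega)

/-- The contract of incidence `i` is offered. -/
def OfferedAt (s : Mem) (i : ℕ) : Prop := s.arr 9 (s.arr 0 (s.arr 5 i)) = s.arr 5 i + 1

open Classical in
/-- The number of incidences below `k` of constraint `j` with an offered contract. -/
noncomputable def count (s : Mem) (k j : ℕ) : ℕ :=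
  ((Finset.range k).filter fun i => s.arr 6 i = j ∧ OfferedAt s i).card

theorem count_succ (s : Mem) (k j : ℕ) [Decidable (s.arr 6 k = j ∧ OfferedAt s k)] :
    count s (k + 1) j = count s k j + if s.arr 6 k = j ∧ OfferedAt s k then 1 else 0 := by
  classical
  rw [count, count, Finset.range_add_one, Finset.filter_insert]
  split_ifs
  · rw [Finset.card_insert_of_notMem (by simp)]
  · rfl

theorem runs_count (s₀ : Mem) (h0 : ∀ j < s₀.reg 1, s₀.arr 10 j = 0) :
    Runs (forLoop 5 2 countBody) s₀ (s₀.reg 2 * (countBody.cost + 2) + 2)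
      fun s => ∀ j < s₀.reg 1, s.arr 10 j = count s₀ (s₀.reg 2) j := by
  classical
  refine runs_forLoop rfl rfl rfl (by decide) s₀
    (fun k s => ∀ j < s₀.reg 1, s.arr 10 j = count s₀ k j) ?_ ?_
  · intro j hj
    exact (h0 j hj).trans (by simp [count])
  intro k s hk hi _ ha hInv j hj
  rw [count_succ, ← hInv j hj]
  have ha5 := ha 5 rfl
  have ha6 := ha 6 rfl
  have ha0 := ha 0 rfl
  have ha9 := ha 9 rfl
  simp only [countBody, seqs, Prog.den, Mem.setReg, Mem.setArr, Test.Holds, Function.update_apply]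
  simp only [reduceIte, Nat.reduceEqDiff, hi, ha5, ha6, ha0, ha9, OfferedAt]
  by_cases h : s₀.arr 9 (s₀.arr 0 (s₀.arr 5 k)) = s₀.arr 5 k + 1
  · simp only [h, if_true, Function.update_self, and_true, Function.update_apply, eq_comm (a := j)]
    split_ifs with h'
    · rw [h']
    · rfl
  · simp [h]

theorem runs_violated (s₀ : Mem) (h0 : s₀.reg 20 = 0) :
    Runs (forLoop 5 1 violatedBody) s₀ (s₀.reg 1 * (violatedBody.cost + 2) + 2)
      fun s => IsFirstMin (fun j => s₀.arr 4 j < s₀.arr 10 j) (fun j => s₀.arr 10 j) (s₀.reg 1)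
        (s.reg 20) := by
  refine runs_forLoop rfl rfl rfl (by decide) s₀
    (fun k s => IsFirstMin (fun j => s₀.arr 4 j < s₀.arr 10 j) (fun j => s₀.arr 10 j) k
      (s.reg 20)) ?_ ?_
  · change IsFirstMin _ _ _ (s₀.reg 20)
    rw [h0]
    exact IsFirstMin.zero _ _ fun y hy => by omega
  intro k s hk hi _ ha hInv
  have ha4 := ha 4 rfl
  have ha10 := ha 10 rfl
  obtain ⟨b, hb⟩ : ∃ b, s.reg 20 = b := ⟨_, rfl⟩
  simp only [hb] at hInv
  have hmain : ((s₀.arr 4 k < s₀.arr 10 k) ∧ (∀ z, b = z + 1 → s₀.arr 10 k < s₀.arr 10 z) ∧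
      ((violatedBody.den s).setReg 5 (k + 1)).reg 20 = k + 1) ∨
      ((s₀.arr 4 k < s₀.arr 10 k → ∃ z, b = z + 1 ∧ s₀.arr 10 z ≤ s₀.arr 10 k) ∧
      ((violatedBody.den s).setReg 5 (k + 1)).reg 20 = b) := by
    simp only [violatedBody, seqs, Prog.den, Mem.setReg, Test.Holds,
      Function.update_apply]
    simp only [reduceIte, Nat.reduceEqDiff, hi, hb, ha4, ha10]
    by_cases h1 : s₀.arr 4 k < s₀.arr 10 k
    swap
    · exact Or.inr ⟨fun h => absurd h h1, by simp [h1, hb]⟩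
    obtain _ | z := b
    · exact Or.inl ⟨h1, by simp, by simp [h1]⟩
    by_cases h2 : s₀.arr 10 k < s₀.arr 10 z
    · exact Or.inl ⟨h1, by simpa using h2, by simp [h1, h2]⟩
    · exact Or.inr ⟨fun _ => ⟨z, rfl, by omega⟩, by simp [h1, h2, hb]⟩
  rcases hmain with ⟨h1, h2, h3⟩ | ⟨h1, h3⟩
  · rw [h3]
    exact hInv.succ_of_lt h1 fun z hz => by exact_mod_cast h2 z hz
  · rw [h3]
    by_cases h : s₀.arr 4 k < s₀.arr 10 k
    · obtain ⟨z, rfl, hle⟩ := h1 h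
      exact hInv.succ_of_le (by exact_mod_cast hle)
    · exact hInv.succ_of_not h

theorem runs_worst (s₀ : Mem) {B : ℕ} (hB : ∀ e, s₀.arr 3 e < B) (h0 : s₀.reg 21 = 0) :
    Runs (forLoop 5 2 worstBody) s₀ (s₀.reg 2 * (worstBody.cost + 2) + 2)
      fun s => IsFirstMin (fun i => s₀.arr 6 i + 1 = s₀.reg 20 ∧ OfferedAt s₀ i)
        (fun i => firmKey B (s₀.arr 3 (s₀.arr 5 i)) (s₀.arr 8 (s₀.arr 5 i))) (s₀.reg 2)
        (s.reg 21) := by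
  refine runs_forLoop rfl rfl rfl (by decide) s₀
    (fun k s => IsFirstMin (fun i => s₀.arr 6 i + 1 = s₀.reg 20 ∧ OfferedAt s₀ i)
        (fun i => firmKey B (s₀.arr 3 (s₀.arr 5 i)) (s₀.arr 8 (s₀.arr 5 i))) k (s.reg 21)) ?_ ?_
  · change IsFirstMin _ _ _ (s₀.reg 21)
    rw [h0]
    exact IsFirstMin.zero _ _ fun y hy => by omega
  intro k s hk hi hr ha hInv
  have ha0 := ha 0 rfl
  have ha3 := ha 3 rfl
  have ha5 := ha 5 rfl
  have ha6 := ha 6 rfl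
  have ha8 := ha 8 rfl
  have ha9 := ha 9 rfl
  have hr20 := hr 20 (by decide) rfl
  obtain ⟨b, hb⟩ : ∃ b, s.reg 21 = b := ⟨_, rfl⟩
  simp only [hb] at hInv
  have hmain : ((s₀.arr 6 k + 1 = s₀.reg 20 ∧ OfferedAt s₀ k) ∧ (∀ z, b = z + 1 →
        firmKey B (s₀.arr 3 (s₀.arr 5 k)) (s₀.arr 8 (s₀.arr 5 k)) <
          firmKey B (s₀.arr 3 (s₀.arr 5 z)) (s₀.arr 8 (s₀.arr 5 z))) ∧
      ((worstBody.den s).setReg 5 (k + 1)).reg 21 = k + 1) ∨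
      ((s₀.arr 6 k + 1 = s₀.reg 20 ∧ OfferedAt s₀ k → ∃ z, b = z + 1 ∧
        firmKey B (s₀.arr 3 (s₀.arr 5 z)) (s₀.arr 8 (s₀.arr 5 z)) ≤
          firmKey B (s₀.arr 3 (s₀.arr 5 k)) (s₀.arr 8 (s₀.arr 5 k))) ∧
      ((worstBody.den s).setReg 5 (k + 1)).reg 21 = b) := by
    simp only [worstBody, seqs, Prog.den, Mem.setReg, Test.Holds,
      Function.update_apply, OfferedAt]
    simp only [reduceIte, Nat.reduceEqDiff, hi, hb, ha0, ha3, ha5, ha6, ha8, ha9, hr20]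
    by_cases h1 : s₀.arr 6 k + 1 = s₀.reg 20
    swap
    · exact Or.inr ⟨fun h => absurd h.1 h1, by simp [h1, hb]⟩
    by_cases h2 : s₀.arr 9 (s₀.arr 0 (s₀.arr 5 k)) = s₀.arr 5 k + 1
    swap
    · exact Or.inr ⟨fun h => absurd h.2 h2, by simp [h1, h2, hb]⟩
    obtain _ | z := b
    · exact Or.inl ⟨⟨h1, h2⟩, by simp, by simp [h1, h2]⟩
    have h3 := hB (s₀.arr 5 k)
    have h4 := hB (s₀.arr 5 z)
    have hz : ∀ z', z + 1 = z' + 1 ↔ z' = z := by omega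
    simp only [h1, h2, hz, forall_eq, exists_eq_left, reduceIte, Nat.add_eq_zero_iff,
      Nat.one_ne_zero, and_false, Nat.add_sub_cancel, true_and, and_true, firmKey]
    split_ifs <;> first
      | exact Or.inl ⟨by omega, by simp⟩
      | exact Or.inr ⟨fun _ => by omega, by simp [hb]⟩
  rcases hmain with ⟨h1, h2, h3⟩ | ⟨h1, h3⟩
  · rw [h3]
    exact hInv.succ_of_lt h1 h2
  · rw [h3]
    by_cases h : s₀.arr 6 k + 1 = s₀.reg 20 ∧ OfferedAt s₀ k
    · obtain ⟨z, rfl, hle⟩ := h1 h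
      exact hInv.succ_of_le hle
    · exact hInv.succ_of_not h

theorem runs_output (s₀ : Mem) : Runs (forLoop 5 0 outputBody) s₀
    (s₀.reg 0 * (outputBody.cost + 2) + 2) fun s => ∀ e < s₀.reg 0,
      s.arr 7 e = if s₀.arr 9 (s₀.arr 0 e) = e + 1 then 1 else 0 := by
  refine runs_forLoop rfl rfl rfl (by decide) s₀ (fun k s => ∀ e < k,
      s.arr 7 e = if s₀.arr 9 (s₀.arr 0 e) = e + 1 then 1 else 0) (by simp) ?_
  intro k s hk hi _ ha hInv e he
  have ha0 := ha 0 rfl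
  have ha9 := ha 9 rfl
  simp only [outputBody, seqs, Prog.den, Mem.setReg, Mem.setArr, Test.Holds, Function.update_apply]
  simp only [reduceIte, Nat.reduceEqDiff, hi, ha0, ha9]
  by_cases h : e = k
  · subst h
    by_cases h' : s₀.arr 9 (s₀.arr 0 e) = e + 1 <;> simp [h', hi]
  · have := hInv e (by omega)
    by_cases h' : s₀.arr 9 (s₀.arr 0 k) = k + 1 <;> simp [h', hi, h, this]

/-! ### A round of the algorithm -/

/-- The contract `e` is the favourite of its worker among the active contracts. -/
def Offered (B : ℕ) (s : Mem) (e : ℕ) : Prop := e < s.reg 0 ∧ Active s e ∧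
  ∀ y < s.reg 0, s.arr 0 y = s.arr 0 e → Active s y →
    workerKey B (s.arr 2 e) (s.arr 8 e) < workerKey B (s.arr 2 y) (s.arr 8 y) ∨
      (workerKey B (s.arr 2 e) (s.arr 8 e) = workerKey B (s.arr 2 y) (s.arr 8 y) ∧ e ≤ y)

open Classical in
/-- The number of incidences of constraint `j` with an offered contract. -/
noncomputable def load (B : ℕ) (s : Mem) (j : ℕ) : ℕ :=
  ((Finset.range (s.reg 2)).filter fun i => s.arr 6 i = j ∧ Offered B s (s.arr 5 i)).card

/-- The memories `s₀` and `s` agree in the input and in the levels. -/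
structure Agree (s₀ s : Mem) : Prop where
  reg : ∀ r < 5, s.reg r = s₀.reg r
  arr : ∀ a < 7, s.arr a = s₀.arr a
  level : s.arr 8 = s₀.arr 8

theorem Agree.trans {s₀ s s' : Mem} (h : Agree s₀ s) (h' : Agree s s') : Agree s₀ s' :=
  ⟨fun r hr => (h'.reg r hr).trans (h.reg r hr), fun a ha => (h'.arr a ha).trans (h.arr a ha),
    h'.level.trans h.level⟩

theorem Agree.active {s₀ s : Mem} (h : Agree s₀ s) (e : ℕ) : Active s e ↔ Active s₀ e := by
  rw [Active, Active, h.arr 2 (by decide), h.level]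

/-- The program neither changes the input nor the levels. -/
def Safe (p : Prog) : Prop := (∀ r < 5, p.writesReg r = false) ∧ (∀ a < 7, p.writesArr a = false) ∧
  p.writesArr 8 = false

instance (p : Prog) : Decidable (Safe p) := inferInstanceAs (Decidable (_ ∧ _ ∧ _))

theorem _root_.SMTI.Runs.agree {p : Prog} {s : Mem} {T : ℕ} {Q : Mem → Prop} (h : Runs p s T Q) (hp : Safe p) :
    Runs p s T fun s' => Agree s s' ∧ Q s' ∧ (∀ r, p.writesReg r = false → s'.reg r = s.reg r) ∧
      ∀ a, p.writesArr a = false → s'.arr a = s.arr a :=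
  h.frame.mono le_rfl fun _ h => ⟨⟨fun r hr => h.2.1 r (hp.1 r hr), fun a ha => h.2.2 a (hp.2.1 a ha),
    h.2.2 8 hp.2.2⟩, h⟩

theorem _root_.SMTI.IsFirstMin.eq_succ_iff {cand : ℕ → Prop} {key : ℕ → ℤ} {k x e : ℕ}
    (h : IsFirstMin cand key k x) : x = e + 1 ↔ e < k ∧ cand e ∧
      ∀ y < k, cand y → key e < key y ∨ (key e = key y ∧ e ≤ y) := by
  refine ⟨h.2 e, fun ⟨h1, h2, h3⟩ => ?_⟩
  obtain _ | z := x
  · exact absurd h2 (h.1 rfl e h1)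
  · obtain ⟨h4, h5, h6⟩ := h.2 z rfl
    have h7 := h3 z h4 h5
    have h8 := h6 e h1 h2
    omega

/-- The first two loops of a round find the offered contracts. -/
theorem runs_offers (s₀ : Mem) {B : ℕ} (hB : ∀ e, 2 * s₀.arr 2 e + 1 < B) :
    Runs offersProg s₀ (50 * (s₀.reg 0 + 1))
      fun s => ∀ e < s₀.reg 0, (s.arr 9 (s₀.arr 0 e) = e + 1 ↔ Offered B s₀ e) := by
  have h1 := (runs_reset s₀).agree (by decide)
  have h2 : ∀ s, (Agree s₀ s ∧ (∀ e < s₀.reg 0, s.arr 9 (s₀.arr 0 e) = 0) ∧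
      (∀ r, (forLoop 5 0 resetBody).writesReg r = false → s.reg r = s₀.reg r) ∧
        ∀ a, (forLoop 5 0 resetBody).writesArr a = false → s.arr a = s₀.arr a) →
      Runs (forLoop 5 0 bestBody) s (s₀.reg 0 * (bestBody.cost + 2) + 2) fun s' =>
        ∀ e < s₀.reg 0, (s'.arr 9 (s₀.arr 0 e) = e + 1 ↔ Offered B s₀ e) := by
    rintro s ⟨hA, h0, -⟩
    have ha0 := hA.arr 0 (by decide)
    have ha2 := hA.arr 2 (by decide)
    have hr0 := hA.reg 0 (by decide)
    have := runs_best s (B := B) (by rw [ha2]; exact hB) (by rw [ha0, hr0]; exact h0)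
    rw [ha0, ha2, hr0, hA.level] at this
    refine this.mono le_rfl fun s' h e he => ?_
    rw [(h e he).eq_succ_iff]
    simp only [hA.active, Offered, true_and, and_imp]
  refine (h1.seq h2).mono ?_ fun _ h => h
  have c1 : resetBody.cost ≤ 10 := by decide
  have c2 : bestBody.cost ≤ 30 := by decide
  nlinarith

theorem runs_loads (s₀ : Mem) : Runs loadsProg s₀ (50 * (s₀.reg 1 + s₀.reg 2 + 1))
    fun s => ∀ j < s₀.reg 1, s.arr 10 j = count s₀ (s₀.reg 2) j := by
  have h1 := (runs_clear s₀).agree (by decide)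
  have h2 : ∀ s, (Agree s₀ s ∧ (∀ j < s₀.reg 1, s.arr 10 j = 0) ∧
      (∀ r, (forLoop 5 1 clearBody).writesReg r = false → s.reg r = s₀.reg r) ∧
        ∀ a, (forLoop 5 1 clearBody).writesArr a = false → s.arr a = s₀.arr a) →
      Runs (forLoop 5 2 countBody) s (s₀.reg 2 * (countBody.cost + 2) + 2) fun s' =>
        ∀ j < s₀.reg 1, s'.arr 10 j = count s₀ (s₀.reg 2) j := by
    rintro s ⟨hA, h0, -, ha⟩
    have hc : ∀ k j, count s k j = count s₀ k j := by
      intro k j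
      simp only [count, OfferedAt, hA.arr 6 (by decide), hA.arr 5 (by decide), hA.arr 0 (by decide),
        ha 9 rfl]
      congr
    have := runs_count s (by rw [hA.reg 1 (by decide)]; exact h0)
    rwa [hA.reg 1 (by decide), hA.reg 2 (by decide), funext₂ hc] at this
  refine (h1.seq h2).mono ?_ fun _ h => h
  have c1 : clearBody.cost ≤ 10 := by decide
  have c2 : countBody.cost ≤ 20 := by decide
  nlinarith

theorem runs_search (s₀ : Mem) : Runs searchProg s₀ (50 * (s₀.reg 1 + 1)) fun s =>
    IsFirstMin (fun j => s₀.arr 4 j < s₀.arr 10 j) (fun j => s₀.arr 10 j) (s₀.reg 1)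
      (s.reg 20) := by
  have h1 := runs_den (p := .const 20 0) (s := s₀) rfl (Q := fun s => s = s₀.setReg 20 0) rfl
  have h2 : ∀ s, s = s₀.setReg 20 0 → Runs (forLoop 5 1 violatedBody) s
      (s₀.reg 1 * (violatedBody.cost + 2) + 2) fun s =>
        IsFirstMin (fun j => s₀.arr 4 j < s₀.arr 10 j) (fun j => s₀.arr 10 j) (s₀.reg 1)
          (s.reg 20) := by
    rintro s rfl
    exact runs_violated _ rfl
  refine (h1.seq h2).mono ?_ fun _ h => h
  have c1 : violatedBody.cost ≤ 30 := by decide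
  have c2 : (Prog.const 20 0).cost ≤ 1 := by decide
  nlinarith

theorem runs_worstProg (s₀ : Mem) {B : ℕ} (hB : ∀ e, s₀.arr 3 e < B) :
    Runs worstProg s₀ (50 * (s₀.reg 2 + 1)) fun s =>
      IsFirstMin (fun i => s₀.arr 6 i + 1 = s₀.reg 20 ∧ OfferedAt s₀ i)
        (fun i => firmKey B (s₀.arr 3 (s₀.arr 5 i)) (s₀.arr 8 (s₀.arr 5 i))) (s₀.reg 2)
        (s.reg 21) := by
  have h1 := runs_den (p := .const 21 0) (s := s₀) rfl (Q := fun s => s = s₀.setReg 21 0) rfl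
  have h2 : ∀ s, s = s₀.setReg 21 0 → Runs (forLoop 5 2 worstBody) s
      (s₀.reg 2 * (worstBody.cost + 2) + 2) fun s =>
        IsFirstMin (fun i => s₀.arr 6 i + 1 = s₀.reg 20 ∧ OfferedAt s₀ i)
        (fun i => firmKey B (s₀.arr 3 (s₀.arr 5 i)) (s₀.arr 8 (s₀.arr 5 i))) (s₀.reg 2)
        (s.reg 21) := by
    rintro s rfl
    exact runs_worst _ (B := B) hB rfl
  refine (h1.seq h2).mono ?_ fun _ h => h
  have c1 : worstBody.cost ≤ 40 := by decide
  have c2 : (Prog.const 21 0).cost ≤ 1 := by decide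
  nlinarith

/-- The current copy of the worst offered contract of a violated constraint of minimum load is
rejected. -/
def Rejects (B : ℕ) (s₀ s : Mem) : Prop := ∃ j < s₀.reg 1, ∃ i < s₀.reg 2,
  s₀.arr 4 j < load B s₀ j ∧
  (∀ j' < s₀.reg 1, s₀.arr 4 j' < load B s₀ j' → load B s₀ j ≤ load B s₀ j') ∧
  s₀.arr 6 i = j ∧ Offered B s₀ (s₀.arr 5 i) ∧
  (∀ i' < s₀.reg 2, s₀.arr 6 i' = j → Offered B s₀ (s₀.arr 5 i') →
    firmKey B (s₀.arr 3 (s₀.arr 5 i)) (s₀.arr 8 (s₀.arr 5 i)) ≤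
      firmKey B (s₀.arr 3 (s₀.arr 5 i')) (s₀.arr 8 (s₀.arr 5 i'))) ∧
  s.arr 8 = Function.update (s₀.arr 8) (s₀.arr 5 i) (s₀.arr 8 (s₀.arr 5 i) + 1)

theorem runs_reject (s₀ s : Mem) {B : ℕ} (hA : Agree s₀ s) (hB : ∀ e, s₀.arr 3 e < B)
    (hoff : ∀ i < s₀.reg 2, (OfferedAt s i ↔ Offered B s₀ (s₀.arr 5 i)))
    {j : ℕ} (hj : s.reg 20 = j + 1) (hjm : j < s₀.reg 1) (hviol : s₀.arr 4 j < load B s₀ j)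
    (hmin : ∀ j' < s₀.reg 1, s₀.arr 4 j' < load B s₀ j' → load B s₀ j ≤ load B s₀ j') :
    Runs (.seq worstProg updateProg) s (50 * (s₀.reg 2 + 1) + updateProg.cost) (Rejects B s₀) := by
  have h1 := (runs_worstProg s (B := B) (by rw [hA.arr 3 (by decide)]; exact hB)).agree (by decide)
  rw [hA.reg 2 (by decide), hA.arr 6 (by decide), hA.arr 3 (by decide), hA.arr 5 (by decide),
    hA.level, hj] at h1
  refine h1.seq fun s' ⟨hA', hmin', hr, ha⟩ => runs_den (by decide) ?_
  have hA'' := hA.trans hA'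
  obtain ⟨i, hi⟩ : ∃ i, s'.reg 21 = i + 1 := by
    refine Nat.exists_eq_succ_of_ne_zero fun h0 => ?_
    -- A violated constraint has at least one offer, so the search cannot come back empty.
    have hne : 0 < load B s₀ j := by omega
    classical
    obtain ⟨i, hi⟩ := Finset.card_pos.1 hne
    simp only [Finset.mem_filter, Finset.mem_range] at hi
    exact hmin'.1 h0 i hi.1 ⟨by rw [hi.2.1], (hoff i hi.1).2 hi.2.2⟩
  obtain ⟨h2, ⟨h3, h4⟩, h5⟩ := hmin'.2 i hi
  refine ⟨j, hjm, i, h2, hviol, hmin, by omega, (hoff i h2).1 h4, fun i' hi' hji' ho => ?_, ?_⟩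
  · rcases h5 i' hi' ⟨by rw [hji'], (hoff i' hi').2 ho⟩ with h | h
    exacts [h.le, h.1.le]
  · have h6 := hA''.arr 5 (by decide)
    have h7 := hA''.level
    simp only [updateProg, seqs, Prog.den, Mem.setReg, Mem.setArr, Function.update_apply]
    simp only [reduceIte, Nat.reduceEqDiff, hi, h6, h7, Nat.add_sub_cancel]

/-- Either no quota is violated and the flag in register `22` stops the main loop, or one copy is
rejected. In both cases array `9` still holds the offers of this round, which the output needs after
the last one. -/
theorem runs_round (s₀ : Mem) {B : ℕ} (hB2 : ∀ e, 2 * s₀.arr 2 e + 1 < B)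
    (hB3 : ∀ e, s₀.arr 3 e < B) (hinc : ∀ i < s₀.reg 2, s₀.arr 5 i < s₀.reg 0) :
    Runs round s₀ (300 * (s₀.reg 0 + s₀.reg 1 + s₀.reg 2 + 1)) fun s =>
      (∀ e < s₀.reg 0, (s.arr 9 (s₀.arr 0 e) = e + 1 ↔ Offered B s₀ e)) ∧
        ((s.reg 22 = 1 ∧ s.arr 8 = s₀.arr 8 ∧ ∀ j < s₀.reg 1, load B s₀ j ≤ s₀.arr 4 j) ∨
          (s.reg 22 = s₀.reg 22 ∧ Rejects B s₀ s)) := by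
  have H1 := (runs_offers s₀ hB2).agree (by decide)
  suffices H2 : ∀ s₁, (Agree s₀ s₁ ∧ (∀ e < s₀.reg 0, (s₁.arr 9 (s₀.arr 0 e) = e + 1 ↔
      Offered B s₀ e)) ∧ (∀ r, offersProg.writesReg r = false → s₁.reg r = s₀.reg r) ∧
        ∀ a, offersProg.writesArr a = false → s₁.arr a = s₀.arr a) →
      Runs (seqs [loadsProg, searchProg, .const 6 0,
        .ite (.eq 20 6) (.const 22 1) (.seq worstProg updateProg)]) s₁
        (200 * (s₀.reg 0 + s₀.reg 1 + s₀.reg 2 + 1)) fun s =>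
      (∀ e < s₀.reg 0, (s.arr 9 (s₀.arr 0 e) = e + 1 ↔ Offered B s₀ e)) ∧
        ((s.reg 22 = 1 ∧ s.arr 8 = s₀.arr 8 ∧ ∀ j < s₀.reg 1, load B s₀ j ≤ s₀.arr 4 j) ∨
          (s.reg 22 = s₀.reg 22 ∧ Rejects B s₀ s)) from
    (H1.seq H2).mono (by omega) fun _ h => h
  rintro s₁ ⟨hA1, h9, hr1, -⟩
  -- The loop counts entries of array `9`; these describe the offers because every incidence refers
  -- to a valid contract.
  have hcount : ∀ j, count s₁ (s₀.reg 2) j = load B s₀ j := by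
    classical
    intro j
    simp only [count, load]
    congr 1
    ext i
    simp only [Finset.mem_filter, Finset.mem_range, hA1.arr 6 (by decide), OfferedAt,
      hA1.arr 5 (by decide), hA1.arr 0 (by decide)]
    refine and_congr_right fun hi => and_congr_right fun _ => h9 _ (hinc i hi)
  have H2 := (runs_loads s₁).agree (by decide)
  rw [hA1.reg 1 (by decide), hA1.reg 2 (by decide), funext hcount] at H2
  suffices H3 : ∀ s₂, (Agree s₁ s₂ ∧ (∀ j < s₀.reg 1, s₂.arr 10 j = load B s₀ j) ∧
      (∀ r, loadsProg.writesReg r = false → s₂.reg r = s₁.reg r) ∧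
        ∀ a, loadsProg.writesArr a = false → s₂.arr a = s₁.arr a) →
      Runs (seqs [searchProg, .const 6 0,
        .ite (.eq 20 6) (.const 22 1) (.seq worstProg updateProg)]) s₂
        (150 * (s₀.reg 0 + s₀.reg 1 + s₀.reg 2 + 1)) fun s =>
      (∀ e < s₀.reg 0, (s.arr 9 (s₀.arr 0 e) = e + 1 ↔ Offered B s₀ e)) ∧
        ((s.reg 22 = 1 ∧ s.arr 8 = s₀.arr 8 ∧ ∀ j < s₀.reg 1, load B s₀ j ≤ s₀.arr 4 j) ∨
          (s.reg 22 = s₀.reg 22 ∧ Rejects B s₀ s)) from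
    (H2.seq H3).mono (by omega) fun _ h => h
  rintro s₂ ⟨hA2, h10, hr2, ha2⟩
  have hA2' := hA1.trans hA2
  have H3 := (runs_search s₂).agree (by decide)
  rw [hA2'.reg 1 (by decide), hA2'.arr 4 (by decide)] at H3
  refine (H3.seq (T₂ := 1 + (50 * (s₀.reg 2 + 1) + updateProg.cost + 1)) ?_).mono ?_ fun _ h => h
  swap
  · have : updateProg.cost ≤ 10 := by decide
    omega
  rintro s₃ ⟨hA3, hmin, hr3, ha3⟩
  have hA3' := hA2'.trans hA3
  have h92 := ha3 9 (by decide)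
  have h91 := ha2 9 (by decide)
  have h22 : s₃.reg 22 = s₀.reg 22 :=
    (hr3 22 (by decide)).trans ((hr2 22 (by decide)).trans (hr1 22 (by decide)))
  refine Runs.seq (T₁ := 1) (Q := fun s => s = s₃.setReg 6 0) (runs_den rfl rfl) ?_
  rintro s₄ rfl
  have h94 : (s₃.setReg 6 0).arr 9 = s₁.arr 9 := h92.trans h91
  have hA4 : Agree s₀ (s₃.setReg 6 0) := hA3'.trans
    ⟨fun r hr => Function.update_of_ne (by omega) _ _, fun _ _ => rfl, rfl⟩
  refine Runs.ite (fun hz => ?_) fun hz => ?_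
  · refine (runs_den (p := .const 22 1) rfl (Q := fun s => s = (s₃.setReg 6 0).setReg 22 1)
      rfl).mono ?_ ?_
    · simp only [Prog.cost]
      omega
    rintro s rfl
    refine ⟨fun e he => ?_, Or.inl ⟨rfl, hA3'.level, fun j hj => ?_⟩⟩
    · change (s₃.setReg 6 0).arr 9 _ = _ ↔ _
      rw [h94]
      exact h9 e he
    · have : ¬ s₀.arr 4 j < s₂.arr 10 j := hmin.1 hz j hj
      rw [h10 j hj] at this
      omega
  · obtain ⟨j, hj⟩ := Nat.exists_eq_succ_of_ne_zero (n := s₃.reg 20) hz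
    obtain ⟨h1, h2, h3⟩ := hmin.2 j hj
    have h2 : s₀.arr 4 j < s₂.arr 10 j := h2
    rw [h10 j h1] at h2
    have H4 := runs_reject s₀ (s₃.setReg 6 0) hA4 hB3 (fun i hi => by
      rw [OfferedAt, h94, hA4.arr 0 (by decide), hA4.arr 5 (by decide)]
      exact h9 _ (hinc i hi)) (j := j) hj h1 h2 fun j' hj' hv => by
        have := h3 j' hj' (show s₀.arr 4 j' < s₂.arr 10 j' by rw [h10 j' hj']; exact hv)
        simp only [h10 j h1, h10 j' hj'] at this
        omega
    refine H4.frame.mono le_rfl fun s ⟨hR, hr, ha⟩ => ⟨fun e he => ?_, Or.inr ⟨?_, hR⟩⟩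
    · rw [ha 9 (by decide), h94]
      exact h9 e he
    · rw [hr 22 (by decide)]
      exact h22

end DA

/-! ### The memory as a state of deferred acceptance -/

theorem array_lt {l : List ℕ} {i : ℕ} (h : i < l.length) : array l i = l[i] := by
  simp [array, h]

theorem array_ofFn {k : ℕ} (g : Fin k → ℕ) (i : Fin k) : array (List.ofFn g) i = g i := by
  rw [array_lt (by simp)]
  simp

theorem array_ofFn_of_le {k : ℕ} (g : Fin k → ℕ) {i : ℕ} (h : k ≤ i) : array (List.ofFn g) i = 0 := by
  simp [array, h]

namespace OLC

variable {W F : Type*} [DecidableEq W] [DecidableEq F] {n : ℕ} {I : OLC W F (Fin n)}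

theorem auxiliary_quota_le {f : F} {L : Finset (Fin n)} (hL : L ∈ I.laminar f) :
    I.auxiliary.quota f (allCopies L) ≤ I.quota f L := by
  simp only [auxiliary, proj_allCopies, hL, if_true]
  split_ifs <;> omega

/-- If at most one copy of each contract is offered, then only original quotas can be violated; the
program may therefore ignore the added constraints. -/
theorem exists_of_auxiliary_violated {f : F} {S K : Finset (Fin n × Fin 3)}
    (hS : ∀ i, (S ∩ allCopies {i}).card ≤ 1) (hK : K ∈ I.auxiliary.laminar f)
    (hv : I.auxiliary.quota f K < (S ∩ K).card) :
    ∃ L ∈ I.laminar f, K = allCopies L ∧ I.quota f L < (S ∩ allCopies L).card := by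
  obtain ⟨L, rfl, hL⟩ := mem_auxiliary_laminar.1 hK
  simp only [auxiliary, proj_allCopies] at hv
  split_ifs at hv with h1 h2
  · obtain ⟨i, rfl⟩ := Finset.card_eq_one.1 h1
    have := hS i
    exact ⟨_, h2, rfl, by omega⟩
  · obtain ⟨i, rfl⟩ := Finset.card_eq_one.1 h1
    have := hS i
    omega
  · rcases hL with hL | ⟨i, hi, rfl⟩
    · exact ⟨L, hL, rfl, hv⟩
    · simp at h1

end OLC

namespace DA

variable {nW nF n : ℕ} {I : OLC (Fin nW) (Fin nF) (Fin n)}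

/-- A number that exceeds all places. -/
def bound (I : OLC (Fin nW) (Fin nF) (Fin n)) : ℕ :=
  2 * (∑ e, (place (I.workerPref (I.worker e)) e + place (I.firmPref (I.firm e)) e)) + 2

theorem place_lt_bound (I : OLC (Fin nW) (Fin nF) (Fin n)) (e : Fin n) :
    2 * place (I.workerPref (I.worker e)) e + 1 < bound I ∧
      place (I.firmPref (I.firm e)) e < bound I := by
  have := Finset.single_le_sum (f := fun e => place (I.workerPref (I.worker e)) e +
    place (I.firmPref (I.firm e)) e) (fun _ _ => Nat.zero_le _) (Finset.mem_univ e)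
  simp only [bound] at *
  omega

theorem place_pos_iff {P : PrefList (Fin n)} {e : Fin n} : 0 < place P e ↔ Listed P e := by
  classical
  rw [place_eq]
  split_ifs with h <;> simp [h]

theorem place_of_listed {P : PrefList (Fin n)} {e : Fin n} (h : Listed P e) :
    place P e = pos P e + 1 := by
  classical
  rw [place_eq, if_pos h]

theorem workerKey_lt {B p r r' : ℕ} (hB : 2 ≤ B) (h : r < r') (h' : r' < 3) :
    workerKey B p r < workerKey B p r' := by
  simp only [workerKey]
  split_ifs <;> omega

theorem workerKey_le {B p r r' : ℕ} (hB : 2 ≤ B) (h : r ≤ r') (h' : r' < 3) :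
    workerKey B p r ≤ workerKey B p r' := by
  rcases h.lt_or_eq with h | rfl
  · exact (workerKey_lt hB h h').le
  · exact le_rfl

/-- The factor `2` makes room for the first and second copies of a tie, and `bound I` moves the
third copies behind all of them. Equal keys mean the same copy number in the same tie, which the
index decides. -/
theorem prefers_iff_workerKey (hI : I.IsInstance) {w : Fin nW} {e d : Fin n} {i j : Fin 3}
    (he : I.worker e = w) (hd : I.worker d = w) :
    Prefers (I.auxiliary.workerPref w) (e, i) (d, j) ↔
      Listed (I.workerPref w) e ∧ Listed (I.workerPref w) d ∧
      (workerKey (bound I) (place (I.workerPref w) e) i <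
          workerKey (bound I) (place (I.workerPref w) d) j ∨
        workerKey (bound I) (place (I.workerPref w) e) i =
          workerKey (bound I) (place (I.workerPref w) d) j ∧ e < d) := by
  rw [OLC.prefers_auxiliary_worker hI]
  refine and_congr_right fun hle => and_congr_right fun hld => ?_
  have h1 := (place_lt_bound I e).1
  have h2 := (place_lt_bound I d).1
  rw [he] at h1
  rw [hd] at h2
  rw [place_of_listed hle, place_of_listed hld] at *
  fin_cases i <;> fin_cases j <;> simp [workerKey] <;> omega

/-- The memory contains the input. -/
structure HasInput (c : Presentation I) (s : Mem) : Prop where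
  reg : ∀ r < 5, s.reg r = c.input.reg r
  arr : ∀ a < 7, s.arr a = c.input.arr a

section Input

variable {c : Presentation I} {s : Mem}

theorem HasInput.reg_zero (h : HasInput c s) : s.reg 0 = n := by
  rw [h.reg 0 (by decide)]; rfl

theorem HasInput.reg_one (h : HasInput c s) : s.reg 1 = c.m := by
  rw [h.reg 1 (by decide)]; rfl

theorem HasInput.reg_two (h : HasInput c s) : s.reg 2 = c.incidence.length := by
  rw [h.reg 2 (by decide)]; rfl

theorem HasInput.worker (h : HasInput c s) (e : Fin n) : s.arr 0 e = I.worker e := by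
  rw [h.arr 0 (by decide)]
  exact array_ofFn _ e

theorem HasInput.workerPlace (h : HasInput c s) (e : Fin n) :
    s.arr 2 e = place (I.workerPref (I.worker e)) e := by
  rw [h.arr 2 (by decide)]
  exact array_ofFn _ e

theorem HasInput.firmPlace (h : HasInput c s) (e : Fin n) :
    s.arr 3 e = place (I.firmPref (I.firm e)) e := by
  rw [h.arr 3 (by decide)]
  exact array_ofFn _ e

theorem HasInput.quota (h : HasInput c s) (j : Fin c.m) :
    s.arr 4 j = I.quota (c.constraint j).1 (c.constraint j).2 := by
  rw [h.arr 4 (by decide)]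
  exact array_ofFn _ j

theorem HasInput.contract (h : HasInput c s) {i : ℕ} (hi : i < c.incidence.length) :
    s.arr 5 i = c.incidence[i].1 := by
  rw [h.arr 5 (by decide)]
  exact (array_lt (by simpa using hi)).trans (by simp)

theorem HasInput.constraint (h : HasInput c s) {i : ℕ} (hi : i < c.incidence.length) :
    s.arr 6 i = c.incidence[i].2 := by
  rw [h.arr 6 (by decide)]
  exact (array_lt (by simpa using hi)).trans (by simp)

theorem HasInput.workerPlace_lt (h : HasInput c s) (e : ℕ) : 2 * s.arr 2 e + 1 < bound I := by
  by_cases he : e < n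
  · rw [h.workerPlace ⟨e, he⟩]
    exact (place_lt_bound I _).1
  · rw [h.arr 2 (by decide)]
    have : c.input.arr 2 e = 0 := array_ofFn_of_le _ (by omega)
    rw [this, bound]
    omega

theorem HasInput.firmPlace_lt (h : HasInput c s) (e : ℕ) : s.arr 3 e < bound I := by
  by_cases he : e < n
  · rw [h.firmPlace ⟨e, he⟩]
    exact (place_lt_bound I _).2
  · rw [h.arr 3 (by decide)]
    have : c.input.arr 3 e = 0 := array_ofFn_of_le _ (by omega)
    rw [this, bound]
    omega

end Input

/-- The rejected copies. -/
def rejected (n : ℕ) (s : Mem) : Finset (Fin n × Fin 3) :=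
  Finset.univ.filter fun x => (x.2 : ℕ) < s.arr 8 x.1

theorem mem_rejected {s : Mem} {e : Fin n} {i : Fin 3} : (e, i) ∈ rejected n s ↔ (i : ℕ) < s.arr 8 e := by
  simp [rejected]

variable {c : Presentation I} {s : Mem}

/-- A worker ranks the copies of one contract in the order of their numbers, so only the first
remaining copy can be offered, and it suffices to compare current copies. -/
theorem mem_offers_rejected (hI : I.IsInstance) (h : HasInput c s) {e : Fin n} {i : Fin 3} :
    (e, i) ∈ I.auxiliary.offers (rejected n s) ↔ (i : ℕ) = s.arr 8 e ∧ Offered (bound I) s e := by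
  have hB : 2 ≤ bound I := by simp [bound]
  rw [OLC.mem_offers, mem_rejected, OLC.listed_auxiliary_worker]
  change _ ∧ Listed (I.workerPref (I.worker e)) e ∧
    (∀ d, d ∉ rejected n s → ¬ Prefers (I.auxiliary.workerPref (I.worker e)) d (e, i)) ↔ _
  constructor
  · rintro ⟨hi, hl, hmin⟩
    have hie : (i : ℕ) = s.arr 8 e := by
      by_contra hne
      have hlt : s.arr 8 e < i := by omega
      refine hmin (e, ⟨s.arr 8 e, by omega⟩) (by simp [mem_rejected]) ?_
      rw [prefers_iff_workerKey hI rfl rfl]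
      exact ⟨hl, hl, Or.inl (workerKey_lt hB hlt i.2)⟩
    refine ⟨hie, by rw [h.reg_zero]; exact e.2, ⟨?_, by omega⟩, fun y hy hw hact => ?_⟩
    · rw [h.workerPlace]
      exact place_pos_iff.2 hl
    · rw [h.reg_zero] at hy
      obtain ⟨d, rfl⟩ : ∃ d : Fin n, y = d := ⟨⟨y, hy⟩, rfl⟩
      rw [h.worker, h.worker] at hw
      have hw : I.worker d = I.worker e := Fin.ext hw
      have hd := hmin (d, ⟨s.arr 8 d, hact.2⟩) (by simp [mem_rejected])
      have hld := place_pos_iff.1 ((h.workerPlace d) ▸ hact.1)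
      rw [hw] at hld
      rw [prefers_iff_workerKey hI hw rfl] at hd
      rw [h.workerPlace, h.workerPlace, hw, ← hie]
      simp only [hl, hld, true_and, Fin.lt_def] at hd
      omega
  · rintro ⟨hie, hlt, hact, hmin⟩
    refine ⟨by omega, place_pos_iff.1 ((h.workerPlace e) ▸ hact.1), fun ⟨d, j⟩ hd hp => ?_⟩
    rw [mem_rejected] at hd
    have hw : I.worker d = I.worker e :=
      hI.worker_eq (OLC.listed_auxiliary_worker.1 hp.listed_left)
    rw [prefers_iff_workerKey hI hw rfl] at hp
    have hactd : Active s d := ⟨by rw [h.workerPlace, hw]; exact place_pos_iff.2 hp.1, by omega⟩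
    have h1 := hmin d (by rw [h.reg_zero]; exact d.2) (by rw [h.worker, h.worker, hw]) hactd
    have h2 := workerKey_le (p := place (I.workerPref (I.worker e)) d) hB (not_lt.1 hd) j.2
    rw [h.workerPlace, h.workerPlace, hw, ← hie] at h1
    have h3 := hp.2.2
    simp only [Fin.lt_def] at h3
    omega

/-- Each offered contract has exactly one offered copy, and exactly one incidence with each
constraint that contains it, since the list of incidences has no duplicates. -/
theorem load_eq_card (hI : I.IsInstance) (h : HasInput c s) (j : Fin c.m) :
    load (bound I) s j =
      (I.auxiliary.offers (rejected n s) ∩ allCopies (c.constraint j).2).card := by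
  classical
  have h1 : (I.auxiliary.offers (rejected n s) ∩ allCopies (c.constraint j).2).card =
      (Finset.univ.filter fun e : Fin n => Offered (bound I) s e ∧ e ∈ (c.constraint j).2).card := by
    refine Finset.card_nbij Prod.fst ?_ ?_ ?_
    · rintro ⟨e, i⟩ he
      rw [Finset.mem_coe, Finset.mem_inter, mem_allCopies, mem_offers_rejected hI h] at he
      simpa using ⟨he.1.2, he.2⟩
    · rintro ⟨e, i⟩ he ⟨e', i'⟩ he' heq
      rw [Finset.mem_coe, Finset.mem_inter, mem_offers_rejected hI h] at he he'
      obtain rfl : e = e' := heq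
      exact Prod.ext rfl (Fin.ext (he.1.1.trans he'.1.1.symm))
    · intro e he
      simp only [Finset.coe_filter, Finset.mem_univ, true_and, Set.mem_ofPred_eq] at he
      refine ⟨(e, ⟨s.arr 8 e, he.1.2.1.2⟩), ?_, rfl⟩
      rw [Finset.mem_coe, Finset.mem_inter, mem_allCopies, mem_offers_rejected hI h]
      exact ⟨⟨rfl, he.1⟩, he.2⟩
  rw [h1, ← Finset.card_map Fin.valEmbedding, load, h.reg_two]
  refine Finset.card_nbij (s.arr 5) ?_ ?_ ?_
  · intro i hi
    simp only [Finset.coe_filter, Finset.mem_range, Set.mem_ofPred_eq] at hi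
    obtain ⟨hi, hij, ho⟩ := hi
    rw [h.constraint hi] at hij
    rw [h.contract hi] at ho ⊢
    simp only [Finset.coe_map, Set.mem_image, Finset.coe_filter, Finset.mem_univ, true_and,
      Set.mem_ofPred_eq]
    refine ⟨c.incidence[i].1, ⟨ho, ?_⟩, rfl⟩
    rw [← c.mem_incidence, ← Fin.ext hij]
    exact List.getElem_mem hi
  · intro i hi i' hi' heq
    simp only [Finset.coe_filter, Finset.mem_range, Set.mem_ofPred_eq] at hi hi'
    have h2 := hi.2.1.trans hi'.2.1.symm
    rw [h.constraint hi.1, h.constraint hi'.1] at h2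
    rw [h.contract hi.1, h.contract hi'.1] at heq
    exact (c.nodup.getElem_inj_iff).1 (Prod.ext (Fin.ext heq) (Fin.ext h2))
  · intro x hx
    simp only [Finset.coe_map, Set.mem_image, Finset.coe_filter, Finset.mem_univ, true_and,
      Set.mem_ofPred_eq] at hx
    obtain ⟨e, ⟨ho, he⟩, rfl⟩ := hx
    obtain ⟨i, hi, hie⟩ := List.getElem_of_mem ((c.mem_incidence e j).2 he)
    refine ⟨i, ?_, ?_⟩
    · simp only [Finset.coe_filter, Finset.mem_range, Set.mem_ofPred_eq]
      rw [h.constraint hi, h.contract hi, hie]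
      exact ⟨hi, rfl, ho⟩
    · rw [h.contract hi, hie]
      rfl

theorem card_offers_inter_le_one (hI : I.IsInstance) (h : HasInput c s) (e : Fin n) :
    (I.auxiliary.offers (rejected n s) ∩ allCopies {e}).card ≤ 1 := by
  refine Finset.card_le_one.2 ?_
  rintro ⟨d, i⟩ hd ⟨d', i'⟩ hd'
  rw [Finset.mem_inter, mem_allCopies, Finset.mem_singleton, mem_offers_rejected hI h] at hd hd'
  obtain ⟨⟨h1, -⟩, rfl⟩ := hd
  obtain ⟨⟨h2, -⟩, h3⟩ := hd'
  obtain rfl : d' = d := h3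
  exact Prod.ext rfl (Fin.ext (h1.trans h2.symm))

theorem firmFeasible_offers (hI : I.IsInstance) (h : HasInput c s)
    (hload : ∀ j < s.reg 1, load (bound I) s j ≤ s.arr 4 j) (f : Fin nF) :
    I.auxiliary.FirmFeasible f (I.auxiliary.offers (rejected n s)) := by
  rw [OLC.auxiliary_firmFeasible_iff hI]
  refine ⟨fun e _ => card_offers_inter_le_one hI h e, fun L hL => ?_⟩
  rcases L.eq_empty_or_nonempty with rfl | hne
  -- The empty set is not among the numbered constraints, but its quota holds trivially.
  · simp [allCopies]
  · obtain ⟨j, hj⟩ := (c.mem_range f L).2 ⟨hL, hne⟩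
    have := hload j (by rw [h.reg_one]; exact j.2)
    rwa [load_eq_card hI h, h.quota, hj] at this

/-- The step of the program is a step of the abstract algorithm. -/
theorem Rejects.sound (hI : I.IsInstance) (hF : I.TiesOnlyInWorkers) (h : HasInput c s)
    (hs : OLC.Sound (OLC.isStrictInstance_auxiliary hI).toIsInstance (rejected n s)) {s' : Mem}
    (hrej : Rejects (bound I) s s') :
    OLC.Sound (OLC.isStrictInstance_auxiliary hI).toIsInstance (rejected n s') ∧
      (rejected n s')ᶜ.card < (rejected n s)ᶜ.card := by
  obtain ⟨j, hj, i, hi, hviol, hmin, hij, ho, hworst, hlev⟩ := hrej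
  rw [h.reg_one] at hj hmin
  rw [h.reg_two] at hi hworst
  obtain ⟨j, rfl⟩ : ∃ j' : Fin c.m, j = j' := ⟨⟨j, hj⟩, rfl⟩
  rw [h.constraint hi] at hij
  have hij : c.incidence[i].2 = j := Fin.ext hij
  rw [h.contract hi] at ho hlev
  simp only [h.contract hi] at hworst
  set d := c.incidence[i].1 with hd
  have hdL : d ∈ (c.constraint j).2 := by
    rw [← c.mem_incidence, ← hij]
    exact List.getElem_mem hi
  set L := (c.constraint j).2 with hL
  set f := (c.constraint j).1 with hf
  have hLf : L ∈ I.laminar f := ((c.mem_range f L).1 ⟨j, rfl⟩).1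
  set O := I.auxiliary.offers (rejected n s) with hO
  have hdO : (d, ⟨s.arr 8 d, ho.2.1.2⟩) ∈ O := (mem_offers_rejected hI h).2 ⟨rfl, ho⟩
  have hA := OLC.isStrictInstance_auxiliary hI
  rw [load_eq_card hI h, h.quota] at hviol
  have hcl := OLC.mem_closure_better hA.toIsInstance hA.firms (O := O) (L := allCopies L) (f := f)
    (OLC.mem_auxiliary_laminar.2 ⟨L, rfl, Or.inl hLf⟩)
    ((OLC.auxiliary_quota_le hLf).trans_lt hviol) (fun K hK hv => ?_)
    (d := (d, ⟨s.arr 8 d, ho.2.1.2⟩)) (Finset.mem_inter.2 ⟨hdO, mem_allCopies.2 hdL⟩) ?_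
  -- The rejected copies of a contract are those with numbers below its level, so an increment
  -- rejects exactly the current copy.
  · have hrej : rejected n s' = insert (d, ⟨s.arr 8 d, ho.2.1.2⟩) (rejected n s) := by
      ext ⟨e, k⟩
      rw [Finset.mem_insert, mem_rejected, mem_rejected, hlev, Function.update_apply]
      by_cases hed : e = d
      · subst hed
        simp only [if_true, Prod.mk.injEq, true_and, Fin.ext_iff]
        omega
      · have : (e : ℕ) ≠ d := fun h => hed (Fin.ext h)
        simp [hed, this]
    rw [hrej]
    refine ⟨hs.insert_offer hA hcl, ?_⟩
    rw [Finset.compl_insert]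
    exact Finset.card_erase_lt_of_mem (Finset.mem_compl.2 (OLC.mem_offers.1 hdO).1)
  -- Any violated set of the auxiliary instance comes from a nonempty original one, so the program
  -- has compared its load.
  · obtain ⟨L', hL', rfl, hv'⟩ :=
      OLC.exists_of_auxiliary_violated (card_offers_inter_le_one hI h) hK hv
    have hne : L'.Nonempty := by
      obtain ⟨x, hx⟩ := Finset.card_pos.1 ((Nat.zero_le _).trans_lt hv')
      exact ⟨x.1, mem_allCopies.1 (Finset.mem_inter.1 hx).2⟩
    obtain ⟨j', hj'⟩ := (c.mem_range f L').2 ⟨hL', hne⟩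
    have := hmin j' j'.2
    rw [load_eq_card hI h, load_eq_card hI h, h.quota, hj'] at this
    exact this hv'
  · rintro ⟨e, k⟩ he hp
    rw [Finset.mem_inter, mem_allCopies, mem_offers_rejected hI h] at he
    obtain ⟨⟨hk, hoe⟩, heL⟩ := he
    obtain ⟨i', hi', hie⟩ := List.getElem_of_mem ((c.mem_incidence e j).2 heL)
    have hle := hworst i' hi' (by rw [h.constraint hi', hie]) (by rw [h.contract hi', hie]; exact hoe)
    rw [h.contract hi', hie] at hle
    simp only [h.firmPlace, ← hk] at hle
    have hfe := hI.laminar_sub f L hLf e heL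
    have hfd := hI.laminar_sub f L hLf d hdL
    have h1 := (place_lt_bound I e).2
    have h2 := (place_lt_bound I d).2
    rw [hfe] at hle h1
    rw [hfd] at hle h2
    rw [OLC.prefers_auxiliary_firm hI hF] at hp
    obtain ⟨hld, hle', hp⟩ := hp
    rw [place_of_listed hld] at hle h2
    rw [place_of_listed hle'] at hle h1
    rw [prefers_iff (hI.firmPref_on f).2.1] at hp
    simp only [firmKey, Fin.ext_iff, ne_eq, Fin.val_zero] at hle hp
    -- A worse offer would have a smaller key than the minimum that was found; two different copies
    -- of one contract are never both current.
    rcases hp with ⟨h3, h4⟩ | ⟨h3, h4 | ⟨h4, h5, h6⟩⟩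
    · rw [if_neg h3, if_pos h4] at hle
      omega
    · split_ifs at hle <;> omega
    · have : (d : ℕ) = e := h4
      rw [this] at h5
      simp at h5 h6
      omega

end DA

/-! ### The mechanism and the size of its input -/

open Classical in
/-- The projection of the worker-optimal stable matching of the auxiliary instance. -/
noncomputable def mechanism : Mechanism := fun _ _ _ I =>
  -- The default value is irrelevant: a worker-optimal matching exists for the data that satisfy
  -- `IsInstance`.
  if h : ∃ S, I.auxiliary.IsWorkerOptimal S then proj h.choose else ∅

theorem mechanism_eq {nW nF n : ℕ} {I : OLC (Fin nW) (Fin nF) (Fin n)} (hI : I.IsInstance)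
    {S : Finset (Fin n × Fin 3)} (hS : I.auxiliary.IsWorkerOptimal S) :
    mechanism nW nF n I = proj S := by
  have h : ∃ S, I.auxiliary.IsWorkerOptimal S := ⟨S, hS⟩
  rw [mechanism, dif_pos h, h.choose_spec.eq (OLC.isStrictInstance_auxiliary hI) hS]

theorem workerStrategyProof_mechanism : WorkerStrategyProof mechanism := by
  intro nW nF n I hI hF w P hP
  have hI' := hI.replaceList hP
  obtain ⟨S, hS⟩ := OLC.exists_isWorkerOptimal (OLC.isStrictInstance_auxiliary hI)
  obtain ⟨T, hT⟩ := OLC.exists_isWorkerOptimal (OLC.isStrictInstance_auxiliary hI')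
  rw [mechanism_eq hI hS, mechanism_eq hI' hT]
  by_cases h : ∃ b ∈ I.ofWorker (proj T) w, Listed (I.workerPref w) b
  · obtain ⟨b, hb, hl⟩ := h
    have hb' := OLC.mem_ofWorker.1 hb
    obtain ⟨a, ha, hw, hp⟩ :=
      OLC.exists_mem_proj_of_replaceList hI hF hS hT.1 hb'.1 hb'.2 hl
    exact Or.inr ⟨a, OLC.mem_ofWorker.2 ⟨ha, hw⟩, b, hb, hw ▸ (hS.1.1.proj hI).1 a ha, hl, hp⟩
  · exact Or.inl fun d hd hl => h ⟨d, hd, hl⟩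

section Size

variable {nW nF n : ℕ} {I : OLC (Fin nW) (Fin nF) (Fin n)}

/-- Sets through `e` belong to the family of its firm and meet pairwise, so by laminarity they form
a chain. -/
theorem card_constraints_le_nesting (hI : I.IsInstance) (c : Presentation I) (e : Fin n) :
    (Finset.univ.filter fun j => e ∈ (c.constraint j).2).card ≤ I.nesting := by
  classical
  have hlam : ∀ j, (c.constraint j).2 ∈ I.laminar (c.constraint j).1 := fun j =>
    ((c.mem_range _ _).1 ⟨j, rfl⟩).1
  have hfirm : ∀ j, e ∈ (c.constraint j).2 → (c.constraint j).1 = I.firm e := fun j hj =>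
    (hI.laminar_sub _ _ (hlam j) e hj).symm
  set J := Finset.univ.filter fun j => e ∈ (c.constraint j).2 with hJ
  have hmem : ∀ j, j ∈ J ↔ e ∈ (c.constraint j).2 := fun j => by simp [hJ]
  have hinj : Set.InjOn (fun j => (c.constraint j).2) (J : Set (Fin c.m)) := by
    intro j hj j' hj' heq
    rw [Finset.mem_coe, hmem] at hj hj'
    exact c.injective (Prod.ext ((hfirm j hj).trans (hfirm j' hj').symm) heq)
  rw [← Finset.card_image_of_injOn hinj]
  have hC : J.image (fun j => (c.constraint j).2) ⊆ I.laminar (I.firm e) := by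
    intro L hL
    obtain ⟨j, hj, rfl⟩ := Finset.mem_image.1 hL
    exact hfirm j ((hmem j).1 hj) ▸ hlam j
  have hchain : IsChain (· ⊆ ·) (J.image (fun j => (c.constraint j).2) : Set (Finset (Fin n))) := by
    intro L hL K hK _
    have hL' := hC (Finset.mem_coe.1 hL)
    have hK' := hC (Finset.mem_coe.1 hK)
    obtain ⟨j, hj, rfl⟩ := Finset.mem_image.1 (Finset.mem_coe.1 hL)
    obtain ⟨k, hk, rfl⟩ := Finset.mem_image.1 (Finset.mem_coe.1 hK)
    rcases hI.laminar _ _ hL' _ hK' with h | h | h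
    · exact Or.inl h
    · exact Or.inr h
    · exact absurd ((hmem k).1 hk) (Finset.disjoint_left.1 h ((hmem j).1 hj))
  refine le_trans ?_ (Finset.le_sup (f := fun f => nestingLevel (I.laminar f))
    (Finset.mem_univ (I.firm e)))
  unfold nestingLevel
  refine Finset.le_sup (f := Finset.card) ?_
  rw [Finset.mem_filter]
  exact ⟨Finset.mem_powerset.2 hC, hchain⟩

theorem length_incidence_le (hI : I.IsInstance) (c : Presentation I) :
    c.incidence.length ≤ n * I.nesting := by
  classical
  rw [← List.toFinset_card_of_nodup c.nodup,
    Finset.card_eq_sum_card_fiberwise (f := Prod.fst) (t := Finset.univ)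
      fun _ _ => Finset.mem_univ _]
  refine (Finset.sum_le_card_nsmul _ _ I.nesting fun e _ => ?_).trans (by simp)
  refine le_trans ?_ (card_constraints_le_nesting hI c e)
  refine Finset.card_le_card_of_injOn Prod.snd ?_ ?_
  · rintro ⟨e', j⟩ hx
    simp only [Finset.mem_coe, Finset.mem_filter, List.mem_toFinset, c.mem_incidence] at hx
    obtain ⟨h1, rfl⟩ := hx
    simpa using h1
  · rintro ⟨e', j⟩ hx ⟨e'', j'⟩ hx' heq
    simp only [Finset.mem_coe, Finset.mem_filter] at hx hx'
    exact Prod.ext (hx.2.trans hx'.2.symm) heq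

/-- Numbered constraints are nonempty, so each occurs in an incidence; without this the number of
rounds times `c.m` would not be under control. -/
theorem card_constraints_le_length (c : Presentation I) : c.m ≤ c.incidence.length := by
  classical
  have h : ∀ j, ∃ e, (e, j) ∈ c.incidence := by
    intro j
    obtain ⟨e, he⟩ := ((c.mem_range _ _).1 ⟨j, rfl⟩).2
    exact ⟨e, (c.mem_incidence e j).2 he⟩
  choose g hg using h
  calc c.m = (Finset.univ.image fun j => (g j, j)).card := by
        rw [Finset.card_image_of_injective _ fun j j' h => (Prod.ext_iff.1 h).2, Finset.card_univ,
          Fintype.card_fin]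
    _ ≤ c.incidence.toFinset.card := Finset.card_le_card fun x hx => by
        obtain ⟨j, -, rfl⟩ := Finset.mem_image.1 hx
        exact List.mem_toFinset.2 (hg j)
    _ ≤ c.incidence.length := c.incidence.toFinset_card_le

end Size

/-! ### Termination and total running time -/

namespace DA

variable {nW nF n : ℕ} {I : OLC (Fin nW) (Fin nF) (Fin n)} {c : Presentation I}

/-- The memory holds the favourite contracts of the workers, and they are the contracts of the
worker-optimal stable matching of the auxiliary instance. -/
def Solved (c : Presentation I) (s : Mem) : Prop := HasInput c s ∧
  ∃ S, I.auxiliary.IsWorkerOptimal S ∧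
    ∀ e : Fin n, s.arr 9 (s.arr 0 e) = e + 1 ↔ e ∈ proj S

theorem mem_proj_offers (hI : I.IsInstance) {s : Mem} (h : HasInput c s) (e : Fin n) :
    e ∈ proj (I.auxiliary.offers (rejected n s)) ↔ Offered (bound I) s e := by
  simp only [mem_proj, mem_offers_rejected hI h]
  exact ⟨fun ⟨_, _, h⟩ => h, fun h => ⟨⟨s.arr 8 e, h.2.1.2⟩, rfl, h⟩⟩

/-- Every round but the last uses up one of the at most `k` remaining copies, which leaves at most
`k + 1` rounds. -/
theorem runs_loop (hI : I.IsInstance) (hF : I.TiesOnlyInWorkers) (k : ℕ) : ∀ s : Mem,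
    HasInput c s → OLC.Sound (OLC.isStrictInstance_auxiliary hI).toIsInstance (rejected n s) →
    s.reg 22 = 0 → s.reg 23 = 0 → (rejected n s)ᶜ.card ≤ k →
    Runs (.loop (.eq 22 23) round) s
      ((k + 1) * (300 * (n + c.m + c.incidence.length + 1) + 1) + 1) (Solved c) := by
  induction k using Nat.strong_induction_on with | _ k ih
  intro s h hs h22 h23 hk
  obtain ⟨t, s', h1, h2, ⟨h3, h4⟩, h5, h6⟩ := (runs_round s h.workerPlace_lt h.firmPlace_lt
    (fun i hi => by
      rw [h.reg_two] at hi
      rw [h.contract hi, h.reg_zero]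
      exact Fin.is_lt _)).frame
  have hloop : (Test.eq 22 23).Holds s := h22.trans h23.symm
  have h' : HasInput c s' := by
    refine ⟨fun r hr => ?_, fun a ha => ?_⟩
    · rw [← h.reg r hr]
      refine h5 r ?_
      revert r
      decide
    · rw [← h.arr a ha]
      refine h6 a ?_
      revert a
      decide
  have h23' : s'.reg 23 = 0 := (h5 23 (by decide)).trans h23
  rw [h.reg_zero, h.reg_one, h.reg_two] at h2
  rcases h4 with ⟨h7, h8, h9⟩ | ⟨h7, h8⟩
  · refine ⟨_, s', .loop_true hloop h1 (.loop_false ?_), ?_, h', _,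
      hs.isWorkerOptimal (OLC.isStrictInstance_auxiliary hI) (firmFeasible_offers hI h ?_), ?_⟩
    · change ¬ s'.reg 22 = s'.reg 23
      rw [h7, h23']
      exact one_ne_zero
    · rw [add_mul]
      omega
    · intro j hj
      exact h9 j hj
    · intro e
      rw [mem_proj_offers hI h, h'.arr 0 (by decide), ← h.arr 0 (by decide)]
      exact h3 e (by rw [h.reg_zero]; exact e.2)
  · obtain ⟨h9, h10⟩ := h8.sound hI hF h hs
    obtain ⟨k, rfl⟩ : ∃ k', k = k' + 1 := ⟨k - 1, by omega⟩
    obtain ⟨t', s'', h11, h12, h13⟩ :=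
      ih k k.lt_succ_self s' h' h9 (h7.trans h22) h23' (by omega)
    refine ⟨_, s'', .loop_true hloop h1 h11, ?_, h13⟩
    rw [add_mul (k + 1)]
    omega

theorem runs_program (hI : I.IsInstance) (hF : I.TiesOnlyInWorkers) (c : Presentation I) :
    Runs program c.input ((3 * n + 1) * (300 * (n + c.m + c.incidence.length + 1) + 1) + 1 +
      50 * (n + 1)) fun s => s.Outputs (mechanism nW nF n I) := by
  have hconst : ∀ (r v : ℕ) (s : Mem), Runs (.const r v) s 1 fun s' => s' = s.setReg r v :=
    fun r v s => ⟨1, _, .const s r v, le_rfl, rfl⟩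
  refine ((hconst 22 0 c.input).seq
    (T₂ := 1 + (((3 * n + 1) * (300 * (n + c.m + c.incidence.length + 1) + 1) + 1) +
      (n * (outputBody.cost + 2) + 2))) ?_).mono ?_ fun _ h => h
  swap
  · have : outputBody.cost ≤ 20 := by decide
    nlinarith
  rintro s rfl
  refine (hconst 23 0 _).seq ?_
  rintro s rfl
  have h : HasInput c ((c.input.setReg 22 0).setReg 23 0) :=
    ⟨fun r hr => (Function.update_of_ne (by omega) _ _).trans (Function.update_of_ne (by omega) _ _),
      fun _ _ => rfl⟩
  have hrej : rejected n ((c.input.setReg 22 0).setReg 23 0) = ∅ := by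
    ext ⟨e, i⟩
    rw [mem_rejected]
    simp [Mem.setReg, Presentation.input]
  -- At the start all levels are zero, so all `3 * n` copies remain and the invariant holds
  -- trivially.
  refine Runs.seq (runs_loop hI hF (3 * n) _ h (hrej ▸ OLC.Sound.empty _) rfl rfl ?_) ?_
  · rw [hrej]
    simp [mul_comm]
  · rintro s ⟨hs, S, hS, hSe⟩
    have hout := runs_output s
    rw [hs.reg_zero] at hout
    refine hout.mono le_rfl fun s' h' e => ?_
    rw [h' e e.2, mechanism_eq hI hS]
    simp only [hSe]

/-- With `N = max 1 n` and `K = max 1 k` there are at most `4 * N` rounds of at most `1201 * N * K`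
steps; the product `4804 * K * N ^ 2` leaves room below `6000` for the linear terms. -/
theorem time_le {n m l k : ℕ} (hm : m ≤ l) (hl : l ≤ n * k) :
    (3 * n + 1) * (300 * (n + m + l + 1) + 1) + 1 + 50 * (n + 1) ≤
      6000 * (max 1 k * (max 1 n) ^ 2) := by
  have h1 : 1 ≤ max 1 k := le_max_left _ _
  have h2 : 1 ≤ max 1 n := le_max_left _ _
  have h3 : l ≤ max 1 n * max 1 k := hl.trans (Nat.mul_le_mul (le_max_right _ _) (le_max_right _ _))
  have h4 : n ≤ max 1 n := le_max_right _ _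
  obtain ⟨K, hK⟩ : ∃ K, K = max 1 k := ⟨_, rfl⟩
  obtain ⟨N, hN⟩ : ∃ N, N = max 1 n := ⟨_, rfl⟩
  rw [← hK] at h1 h3 ⊢
  rw [← hN] at h2 h3 h4 ⊢
  clear hK hN hl
  have h5 : N ≤ N * K := Nat.le_mul_of_pos_right _ h1
  have h6 : 300 * (n + m + l + 1) + 1 ≤ 1201 * (N * K) := by omega
  have h7 : 3 * n + 1 ≤ 4 * N := by omega
  have h8 := Nat.mul_le_mul h7 h6
  have h9 : N * K ≤ N * (N * K) := Nat.le_mul_of_pos_left _ h2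
  have h10 : 4 * N * (1201 * (N * K)) = 4804 * (N * (N * K)) := by ring
  have h11 : K * N ^ 2 = N * (N * K) := by ring
  rw [h10] at h8
  rw [h11]
  linarith

end DA

end SMTI

theorem theorem3 :
    ∃ A : SMTI.Mechanism,
      -- the output is the projection of the worker-optimal stable matching of the auxiliary
      -- instance, and it is a stable matching of at least two thirds of the maximum size
      (∀ (nW nF n : ℕ) (I : SMTI.OLC (Fin nW) (Fin nF) (Fin n)),
        I.IsInstance → I.TiesOnlyInWorkers →
          (∃! S, I.auxiliary.IsWorkerOptimal S) ∧
          (∀ S, I.auxiliary.IsWorkerOptimal S → A nW nF n I = SMTI.proj S) ∧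
          I.IsStable (A nW nF n I) ∧
          ∀ M, I.IsMaxStable M → (2 / 3 : ℝ) * (M.card : ℝ) ≤ ((A nW nF n I).card : ℝ)) ∧
      -- no worker can gain by submitting another list
      SMTI.WorkerStrategyProof A ∧
      -- one program computes the mechanism, in time `O(k * |E| ^ 2)`
      ∃ (p : SMTI.Prog) (C : ℕ),
        ∀ (nW nF n : ℕ) (I : SMTI.OLC (Fin nW) (Fin nF) (Fin n)),
          I.IsInstance → I.TiesOnlyInWorkers → ∀ c : SMTI.Presentation I,
            ∃ (t : ℕ) (s : SMTI.Mem), SMTI.Exec p c.input t s ∧ s.Outputs (A nW nF n I) ∧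
              t ≤ C * (max 1 I.nesting * (max 1 n) ^ 2) := by
  refine ⟨SMTI.mechanism, fun nW nF n I hI hF => ?_, SMTI.workerStrategyProof_mechanism,
    SMTI.DA.program, 6000, fun nW nF n I hI hF c => ?_⟩
  · have hA := SMTI.OLC.isStrictInstance_auxiliary hI
    obtain ⟨S, hS⟩ := SMTI.OLC.exists_isWorkerOptimal hA
    refine ⟨SMTI.OLC.existsUnique_isWorkerOptimal hA, fun S hS => SMTI.mechanism_eq hI hS, ?_,
      fun M hM => ?_⟩
    · rw [SMTI.mechanism_eq hI hS]
      exact hS.1.proj hI hF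
    · rw [SMTI.mechanism_eq hI hS]
      have h : ((2 * M.card : ℕ) : ℝ) ≤ ((3 * (SMTI.proj S).card : ℕ) : ℝ) :=
        Nat.cast_le.2 (SMTI.OLC.two_mul_card_le hI hF hS.1 hM.1)
      push_cast at h
      linarith
  · obtain ⟨t, s, h1, h2, h3⟩ := SMTI.DA.runs_program hI hF c
    exact ⟨t, s, h1, h3, h2.trans (SMTI.DA.time_le (SMTI.card_constraints_le_length c)
      (SMTI.length_incidence_le hI c))⟩
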